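/- Let $M$ be a (Hausdorff) smooth manifold of dimension $n\ge 1$ and let $F$ be a Finsler structure on $M$: a smooth function $F:TM_0=TM\setminus 0\to(0,\infty)$ with $F(x,\lambda y)=\lambda F(x,y)$ for $\lambda>0$ and with $(g_{ij})=(\tfrac12[F^2]_{y^iy^j})$ positive definite on $TM_0$. Let $\pi:SM=TM_0/\mathbb R^+\to M$ be the projective sphere bundle. Put $G^i=\tfrac14 g^{ij}([F^2]_{y^jx^k}y^k-[F^2]_{x^j})$ and $\delta y^i=\tfrac1F\big(dy^i+\tfrac{\partial G^i}{\partial y^j}dx^j\big)$. For a local orthonormal coframe $\omega^i=v^i_j\,dx^j$ $(1\le i\le n)$ of $g=g_{ij}\,dx^i\otimes dx^j$ on $\pi^*TM$ with $\omega^n=F_{y^i}dx^i$, put $\omega^{n+\alpha}=-v^\alpha_j\,\delta y^j$ $(1\le\alpha\le n-1)$; then $\omega^1,\dots,\omega^{2n-1}$ is a local coframe of $SM$. For $\epsilon>0$ let $$g^{T(SM),\epsilon}=\frac1{\epsilon^2}\sum_{i=1}^n\omega^i\otimes\omega^i+\sum_{\alpha=1}^{n-1}\omega^{n+\alpha}\otimes\omega^{n+\alpha},$$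 let $\langle\cdot,\cdot\rangle=g^{T(SM)}=g^{T(SM),1}$ be the Sasaki-type metric on $SM$, and let $\nabla^{T(SM),\epsilon}$ and $\nabla^{T(SM)}$ be the Levi-Civita connections of $g^{T(SM),\epsilon}$ and $g^{T(SM)}$. Let $V(SM)=\ker d\pi$, let $H(SM)$ be its orthogonal complement with respect to $g^{T(SM)}$, and let $p^\perp$ be the orthogonal projection of $T(SM)$ onto $H(SM)$. Let $\widetilde\nabla$ be the Bott connection on $H(SM)$, given for sections $U$ of $H(SM)$ by $\widetilde\nabla_XU=p^\perp[X,U]$ if $X$ is vertical and $\widetilde\nabla_XU=p^\perp\nabla^{T(SM)}_XU$ if $X$ is horizontal. Let $\widetilde\nabla^*$ be its dual connection, $d\langle U,V\rangle=\langle\widetilde\nabla U,V\rangle+\langle U,\widetilde\nabla^*V\rangle$ for all sections $U,V$ of $H(SM)$, and let $\widehat\nabla=\widetilde\nabla+H$ with $2H=\widetilde\nabla^*-\widetilde\nabla$ be the symmetrized Bott connection, called the Cartan connection of $(M,F)$. Then $$\lim_{\epsilon\to0^+}p^\perp\nabla^{T(SM),\epsilon}p^\perp=\widehat\nabla ,$$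 that is, for every smooth vector field $X$ on $SM$ and every smooth section $U$ of $H(SM)$, $p^\perp\nabla^{T(SM),\epsilon}_X(p^\perp U)\to\widehat\nabla_XU$ as $\epsilon\to0^+$ at every point of $SM$, and uniformly on every compact subset of $SM$ (in the norm of $g^{T(SM)}$). -/

import Mathlib

open Set Filter Topology Manifold Bundle
open scoped ContDiff

noncomputable section

namespace Finsler

/-- The model space `ℝⁿ` with its Euclidean norm. -/
abbrev Eu (n : ℕ) : Type := EuclideanSpace ℝ (Fin n)

set_option linter.unusedSectionVars false

section SphereBundle

variable (m : ℕ) (M : Type*) [TopologicalSpace M] [ChartedSpace (Eu (m + 1)) M]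
  [IsManifold 𝓘(ℝ, Eu (m + 1)) ∞ M]

/-- The tangent bundle `TM`, a smooth manifold of dimension `2n` with `n = m + 1`. -/
abbrev TM : Type _ := TangentBundle 𝓘(ℝ, Eu (m + 1)) M

/-- The slit tangent bundle `TM₀ = TM \ 0`. -/
abbrev TM₀ : Type _ := {v : TM m M // v.2 ≠ 0}

variable {m M}

/-- The fibrewise dilation of `TM` by `c`. -/
def dil (c : ℝ) (v : TM m M) : TM m M := ⟨v.1, c • v.2⟩

lemma dil_one (v : TM m M) : dil 1 v = v := by
  show (⟨v.1, (1 : ℝ) • v.2⟩ : TM m M) = v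
  rw [one_smul]

lemma dil_dil (c d : ℝ) (v : TM m M) : dil c (dil d v) = dil (c * d) v := by
  show (⟨v.1, c • d • v.2⟩ : TM m M) = ⟨v.1, (c * d) • v.2⟩
  rw [smul_smul]

variable (m M)

/-- Two nonzero tangent vectors are equivalent if they differ by a positive factor. -/
def raySetoid : Setoid (TM₀ m M) where
  r v w := ∃ c : ℝ, 0 < c ∧ w.1 = dil c v.1
  iseqv :=
    { refl := fun v => ⟨1, one_pos, (dil_one v.1).symm⟩
      symm := by
        rintro v w ⟨c, hc, h⟩
        refine ⟨c⁻¹, inv_pos.2 hc, ?_⟩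
        rw [h, dil_dil, inv_mul_cancel₀ hc.ne', dil_one]
      trans := by
        rintro u v w ⟨c, hc, h⟩ ⟨d, hd, h'⟩
        refine ⟨d * c, mul_pos hd hc, ?_⟩
        rw [h', h, dil_dil] }

/-- The projective sphere bundle `SM = TM₀ / ℝ⁺`. -/
def SphereBundle : Type _ := Quotient (raySetoid m M)

instance : TopologicalSpace (SphereBundle m M) :=
  inferInstanceAs (TopologicalSpace (Quotient (raySetoid m M)))

variable {m M}

/-- The quotient map `TM₀ → SM`. -/
def ray (v : TM₀ m M) : SphereBundle m M := Quotient.mk (raySetoid m M) v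

/-- The projection `π : SM → M`. -/
def baseProj : SphereBundle m M → M :=
  Quotient.lift (fun v => v.1.1) (by rintro v w ⟨c, _, h⟩; rw [h]; rfl)

lemma isQuotientMap_ray : IsQuotientMap (ray : TM₀ m M → SphereBundle m M) :=
  isQuotientMap_quotient_mk'

lemma ray_eq_iff {v w : TM₀ m M} : ray v = ray w ↔ ∃ c : ℝ, 0 < c ∧ w.1 = dil c v.1 :=
  Quotient.eq (r := raySetoid m M)

/-- The chart of `TM` with coordinates `(x, y)` induced by the preferred chart of `M` at `x₀`. -/
def tchart (x₀ : M) : OpenPartialHomeomorph (TM m M) (Eu (m + 1) × Eu (m + 1)) :=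
  chartAt (ModelProd (Eu (m + 1)) (Eu (m + 1)))
    (⟨x₀, 0⟩ : TangentBundle 𝓘(ℝ, Eu (m + 1)) M)

lemma mem_tchart_source {x₀ : M} {v : TM m M} :
    v ∈ (tchart x₀).source ↔ v.1 ∈ (chartAt (Eu (m + 1)) x₀).source :=
  TangentBundle.mem_chart_source_iff _ _

lemma mem_tchart_target {x₀ : M} {q : Eu (m + 1) × Eu (m + 1)} :
    q ∈ (tchart x₀).target ↔ q.1 ∈ (chartAt (Eu (m + 1)) x₀).target :=
  TangentBundle.mem_chart_target_iff _ _

lemma tchart_fst (x₀ : M) (v : TM m M) :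
    (tchart x₀ v).1 = chartAt (Eu (m + 1)) x₀ v.1 := rfl

lemma tchart_snd {x₀ : M} {v : TM m M} (hv : v ∈ (tchart x₀).source) :
    (tchart x₀ v).2 =
      (trivializationAt (Eu (m + 1)) (TangentSpace 𝓘(ℝ, Eu (m + 1))) x₀).continuousLinearEquivAt ℝ
        v.1 (mem_tchart_source.1 hv) v.2 := rfl

lemma dil_mem_source {x₀ : M} {v : TM m M} (c : ℝ) (hv : v ∈ (tchart x₀).source) :
    dil c v ∈ (tchart x₀).source := mem_tchart_source.2 (mem_tchart_source.1 hv)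

lemma tchart_dil_snd {x₀ : M} {v : TM m M} (c : ℝ) (hv : v ∈ (tchart x₀).source) :
    (tchart x₀ (dil c v)).2 = c • (tchart x₀ v).2 := by
  rw [tchart_snd hv, tchart_snd (dil_mem_source c hv)]
  exact map_smul _ c v.2

lemma tchart_snd_eq_zero {x₀ : M} {v : TM m M} (hv : v ∈ (tchart x₀).source) :
    (tchart x₀ v).2 = 0 ↔ v.2 = 0 := by
  rw [tchart_snd hv]
  exact ContinuousLinearEquiv.map_eq_zero_iff _

/-- Linear coordinates on `ℝⁿ` whose first coordinate is positive at a given nonzero vector. -/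
lemma exists_coord {y : Eu (m + 1)} (hy : y ≠ 0) :
    ∃ φ : Eu (m + 1) ≃L[ℝ] ℝ × Eu m, 0 < (φ y).1 := by
  have hd : Module.finrank ℝ (Eu (m + 1)) = Module.finrank ℝ (ℝ × Eu m) := by
    simp [add_comm]
  let e : Eu (m + 1) ≃L[ℝ] ℝ × Eu m := ContinuousLinearEquiv.ofFinrankEq hd
  have hey : e y ≠ 0 := by simpa using hy
  obtain ⟨f, hf⟩ := SeparatingDual.exists_continuousLinearEquiv_apply_eq (R := ℝ) hey
    (show ((1 : ℝ), (0 : Eu m)) ≠ 0 by simp)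
  exact ⟨e.trans f, by simp [hf]⟩

/-- The affine coordinates `(x, [y]) ↦ (x, w / a)`, with `(a, w) = φ y`, on nonzero vectors. -/
def affFun (x₀ : M) (φ : Eu (m + 1) ≃L[ℝ] ℝ × Eu m) (v : TM m M) : Eu (m + 1) × Eu m :=
  ((tchart x₀ v).1, (φ (tchart x₀ v).2).1⁻¹ • (φ (tchart x₀ v).2).2)

/-- The vectors over the chart domain at `x₀` whose first `φ`-coordinate is positive. -/
def affDom (x₀ : M) (φ : Eu (m + 1) ≃L[ℝ] ℝ × Eu m) : Set (TM m M) :=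
  {v | v ∈ (tchart x₀).source ∧ 0 < (φ (tchart x₀ v).2).1}

/-- The representative `(x, φ⁻¹ (1, z))` of the point with affine coordinates `(x, z)`. -/
def affInv (x₀ : M) (φ : Eu (m + 1) ≃L[ℝ] ℝ × Eu m) (q : Eu (m + 1) × Eu m) : TM m M :=
  (tchart x₀).symm (q.1, φ.symm (1, q.2))

variable {x₀ : M} {φ : Eu (m + 1) ≃L[ℝ] ℝ × Eu m}

lemma affFun_dil {v : TM m M} (hv : v ∈ (tchart x₀).source) {c : ℝ} (hc : 0 < c) :
    affFun x₀ φ (dil c v) = affFun x₀ φ v := by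
  refine Prod.ext rfl ?_
  show (φ (tchart x₀ (dil c v)).2).1⁻¹ • (φ (tchart x₀ (dil c v)).2).2 = _
  rw [tchart_dil_snd c hv, map_smul, Prod.smul_fst, Prod.smul_snd, smul_smul, smul_eq_mul,
    mul_inv, mul_right_comm, inv_mul_cancel₀ hc.ne', one_mul]
  rfl

lemma dil_mem_affDom {v : TM m M} (hv : v ∈ affDom x₀ φ) {c : ℝ} (hc : 0 < c) :
    dil c v ∈ affDom x₀ φ := by
  refine ⟨dil_mem_source c hv.1, ?_⟩
  rw [tchart_dil_snd c hv.1, map_smul, Prod.smul_fst, smul_eq_mul]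
  exact mul_pos hc hv.2

lemma isOpen_affDom : IsOpen (affDom x₀ φ) := by
  have h : ContinuousOn (fun v : TM m M => (φ (tchart x₀ v).2).1) (tchart x₀).source :=
    (continuous_fst.comp (φ.continuous.comp continuous_snd)).comp_continuousOn
      (tchart x₀).continuousOn
  exact h.isOpen_inter_preimage (tchart x₀).open_source isOpen_Ioi

lemma continuousOn_affFun : ContinuousOn (affFun x₀ φ) (affDom x₀ φ) := by
  have h : ContinuousOn (tchart (M := M) x₀) (affDom x₀ φ) :=
    (tchart x₀).continuousOn.mono fun v hv => hv.1
  have h2 : ContinuousOn (fun v : TM m M => φ (tchart x₀ v).2) (affDom x₀ φ) :=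
    φ.continuous.comp_continuousOn (continuous_snd.comp_continuousOn h)
  exact (continuous_fst.comp_continuousOn h).prodMk
    (((continuous_fst.comp_continuousOn h2).inv₀ fun v hv => hv.2.ne').smul
      (continuous_snd.comp_continuousOn h2))

lemma affInv_coord {q : Eu (m + 1) × Eu m} (hq : q.1 ∈ (chartAt (Eu (m + 1)) x₀).target) :
    tchart x₀ (affInv x₀ φ q) = (q.1, φ.symm (1, q.2)) :=
  (tchart x₀).right_inv (mem_tchart_target.2 hq)

lemma affInv_mem {q : Eu (m + 1) × Eu m} (hq : q.1 ∈ (chartAt (Eu (m + 1)) x₀).target) :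
    affInv x₀ φ q ∈ affDom x₀ φ := by
  refine ⟨(tchart x₀).map_target (mem_tchart_target.2 hq), ?_⟩
  rw [affInv_coord hq]
  simp

lemma ne_zero_of_mem_affDom {v : TM m M} (hv : v ∈ affDom x₀ φ) : v.2 ≠ 0 := by
  intro h
  have h2 := hv.2
  rw [(tchart_snd_eq_zero hv.1).2 h] at h2
  simp at h2

lemma affFun_affInv {q : Eu (m + 1) × Eu m} (hq : q.1 ∈ (chartAt (Eu (m + 1)) x₀).target) :
    affFun x₀ φ (affInv x₀ φ q) = q := by
  simp [affFun, affInv_coord hq]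

lemma affInv_affFun {v : TM m M} (hv : v ∈ affDom x₀ φ) :
    dil (φ (tchart x₀ v).2).1 (affInv x₀ φ (affFun x₀ φ v)) = v := by
  have ht : (affFun x₀ φ v).1 ∈ (chartAt (Eu (m + 1)) x₀).target :=
    mem_tchart_target.1 ((tchart x₀).map_source hv.1)
  have hs := (affInv_mem (φ := φ) ht).1
  refine (tchart x₀).injOn (dil_mem_source _ hs) hv.1 (Prod.ext ?_ ?_)
  · show (tchart x₀ (affInv x₀ φ (affFun x₀ φ v))).1 = _
    rw [affInv_coord ht]
    rfl
  · rw [tchart_dil_snd _ hs, affInv_coord ht]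
    apply φ.injective
    have h0 := hv.2.ne'
    refine Prod.ext ?_ ?_ <;> simp [affFun, smul_smul, h0]

lemma continuousOn_affInv :
    ContinuousOn (affInv (M := M) x₀ φ) ((chartAt (Eu (m + 1)) x₀).target ×ˢ univ) := by
  refine (tchart x₀).continuousOn_symm.comp
    (f := fun q : Eu (m + 1) × Eu m => (q.1, φ.symm ((1 : ℝ), q.2))) ?_ ?_
  · fun_prop
  · intro q hq
    exact mem_tchart_target.2 hq.1

lemma exists_out_ray (v : TM₀ m M) : ∃ c : ℝ, 0 < c ∧ (Quotient.out (ray v)).1 = dil c v.1 :=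
  ray_eq_iff.1 (Quotient.out_eq (ray v)).symm

lemma out_mem_iff {v : TM₀ m M} : (Quotient.out (ray v)).1 ∈ affDom x₀ φ ↔ v.1 ∈ affDom x₀ φ := by
  obtain ⟨c, hc, h⟩ := exists_out_ray v
  rw [h]
  refine ⟨fun hv => ?_, fun hv => dil_mem_affDom hv hc⟩
  have := dil_mem_affDom hv (inv_pos.2 hc)
  rwa [dil_dil, inv_mul_cancel₀ hc.ne', dil_one] at this

lemma affFun_out {v : TM₀ m M} (hv : v.1 ∈ affDom x₀ φ) :
    affFun x₀ φ (Quotient.out (ray v)).1 = affFun x₀ φ v.1 := by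
  obtain ⟨c, hc, h⟩ := exists_out_ray v
  rw [h, affFun_dil hv.1 hc]

lemma isOpen_affSource :
    IsOpen {p : SphereBundle m M | (Quotient.out p).1 ∈ affDom x₀ φ} := by
  rw [← isQuotientMap_ray.isOpen_preimage]
  have : ray ⁻¹' {p : SphereBundle m M | (Quotient.out p).1 ∈ affDom x₀ φ} =
      Subtype.val ⁻¹' affDom x₀ φ := by
    ext v
    exact out_mem_iff
  rw [this]
  exact isOpen_affDom.preimage continuous_subtype_val

open Classical in
/-- The affine chart of `SM` over the chart of `M` at `x₀` in the linear coordinates `φ` of the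
fibre: on its domain `{(x, [y]) : a > 0}` it is `(x, [y]) ↦ (x, w / a)` with `(a, w) = φ y`, and its
inverse is `(x, z) ↦ (x, [φ⁻¹ (1, z)])`. The point `p₀` only serves as a value off the target. -/
def affChart (p₀ : SphereBundle m M) (x₀ : M) (φ : Eu (m + 1) ≃L[ℝ] ℝ × Eu m) :
    OpenPartialHomeomorph (SphereBundle m M) (Eu (m + 1) × Eu m) where
  toFun p := affFun x₀ φ (Quotient.out p).1
  invFun q := if h : (affInv x₀ φ q).2 ≠ 0 then ray ⟨affInv x₀ φ q, h⟩ else p₀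
  source := {p | (Quotient.out p).1 ∈ affDom x₀ φ}
  target := (chartAt (Eu (m + 1)) x₀).target ×ˢ univ
  map_source' p hp := ⟨mem_tchart_target.1 ((tchart x₀).map_source hp.1), trivial⟩
  map_target' q hq := by
    have hm := affInv_mem (φ := φ) hq.1
    rw [dif_pos (ne_zero_of_mem_affDom hm)]
    exact out_mem_iff.2 hm
  left_inv' p hp := by
    have hm : affInv x₀ φ (affFun x₀ φ (Quotient.out p).1) ∈ affDom x₀ φ :=
      affInv_mem (mem_tchart_target.1 ((tchart x₀).map_source hp.1))
    refine (dif_pos (ne_zero_of_mem_affDom hm)).trans ?_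
    refine Eq.trans ?_ (Quotient.out_eq p)
    exact ray_eq_iff.2 ⟨_, hp.2, (affInv_affFun hp).symm⟩
  right_inv' q hq := by
    have hm := affInv_mem (φ := φ) hq.1
    rw [dif_pos (ne_zero_of_mem_affDom hm), affFun_out hm, affFun_affInv hq.1]
  open_source := isOpen_affSource
  open_target := (chartAt (Eu (m + 1)) x₀).open_target.prod isOpen_univ
  continuousOn_toFun := by
    rw [isQuotientMap_ray.continuousOn_isOpen_iff isOpen_affSource]
    refine ContinuousOn.congr (f := fun v : TM₀ m M => affFun x₀ φ v.1) ?_ ?_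
    · exact continuousOn_affFun.comp continuous_subtype_val.continuousOn
        fun v hv => out_mem_iff.1 hv
    · exact fun v hv => affFun_out (out_mem_iff.1 hv)
  continuousOn_invFun := by
    rw [continuousOn_iff_continuous_domRestrict]
    have hm (q : ((chartAt (Eu (m + 1)) x₀).target ×ˢ univ : Set (Eu (m + 1) × Eu m))) :
        (affInv x₀ φ q.1).2 ≠ 0 := ne_zero_of_mem_affDom (affInv_mem q.2.1)
    have h : Continuous fun q : ((chartAt (Eu (m + 1)) x₀).target ×ˢ univ :
        Set (Eu (m + 1) × Eu m)) => ray (M := M) ⟨affInv x₀ φ q.1, hm q⟩ :=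
      isQuotientMap_ray.continuous.comp
        ((continuousOn_iff_continuous_domRestrict.1 continuousOn_affInv).subtype_mk hm)
    refine h.congr fun q => ?_
    rw [Set.domRestrict_apply, dif_pos (hm q)]

lemma exists_coord_at (p : SphereBundle m M) :
    ∃ φ : Eu (m + 1) ≃L[ℝ] ℝ × Eu m, (Quotient.out p).1 ∈ affDom (baseProj p) φ := by
  have hs : (Quotient.out p).1 ∈ (tchart (baseProj p)).source := by
    rw [mem_tchart_source]
    have : baseProj p = (Quotient.out p).1.1 := by
      conv_lhs => rw [← Quotient.out_eq p]
      rfl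
    rw [this]
    exact mem_chart_source _ _
  obtain ⟨φ, h⟩ := exists_coord (fun h => (Quotient.out p).2 ((tchart_snd_eq_zero hs).1 h))
  exact ⟨φ, hs, h⟩

instance : ChartedSpace (Eu (m + 1) × Eu m) (SphereBundle m M) where
  atlas := {c | ∃ p₀ x₀ φ, c = affChart p₀ x₀ φ}
  chartAt p := affChart p (baseProj p) (exists_coord_at p).choose
  mem_chart_source p := (exists_coord_at p).choose_spec
  chart_mem_atlas _ := ⟨_, _, _, rfl⟩

/-- The smooth structure of `SM`, a manifold of dimension `2n - 1 = (m + 1) + m`. -/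
instance : IsManifold 𝓘(ℝ, Eu (m + 1) × Eu m) ∞ (SphereBundle m M) := by
  apply isManifold_of_contDiffOn
  rintro _ _ ⟨p₀, x₀, φ, rfl⟩ ⟨p₁, x₁, ψ, rfl⟩
  have hT : ContDiffOn ℝ ∞ ((tchart (m := m) (M := M) x₀).symm ≫ₕ tchart (m := m) (M := M) x₁)
      ((tchart (m := m) (M := M) x₀).symm ≫ₕ tchart (m := m) (M := M) x₁).source := by
    have h := StructureGroupoid.compatible (contDiffGroupoid ∞ (𝓘(ℝ, Eu (m + 1)).tangent))
      (chart_mem_atlas (ModelProd (Eu (m + 1)) (Eu (m + 1)))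
        (⟨x₀, 0⟩ : TangentBundle 𝓘(ℝ, Eu (m + 1)) M))
      (chart_mem_atlas (ModelProd (Eu (m + 1)) (Eu (m + 1)))
        (⟨x₁, 0⟩ : TangentBundle 𝓘(ℝ, Eu (m + 1)) M))
    have h1 := h.1
    have hr : range (𝓘(ℝ, Eu (m + 1)).tangent) = univ :=
      ModelWithCorners.Boundaryless.range_eq_univ
    simp only [contDiffPregroupoid, hr, inter_univ] at h1
    exact h1
  have hq {q : Eu (m + 1) × Eu m}
      (hq : q ∈ ((affChart p₀ x₀ φ).symm ≫ₕ affChart p₁ x₁ ψ).source) :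
      q.1 ∈ (chartAt (Eu (m + 1)) x₀).target ∧ affInv x₀ φ q ∈ affDom x₁ ψ ∧
      affChart p₁ x₁ ψ ((affChart p₀ x₀ φ).symm q) = affFun x₁ ψ (affInv x₀ φ q) := by
    have h1 : q.1 ∈ (chartAt (Eu (m + 1)) x₀).target := hq.1.1
    have hm := affInv_mem (φ := φ) h1
    have he : (affChart p₀ x₀ φ).symm q = ray ⟨affInv x₀ φ q, ne_zero_of_mem_affDom hm⟩ :=
      dif_pos (ne_zero_of_mem_affDom hm)
    have h2 : (affChart p₀ x₀ φ).symm q ∈ (affChart p₁ x₁ ψ).source := hq.2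
    rw [he] at h2 ⊢
    have h3 := out_mem_iff.1 h2
    exact ⟨h1, h3, affFun_out h3⟩
  have hmap : ContDiff ℝ ∞ (fun q : Eu (m + 1) × Eu m => (q.1, φ.symm ((1 : ℝ), q.2))) := by
    fun_prop
  have hcomp : ContDiffOn ℝ ∞ (fun q : Eu (m + 1) × Eu m => tchart x₁ (affInv (M := M) x₀ φ q))
      ((affChart p₀ x₀ φ).symm ≫ₕ affChart p₁ x₁ ψ).source := by
    refine hT.comp hmap.contDiffOn ?_
    intro q h
    exact ⟨mem_tchart_target.2 (hq h).1, (hq h).2.1.1⟩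
  have hfin : ContDiffOn ℝ ∞ (fun q : Eu (m + 1) × Eu m => affFun x₁ ψ (affInv (M := M) x₀ φ q))
      ((affChart p₀ x₀ φ).symm ≫ₕ affChart p₁ x₁ ψ).source := by
    have h2 := ψ.contDiff.comp_contDiffOn (contDiff_snd.comp_contDiffOn hcomp)
    exact (contDiff_fst.comp_contDiffOn hcomp).prodMk
      (((contDiff_fst.comp_contDiffOn h2).inv fun q h => (hq h).2.1.2.ne').smul
        (contDiff_snd.comp_contDiffOn h2))
  simp only [modelWithCornersSelf_coe, modelWithCornersSelf_coe_symm, Function.id_comp,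
    Function.comp_id, preimage_id, range_id, inter_univ]
  exact hfin.congr fun q h => (hq h).2.2

lemma continuous_baseProj : Continuous (baseProj : SphereBundle m M → M) :=
  Continuous.quotient_lift
    ((FiberBundle.continuous_proj (Eu (m + 1)) (TangentSpace 𝓘(ℝ, Eu (m + 1)))).comp
      continuous_subtype_val) _

lemma baseProj_ray (v : TM₀ m M) : baseProj (ray v) = v.1.1 := rfl

/-- `SM` is Hausdorff when `M` is. -/
instance [T2Space M] : T2Space (SphereBundle m M) := by
  refine ⟨fun p q hpq => ?_⟩
  by_cases hb : baseProj p = baseProj q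
  swap
  · exact separated_by_continuous continuous_baseProj hb
  obtain ⟨v, rfl⟩ := Quotient.exists_rep p
  obtain ⟨w, rfl⟩ := Quotient.exists_rep q
  change ray v ≠ ray w at hpq
  change v.1.1 = w.1.1 at hb
  let x₀ : M := v.1.1
  let f : TM₀ m M → Eu (m + 1) := fun u => ‖(tchart x₀ u.1).2‖⁻¹ • (tchart x₀ u.1).2
  let S : Set (TM₀ m M) := Subtype.val ⁻¹' (tchart x₀).source
  have hS : IsOpen S := (tchart x₀).open_source.preimage continuous_subtype_val
  have hne {u : TM₀ m M} (hu : u ∈ S) : (tchart x₀ u.1).2 ≠ 0 := fun h =>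
    u.2 ((tchart_snd_eq_zero hu).1 h)
  have hf : ContinuousOn f S := by
    have h : ContinuousOn (fun u : TM₀ m M => (tchart x₀ u.1).2) S :=
      continuous_snd.comp_continuousOn
        ((tchart x₀).continuousOn.comp continuous_subtype_val.continuousOn fun u hu => hu)
    exact (h.norm.inv₀ fun u hu => norm_ne_zero_iff.2 (hne hu)).smul h
  have hv : v ∈ S := mem_tchart_source.2 (mem_chart_source _ _)
  have hw : w ∈ S := mem_tchart_source.2 (by rw [← hb]; exact mem_chart_source _ _)
  have hsat {u u' : TM₀ m M} (h : ray u = ray u') (hu : u ∈ S) : u' ∈ S ∧ f u' = f u := by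
    obtain ⟨c, hc, h⟩ := ray_eq_iff.1 h
    have h1 : u'.1 ∈ (tchart x₀).source := by rw [h]; exact dil_mem_source c hu
    refine ⟨h1, ?_⟩
    show ‖(tchart x₀ u'.1).2‖⁻¹ • (tchart x₀ u'.1).2 = _
    rw [h, tchart_dil_snd c hu, norm_smul, Real.norm_of_nonneg hc.le, smul_smul, mul_inv,
      mul_right_comm, inv_mul_cancel₀ hc.ne', one_mul]
  have hfvw : f v ≠ f w := by
    intro h
    apply hpq
    have h1 := norm_pos_iff.2 (hne hv)
    have h2 := norm_pos_iff.2 (hne hw)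
    refine ray_eq_iff.2 ⟨‖(tchart x₀ w.1).2‖ * ‖(tchart x₀ v.1).2‖⁻¹,
      mul_pos h2 (inv_pos.2 h1), ?_⟩
    refine (tchart x₀).injOn hw (dil_mem_source _ hv) (Prod.ext ?_ ?_)
    · show chartAt (Eu (m + 1)) x₀ w.1.1 = chartAt (Eu (m + 1)) x₀ v.1.1
      rw [hb]
    · rw [tchart_dil_snd _ hv, ← smul_smul]
      change _ = ‖(tchart x₀ w.1).2‖ • f v
      rw [h, smul_smul, mul_inv_cancel₀ h2.ne', one_smul]
  obtain ⟨A, B, hA, hB, hvA, hwB, hAB⟩ := t2_separation hfvw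
  have key (A : Set (Eu (m + 1))) (hA : IsOpen A) : IsOpen (ray '' (S ∩ f ⁻¹' A)) := by
    rw [← isQuotientMap_ray.isOpen_preimage]
    convert hf.isOpen_inter_preimage hS hA using 1
    ext u
    constructor
    · rintro ⟨u', ⟨h1, h2⟩, h⟩
      obtain ⟨h3, h4⟩ := hsat h h1
      exact ⟨h3, by rw [mem_preimage, h4]; exact h2⟩
    · exact fun h => ⟨u, h, rfl⟩
  refine ⟨_, _, key A hA, key B hB, ⟨v, ⟨hv, hvA⟩, rfl⟩, ⟨w, ⟨hw, hwB⟩, rfl⟩, ?_⟩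
  rw [Set.disjoint_left]
  rintro _ ⟨u, ⟨h1, h2⟩, rfl⟩ ⟨u', ⟨h3, h4⟩, h⟩
  refine Set.disjoint_left.1 hAB h2 ?_
  rw [(hsat h h3).2]
  exact h4

end SphereBundle

/-! ### Levi-Civita connections and orthogonal projections -/

section Riemannian

variable {E : Type*} [NormedAddCommGroup E] [NormedSpace ℝ E] {H : Type*} [TopologicalSpace H]
  (I : ModelWithCorners ℝ E H) {N : Type*} [TopologicalSpace N] [ChartedSpace H N]

/-- The vector field `X` is smooth. -/
def SmoothField [IsManifold I 1 N] (X : Π p : N, TangentSpace I p) : Prop :=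
  ContMDiff I I.tangent ∞ (fun p => (⟨p, X p⟩ : TangentBundle I N))

/-- `cov`, with `cov Y p v` standing for `(∇_v Y)(p)`, is the Levi-Civita connection of the metric
`g`: a covariant derivative that is torsion-free and compatible with `g`. -/
structure IsLeviCivita [IsManifold I 1 N]
    (g : Π p : N, TangentSpace I p → TangentSpace I p → ℝ)
    (cov : (Π p : N, TangentSpace I p) → Π p : N, TangentSpace I p →L[ℝ] TangentSpace I p) :
    Prop where
  isCovariantDerivative : IsCovariantDerivativeOn (I := I) E cov Set.univ
  torsion_free : ∀ (X Y : Π p : N, TangentSpace I p) (p : N),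
    MDifferentiableAt I I.tangent (fun q => (⟨q, X q⟩ : TangentBundle I N)) p →
    MDifferentiableAt I I.tangent (fun q => (⟨q, Y q⟩ : TangentBundle I N)) p →
    cov Y p (X p) - cov X p (Y p) = VectorField.mlieBracket I X Y p
  metric : ∀ (Y Z : Π p : N, TangentSpace I p) (p : N) (v : TangentSpace I p),
    MDifferentiableAt I I.tangent (fun q => (⟨q, Y q⟩ : TangentBundle I N)) p →
    MDifferentiableAt I I.tangent (fun q => (⟨q, Z q⟩ : TangentBundle I N)) p →
    mvfderiv I (fun q => g q (Y q) (Z q)) p v = g p (cov Y p v) (Z p) + g p (Y p) (cov Z p v)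

/-- The Levi-Civita connection of the Riemannian metric `g`. -/
def leviCivita [IsManifold I 1 N] (g : Π p : N, TangentSpace I p → TangentSpace I p → ℝ) :
    (Π p : N, TangentSpace I p) → Π p : N, TangentSpace I p →L[ℝ] TangentSpace I p :=
  Classical.epsilon (IsLeviCivita I g)

variable {W : Type*} [AddCommGroup W] [Module ℝ W]

/-- The orthogonal complement of `V` with respect to the inner product `b`. -/
def orthCompl (b : W → W → ℝ) (V : Set W) : Set W := {w | ∀ v ∈ V, b w v = 0}

/-- The orthogonal projection onto the subspace `V` with respect to the inner product `b`. -/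
def orthProj (b : W → W → ℝ) (V : Set W) (w : W) : W :=
  Classical.epsilon fun z => z ∈ V ∧ w - z ∈ orthCompl b V

end Riemannian

/-! ### Finsler structures -/

section FinslerStructure

variable {m : ℕ} {M : Type*} [TopologicalSpace M] [ChartedSpace (Eu (m + 1)) M]
  [IsManifold 𝓘(ℝ, Eu (m + 1)) ∞ M]

/-- The partial derivative `∂/∂xⁱ` of a function of `(x, y)`. -/
def ddx (i : Fin (m + 1)) (f : Eu (m + 1) × Eu (m + 1) → ℝ) (q : Eu (m + 1) × Eu (m + 1)) : ℝ :=
  fderiv ℝ f q (EuclideanSpace.single i 1, 0)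

/-- The partial derivative `∂/∂yⁱ` of a function of `(x, y)`. -/
def ddy (i : Fin (m + 1)) (f : Eu (m + 1) × Eu (m + 1) → ℝ) (q : Eu (m + 1) × Eu (m + 1)) : ℝ :=
  fderiv ℝ f q (0, EuclideanSpace.single i 1)

/-- A function on `TM` in the induced coordinates `(x, y)` around `x₀`. -/
def inCoord (F : TM m M → ℝ) (x₀ : M) : Eu (m + 1) × Eu (m + 1) → ℝ :=
  fun q => F ((tchart x₀).symm q)

/-- The matrix `g_ij = ½ [F²]_{yⁱ yʲ}`. -/
def fundMatrix (F : TM m M → ℝ) (x₀ : M) (q : Eu (m + 1) × Eu (m + 1)) :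
    Matrix (Fin (m + 1)) (Fin (m + 1)) ℝ :=
  Matrix.of fun i j => 1 / 2 * ddy i (ddy j (inCoord F x₀ ^ 2)) q

variable (m M) in
/-- A Finsler structure on `M`. Only the values of `toFun` on nonzero vectors matter. -/
structure FinslerStructure where
  /-- The function `F`. -/
  toFun : TM m M → ℝ
  smooth : ContMDiffOn 𝓘(ℝ, Eu (m + 1)).tangent 𝓘(ℝ, ℝ) ∞ toFun {v | v.2 ≠ 0}
  pos : ∀ v : TM m M, v.2 ≠ 0 → 0 < toFun v
  homogeneous : ∀ v : TM m M, v.2 ≠ 0 → ∀ c : ℝ, 0 < c → toFun (dil c v) = c * toFun v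
  posDef : ∀ v : TM m M, v.2 ≠ 0 → (fundMatrix toFun v.1 (tchart v.1 v)).PosDef

namespace FinslerStructure

variable (F : FinslerStructure m M)

/-- The coefficients `Gⁱ = ¼ g^{ij} ([F²]_{yʲ xᵏ} yᵏ - [F²]_{xʲ})`. -/
def sprayCoeff (x₀ : M) (i : Fin (m + 1)) (q : Eu (m + 1) × Eu (m + 1)) : ℝ :=
  1 / 4 * ∑ j, (fundMatrix F.toFun x₀ q)⁻¹ i j *
    (∑ k, ddx k (ddy j (inCoord F.toFun x₀ ^ 2)) q * q.2 k - ddx j (inCoord F.toFun x₀ ^ 2) q)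

/-- The value of `δyⁱ = (dyⁱ + ∂Gⁱ/∂yʲ dxʲ) / F` on the tangent vector `ξ = (ẋ, ẏ)` of `TM₀` at
`v`, in the coordinates induced by the preferred chart at the base point of `v`. -/
def deltaY (v : TM m M) (ξ : Eu (m + 1) × Eu (m + 1)) (i : Fin (m + 1)) : ℝ :=
  (F.toFun v)⁻¹ * (ξ.2 i + ∑ j, ddy j (F.sprayCoeff v.1 i) (tchart v.1 v) * ξ.1 j)

/-- The form `∑_{i ≤ n} ωⁱ ⊗ ωⁱ = g_ij dxⁱ ⊗ dxʲ` at `v`. -/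
def horForm (v : TM m M) (ξ ζ : Eu (m + 1) × Eu (m + 1)) : ℝ :=
  ∑ i, ∑ j, fundMatrix F.toFun v.1 (tchart v.1 v) i j * ξ.1 i * ζ.1 j

/-- The form `∑_{α ≤ n - 1} ω^{n+α} ⊗ ω^{n+α}` at `v`. As `ω^{n+i} = - vⁱ_j δyʲ` for the orthonormal
coframe `ωⁱ = vⁱ_j dxʲ` with `vⁿ_j = F_{yʲ}`, it is `(g_ij - F_{yⁱ} F_{yʲ}) δyⁱ ⊗ δyʲ`. -/
def verForm (v : TM m M) (ξ ζ : Eu (m + 1) × Eu (m + 1)) : ℝ :=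
  ∑ i, ∑ j, (fundMatrix F.toFun v.1 (tchart v.1 v) i j -
    ddy i (inCoord F.toFun v.1) (tchart v.1 v) * ddy j (inCoord F.toFun v.1) (tchart v.1 v)) *
    F.deltaY v ξ i * F.deltaY v ζ j

/-- The section `[v] ↦ v / F v` of the quotient map `TM₀ → SM`. -/
def unitSection : SphereBundle m M → TM m M :=
  Quotient.lift (fun v : TM₀ m M => dil (F.toFun v.1)⁻¹ v.1) (by
    rintro v w ⟨c, hc, h⟩
    show dil (F.toFun v.1)⁻¹ v.1 = dil (F.toFun w.1)⁻¹ w.1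
    rw [h, F.homogeneous v.1 v.2 c hc, dil_dil, mul_inv, mul_comm c⁻¹, mul_assoc,
      inv_mul_cancel₀ hc.ne', mul_one])

/-- The model with corners of `SM`. -/
local notation "𝓢" => 𝓘(ℝ, Eu (m + 1) × Eu m)

/-- The derivative at `p` of `[v] ↦ v / F v`, in the coordinates `(x, y)` of `TM`. A form on `SM` is
the pullback along `[v] ↦ v / F v` of the corresponding form on `TM₀`. -/
def lift (p : SphereBundle m M) (X : TangentSpace 𝓢 p) : Eu (m + 1) × Eu (m + 1) :=
  mfderiv 𝓢 𝓘(ℝ, Eu (m + 1)).tangent F.unitSection p X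

/-- The rescaled Sasaki-type metric
`g^{T(SM),ε} = ε⁻² ∑_{i ≤ n} ωⁱ ⊗ ωⁱ + ∑_{α ≤ n - 1} ω^{n+α} ⊗ ω^{n+α}` on `SM`. -/
def rescaledMetric (ε : ℝ) (p : SphereBundle m M) (X Y : TangentSpace 𝓢 p) : ℝ :=
  (ε ^ 2)⁻¹ * F.horForm (F.unitSection p) (F.lift p X) (F.lift p Y) +
    F.verForm (F.unitSection p) (F.lift p X) (F.lift p Y)

/-- The Sasaki-type metric `g^{T(SM)}` on `SM`. -/
def sasakiMetric (p : SphereBundle m M) (X Y : TangentSpace 𝓢 p) : ℝ := F.rescaledMetric 1 p X Y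

/-- The vertical space `V(SM)_p`, the tangent space of the fibre of `π : SM → M`. -/
def vertical (p : SphereBundle m M) : Set (TangentSpace 𝓢 p) :=
  {X | mfderiv 𝓢 𝓘(ℝ, Eu (m + 1)) (baseProj : SphereBundle m M → M) p X = 0}

/-- The horizontal space `H(SM)_p`, the orthogonal complement of `V(SM)_p`. -/
def horizontal (p : SphereBundle m M) : Set (TangentSpace 𝓢 p) :=
  orthCompl (F.sasakiMetric p) (vertical p)

/-- The orthogonal projection `p : T(SM) → V(SM)`, applied to a vector field. -/
def projV (X : Π p : SphereBundle m M, TangentSpace 𝓢 p) (p : SphereBundle m M) :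
    TangentSpace 𝓢 p :=
  orthProj (F.sasakiMetric p) (vertical p) (X p)

/-- The orthogonal projection `p^⊥ : T(SM) → H(SM)`, applied to a vector field. -/
def projH (X : Π p : SphereBundle m M, TangentSpace 𝓢 p) (p : SphereBundle m M) :
    TangentSpace 𝓢 p :=
  orthProj (F.sasakiMetric p) (F.horizontal p) (X p)

/-- `U` is a smooth section of `H(SM)`. -/
def IsHorizontalSection (U : Π p : SphereBundle m M, TangentSpace 𝓢 p) : Prop :=
  SmoothField 𝓢 U ∧ ∀ p, U p ∈ F.horizontal p

variable (m M) in
/-- Operators `(X, U) ↦ D_X U` on vector fields of `SM`. -/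
abbrev FieldOperator : Type _ :=
  (Π p : SphereBundle m M, TangentSpace 𝓢 p) → (Π p : SphereBundle m M, TangentSpace 𝓢 p) →
    Π p : SphereBundle m M, TangentSpace 𝓢 p

/-- The compressed connection `p^⊥ ∇^{T(SM),ε} p^⊥` on `H(SM)`, where `∇^{T(SM),ε}` is the
Levi-Civita connection of the rescaled metric. -/
def compressed (ε : ℝ) : FieldOperator m M := fun X U =>
  F.projH fun p => leviCivita 𝓢 (F.rescaledMetric ε) (F.projH U) p (X p)

/-- The Bott connection on `H(SM)`: `∇̃_X U = p^⊥ [X, U]` for vertical `X`, and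
`∇̃_X U = p^⊥ ∇^{T(SM)}_X U` for horizontal `X`. -/
def bott : FieldOperator m M := fun X U p =>
  F.projH (VectorField.mlieBracket 𝓢 (F.projV X) U) p + F.compressed 1 (F.projH X) U p

/-- `D'` is the dual of the connection `D` on `H(SM)` with respect to `g^{T(SM)}`:
`X⟨U, V⟩ = ⟨D_X U, V⟩ + ⟨U, D'_X V⟩`. -/
def IsDualConnection (D D' : FieldOperator m M) : Prop :=
  ∀ X U V, SmoothField 𝓢 X → F.IsHorizontalSection U → F.IsHorizontalSection V → ∀ p,
    D' X V p ∈ F.horizontal p ∧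
    mvfderiv 𝓢 (fun q => F.sasakiMetric q (U q) (V q)) p (X p) =
      F.sasakiMetric p (D X U p) (V p) + F.sasakiMetric p (U p) (D' X V p)

/-- The dual `∇̃*` of the Bott connection. -/
def bottDual : FieldOperator m M := Classical.epsilon (F.IsDualConnection F.bott)

/-- The Cartan endomorphism `H = ½ (∇̃* - ∇̃)`. -/
def cartanEndo : FieldOperator m M := fun X U p =>
  (1 / 2 : ℝ) • (F.bottDual X U p - F.bott X U p)

/-- The symmetrized Bott connection `∇̂ = ∇̃ + H`. -/
def symmBott : FieldOperator m M := fun X U p => F.bott X U p + F.cartanEndo X U p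

end FinslerStructure

end FinslerStructure

end Finsler

end

noncomputable section

set_option maxSynthPendingDepth 3
set_option linter.unusedSectionVars false

/-! Write the rescaled metric as ε⁻² h + w, where h is g_ij dxⁱ dxʲ pulled back to SM and w is the
vertical part. Then ker h = V(SM) and ker w = H(SM). In the Koszul formula for ∇^ε_X U tested
against Z, with U and Z horizontal, every w-term that has U or Z in a slot vanishes. After
multiplication by ε² there remains 2 h(p^⊥∇^ε_X U, Z) = K(X, U, Z) - ε² w([U, Z], X), with K the
Koszul expression of h alone. So the compressed connection is exactly affine in ε²: p^⊥∇^ε_X U = L_X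
U + ε² A (`IsSplitPair.proj_leviCivita_eq`). Pointwise convergence to L is immediate. The defect A
satisfies h(A, Z) = -½ w([U, Z], X), hence is locally bounded (`IsSplitPair.exists_bound`), and this
makes the convergence uniform on compact sets.

The limit L is the symmetrized Bott connection. For horizontal X the ε²-term vanishes, so the Bott
connection is L itself. For vertical X the form h kills X, and K(X, U, Z) reduces to X h(U, Z) +
h([X, U], Z) - h([X, Z], U). Together these give X⟨U, V⟩ = ⟨∇̃_X U, V⟩ + ⟨U, 2 L_X V - ∇̃_X V⟩
(`IsSplitPair.mvfderiv_left_eq`), that is ∇̃* = 2L - ∇̃, and so ∇̂ = ½(∇̃ + ∇̃*) = L.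

It remains to see that h and w are smooth, positive semidefinite and have complementary kernels
(`FinslerStructure.isSplitPair`). Both are defined at each point in the chart centred there, so
smoothness rests on invariance under coordinate changes. For w this is the transformation law of the
spray coefficients (`IsCoordChange.sprayVec_eq`, `IsCoordChange.deltaMap_eq`). The kernels come from
Euler's identities: the angular form degenerates exactly along y, and y is transverse to the
indicatrix F = 1, with which the fibres of SM are identified. -/

namespace Finsler

/-! ### Linear algebra of Christoffel symbols -/

section Christoffel

variable {E : Type*} [NormedAddCommGroup E] [NormedSpace ℝ E]

/-- The linear equivalence from a finite-dimensional space to its dual given by a form without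
kernel. -/
lemma exists_flat_equiv [FiniteDimensional ℝ E] {b : E →L[ℝ] E →L[ℝ] ℝ}
    (hb : ∀ u, b u = 0 → u = 0) :
    ∃ f : E ≃L[ℝ] (E →L[ℝ] ℝ), (f : E →L[ℝ] E →L[ℝ] ℝ) = b := by
  have hinj : Function.Injective b.toLinearMap :=
    LinearMap.ker_eq_bot.1 (LinearMap.ker_eq_bot'.2 hb)
  have hd : Module.finrank ℝ E = Module.finrank ℝ (E →L[ℝ] ℝ) :=
    (Subspace.dual_finrank_eq (K := ℝ) (V := E)).symm.trans
      (LinearMap.toContinuousLinearMap (𝕜 := ℝ) (E := E) (F' := ℝ)).finrank_eq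
  exact ⟨(LinearEquiv.ofInjectiveOfFinrankEq b.toLinearMap hinj hd).toContinuousLinearEquiv, rfl⟩

/-- The Christoffel symbols of a form `b` with derivative `D`. -/
lemma exists_christoffel [FiniteDimensional ℝ E] {b : E →L[ℝ] E →L[ℝ] ℝ}
    (hb : ∀ u, b u = 0 → u = 0) {D : E →L[ℝ] E →L[ℝ] E →L[ℝ] ℝ}
    (hD : ∀ u v w, D u v w = D u w v) :
    ∃ Γ : E →L[ℝ] E →L[ℝ] E, (∀ u v, Γ u v = Γ v u) ∧
      ∀ u v w, D u v w = b (Γ u v) w + b (Γ u w) v := by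
  obtain ⟨f, hf⟩ := exists_flat_equiv hb
  let T : (E →L[ℝ] E →L[ℝ] ℝ) →L[ℝ] (E →L[ℝ] E →L[ℝ] ℝ) :=
    (ContinuousLinearMap.flipₗᵢ ℝ E E ℝ).toContinuousLinearEquiv.toContinuousLinearMap
  have hT (c : E →L[ℝ] E →L[ℝ] ℝ) (u v : E) : T c u v = c v u := rfl
  -- Christoffel symbols of the first kind. They are symmetric in the first two slots because `D` is
  -- symmetric in the last two; raising the last index by `b` gives `Γ`.
  let K : E →L[ℝ] E →L[ℝ] E →L[ℝ] ℝ := (1 / 2 : ℝ) • (D + D.flip - T.comp D.flip)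
  have hK (u v w : E) : K u v w = 1 / 2 * (D u v w + D v u w - D w u v) := rfl
  let Γ : E →L[ℝ] E →L[ℝ] E :=
    (ContinuousLinearMap.compL ℝ E (E →L[ℝ] ℝ) E f.symm.toContinuousLinearMap).comp K
  have hΓ (u v w : E) : b (Γ u v) w = K u v w := by
    rw [← hf]
    show f (f.symm (K u v)) w = _
    rw [f.apply_symm_apply]
  refine ⟨Γ, fun u v => f.injective ?_, fun u v w => ?_⟩
  · ext w
    have h (x : E) : f x = b x := by rw [← hf]; rfl
    rw [h, h, hΓ, hΓ, hK, hK, hD w u v]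
    ring
  · rw [hΓ, hΓ, hK, hK, hD u w v, hD v u w, hD w u v]
    ring

/-- The symmetrization of a bilinear form. -/
lemma exists_symmetrization :
    ∃ L : (E →L[ℝ] E →L[ℝ] ℝ) →L[ℝ] (E →L[ℝ] E →L[ℝ] ℝ), ∀ b u v,
      L b u v = 1 / 2 * (b u v + b v u) :=
  ⟨(1 / 2 : ℝ) • (ContinuousLinearMap.id ℝ _ +
      (ContinuousLinearMap.flipₗᵢ ℝ E E ℝ).toContinuousLinearEquiv.toContinuousLinearMap),
    fun _ _ _ => rfl⟩

end Christoffel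

/-! ### Vector fields and bilinear forms in charts; existence of the Levi-Civita connection -/

section RiemannianForm

variable {E : Type*} [NormedAddCommGroup E] [NormedSpace ℝ E]
  {N : Type*} [TopologicalSpace N] [ChartedSpace E N] [IsManifold 𝓘(ℝ, E) ∞ N]

/-- The trivialization of the tangent bundle by the preferred chart at `p`, on the fibre at `q`. -/
abbrev triv (p q : N) : TangentSpace 𝓘(ℝ, E) q →L[ℝ] E :=
  (trivializationAt E (TangentSpace 𝓘(ℝ, E)) p).continuousLinearMapAt ℝ q

lemma triv_eq_mfderiv {p q : N} (hq : q ∈ (chartAt E p).source) :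
    triv p q = mfderiv 𝓘(ℝ, E) 𝓘(ℝ, E) (extChartAt 𝓘(ℝ, E) p) q :=
  TangentBundle.continuousLinearMapAt_trivializationAt hq

lemma exists_equiv_triv {p q : N} (hq : q ∈ (chartAt E p).source) :
    ∃ e : TangentSpace 𝓘(ℝ, E) q ≃L[ℝ] E, ∀ v, e v = triv p q v := by
  have hq' : q ∈ (trivializationAt E (TangentSpace 𝓘(ℝ, E)) p).baseSet := by simpa using hq
  refine ⟨(trivializationAt E (TangentSpace 𝓘(ℝ, E)) p).continuousLinearEquivAt ℝ q hq',
    fun v => ?_⟩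
  rw [triv, Trivialization.continuousLinearMapAt_apply, Trivialization.coe_linearMapAt_of_mem _ hq']
  rfl

lemma triv_apply {p q : N} (hq : q ∈ (chartAt E p).source) (v : TangentSpace 𝓘(ℝ, E) q) :
    triv p q v = (trivializationAt E (TangentSpace 𝓘(ℝ, E)) p ⟨q, v⟩).2 := by
  have hq' : q ∈ (trivializationAt E (TangentSpace 𝓘(ℝ, E)) p).baseSet := by simpa using hq
  rw [triv, Trivialization.continuousLinearMapAt_apply, Trivialization.coe_linearMapAt_of_mem _ hq']

/-- The vector field `X` is differentiable at `p`. -/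
abbrev DiffField (X : Π q : N, TangentSpace 𝓘(ℝ, E) q) (p : N) : Prop :=
  MDifferentiableAt 𝓘(ℝ, E) 𝓘(ℝ, E).tangent (fun q => (⟨q, X q⟩ : TangentBundle 𝓘(ℝ, E) N)) p

/-- The vector field `X` is smooth at `p`. -/
abbrev SmoothAt (X : Π q : N, TangentSpace 𝓘(ℝ, E) q) (p : N) : Prop :=
  ContMDiffAt 𝓘(ℝ, E) 𝓘(ℝ, E).tangent ∞ (fun q => (⟨q, X q⟩ : TangentBundle 𝓘(ℝ, E) N)) p

variable {p : N} {X Y Z : Π q : N, TangentSpace 𝓘(ℝ, E) q}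

lemma mdifferentiableAt_triv
    (hY : DiffField Y p) :
    MDifferentiableAt 𝓘(ℝ, E) 𝓘(ℝ, E) (fun q => triv p q (Y q)) p := by
  have h := (mdifferentiableAt_section 𝓘(ℝ, E) Y).1 hY
  refine h.congr_of_eventuallyEq ?_
  filter_upwards [(chartAt E p).open_source.mem_nhds (mem_chart_source E p)] with q hq
  exact triv_apply hq _

lemma contMDiffAt_triv
    (hY : SmoothAt Y p) :
    ContMDiffAt 𝓘(ℝ, E) 𝓘(ℝ, E) ∞ (fun q => triv p q (Y q)) p := by
  have h := (contMDiffAt_section p).1 hY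
  refine h.congr_of_eventuallyEq ?_
  filter_upwards [(chartAt E p).open_source.mem_nhds (mem_chart_source E p)] with q hq
  exact triv_apply hq _

lemma contMDiffAt_of_triv
    (hY : ContMDiffAt 𝓘(ℝ, E) 𝓘(ℝ, E) ∞ (fun q => triv p q (Y q)) p) :
    SmoothAt Y p := by
  refine (contMDiffAt_section p).2 (hY.congr_of_eventuallyEq ?_)
  filter_upwards [(chartAt E p).open_source.mem_nhds (mem_chart_source E p)] with q hq
  exact (triv_apply hq _).symm

/-- The derivative is by definition taken in the chart centred at `p`, where the trivialization is
the identity. Writing `triv p p v` instead of `v` keeps the formula inside the model space. -/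
lemma mvfderiv_eq_fderiv {G : Type*} [NormedAddCommGroup G] [NormedSpace ℝ G] {f : N → G}
    (hf : MDifferentiableAt 𝓘(ℝ, E) 𝓘(ℝ, G) f p) (v : TangentSpace 𝓘(ℝ, E) p) :
    mvfderiv 𝓘(ℝ, E) f p v =
      fderiv ℝ (f ∘ (extChartAt 𝓘(ℝ, E) p).symm) (extChartAt 𝓘(ℝ, E) p p) (triv p p v) := by
  have h1 : triv p p v = v := by
    rw [triv_eq_mfderiv (mem_chart_source E p), mfderiv_extChartAt_self]; rfl
  rw [h1]
  simp only [mvfderiv, mfderiv, hf]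
  simp only [modelWithCornersSelf_coe, range_id, fderivWithin_univ]
  rfl

lemma differentiableAt_comp_extChartAt_symm {G : Type*} [NormedAddCommGroup G] [NormedSpace ℝ G]
    {f : N → G} (hf : MDifferentiableAt 𝓘(ℝ, E) 𝓘(ℝ, G) f p) :
    DifferentiableAt ℝ (f ∘ (extChartAt 𝓘(ℝ, E) p).symm) (extChartAt 𝓘(ℝ, E) p p) := by
  have h := ((mdifferentiableAt_iff _ _).1 hf).2
  simpa only [modelWithCornersSelf_coe, range_id, differentiableWithinAt_univ] using! h

lemma mvfderiv_clm_apply {G K : Type*} [NormedAddCommGroup G] [NormedSpace ℝ G]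
    [NormedAddCommGroup K] [NormedSpace ℝ K] {A : N → G →L[ℝ] K} {f : N → G}
    (hA : MDifferentiableAt 𝓘(ℝ, E) 𝓘(ℝ, G →L[ℝ] K) A p)
    (hf : MDifferentiableAt 𝓘(ℝ, E) 𝓘(ℝ, G) f p) (v : TangentSpace 𝓘(ℝ, E) p) :
    mvfderiv 𝓘(ℝ, E) (fun q => A q (f q)) p v =
      mvfderiv 𝓘(ℝ, E) A p v (f p) + A p (mvfderiv 𝓘(ℝ, E) f p v) := by
  rw [mvfderiv_eq_fderiv hA, mvfderiv_eq_fderiv hf, mvfderiv_eq_fderiv (hA.clm_apply hf)]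
  have h := fderiv_clm_apply (differentiableAt_comp_extChartAt_symm hA)
    (differentiableAt_comp_extChartAt_symm hf)
  have h2 := DFunLike.congr_fun h (triv p p v)
  simp only [Function.comp_apply, extChartAt_to_inv, add_apply,
    ContinuousLinearMap.comp_apply, ContinuousLinearMap.flip_apply] at h2
  rw [add_comm]
  exact h2

/-- In the trivialization at `p`, the Lie bracket is the commutator of directional derivatives. -/
lemma triv_mlieBracket
    (hX : DiffField X p)
    (hY : DiffField Y p) :
    triv p p (VectorField.mlieBracket 𝓘(ℝ, E) X Y p) =
      mvfderiv 𝓘(ℝ, E) (fun q => triv p q (Y q)) p (X p) -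
      mvfderiv 𝓘(ℝ, E) (fun q => triv p q (X q)) p (Y p) := by
  -- The manifold bracket is the bracket of the pullbacks under the inverse chart. Near the centre
  -- such a pullback is just the trivialized field read in the chart.
  have key : ∀ Z : Π q : N, TangentSpace 𝓘(ℝ, E) q,
      (VectorField.mpullbackWithin 𝓘(ℝ, E) 𝓘(ℝ, E) (extChartAt 𝓘(ℝ, E) p).symm Z
        (range 𝓘(ℝ, E)) : E → E) =ᶠ[𝓝 (extChartAt 𝓘(ℝ, E) p p)]
      (fun q => triv p q (Z q)) ∘ (extChartAt 𝓘(ℝ, E) p).symm := by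
    intro Z
    have ht : (extChartAt 𝓘(ℝ, E) p).target ∈ 𝓝 (extChartAt 𝓘(ℝ, E) p p) :=
      extChartAt_target_mem_nhds p
    filter_upwards [ht] with x hx
    have hs : (extChartAt 𝓘(ℝ, E) p).symm x ∈ (chartAt E p).source := by
      simpa using (extChartAt 𝓘(ℝ, E) p).map_target hx
    rw [VectorField.mpullbackWithin_apply, ContinuousLinearMap.inverse_eq
      (mfderivWithin_extChartAt_symm_comp_mfderiv_extChartAt hx)
      (mfderiv_extChartAt_comp_mfderivWithin_extChartAt_symm hx), Function.comp_apply,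
      triv_eq_mfderiv hs]
    rfl
  have hp : ∀ Z : Π q : N, TangentSpace 𝓘(ℝ, E) q,
      triv p p (Z p) = VectorField.mpullbackWithin 𝓘(ℝ, E) 𝓘(ℝ, E) (extChartAt 𝓘(ℝ, E) p).symm Z
        (range 𝓘(ℝ, E)) (extChartAt 𝓘(ℝ, E) p p) := by
    intro Z
    have := (key Z).self_of_nhds
    rw [this, Function.comp_apply, extChartAt_to_inv]
  rw [mvfderiv_eq_fderiv (mdifferentiableAt_triv hX),
    mvfderiv_eq_fderiv (mdifferentiableAt_triv hY),
    ← (key X).fderiv_eq, ← (key Y).fderiv_eq, hp X, hp Y]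
  rw [← VectorField.mlieBracketWithin_univ, VectorField.mlieBracketWithin_apply,
    triv_eq_mfderiv (mem_chart_source E p)]
  refine ((isInvertible_mfderiv_extChartAt (mem_extChartAt_source p)).self_apply_inverse _).trans ?_
  simp only [preimage_univ, univ_inter, modelWithCornersSelf_coe, range_id]
  have this (V W : E → E) (x : E) : VectorField.lieBracketWithin ℝ V W univ x =
      fderiv ℝ W x (V x) - fderiv ℝ V x (W x) := by
    rw [VectorField.lieBracketWithin_univ]
    rfl
  exact this _ _ _

/-- `g` is a smooth field of bilinear forms on the tangent spaces of `N`. -/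
def SmoothForm (g : Π p : N, TangentSpace 𝓘(ℝ, E) p → TangentSpace 𝓘(ℝ, E) p → ℝ) : Prop :=
  ∀ p : N, ∃ B : N → E →L[ℝ] E →L[ℝ] ℝ,
    ContMDiffAt 𝓘(ℝ, E) 𝓘(ℝ, E →L[ℝ] E →L[ℝ] ℝ) ∞ B p ∧
    ∀ᶠ q in 𝓝 p, ∀ X Y : TangentSpace 𝓘(ℝ, E) q, g q X Y = B q (triv p q X) (triv p q Y)

variable {g h : Π p : N, TangentSpace 𝓘(ℝ, E) p → TangentSpace 𝓘(ℝ, E) p → ℝ}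

lemma SmoothForm.exists_bilin (hg : SmoothForm g) (p : N) :
    ∃ b : TangentSpace 𝓘(ℝ, E) p →ₗ[ℝ] TangentSpace 𝓘(ℝ, E) p →ₗ[ℝ] ℝ, ∀ X Y, g p X Y = b X Y := by
  obtain ⟨B, -, h⟩ := hg p
  have h := h.self_of_nhds
  exact ⟨LinearMap.mk₂ ℝ (g p) (by simp [h]) (by simp [h]) (by simp [h]) (by simp [h]),
    fun X Y => rfl⟩

lemma SmoothForm.add (hg : SmoothForm g) (hh : SmoothForm h) :
    SmoothForm fun p X Y => g p X Y + h p X Y := by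
  intro p
  obtain ⟨B, hB, h1⟩ := hg p
  obtain ⟨C, hC, h2⟩ := hh p
  refine ⟨fun q => B q + C q, hB.add hC, ?_⟩
  filter_upwards [h1, h2] with q h1 h2 X Y
  simp [h1, h2]

lemma SmoothForm.const_mul (c : ℝ) (hg : SmoothForm g) :
    SmoothForm fun p X Y => c * g p X Y := by
  intro p
  obtain ⟨B, hB, h1⟩ := hg p
  have hc : ContMDiffAt 𝓘(ℝ, E) 𝓘(ℝ, ℝ) ∞ (fun _ : N => c) p := contMDiffAt_const
  refine ⟨fun q => c • B q, hc.smul hB, ?_⟩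
  filter_upwards [h1] with q h1 X Y
  simp [h1]

lemma SmoothForm.contMDiffAt (hg : SmoothForm g)
    (hX : SmoothAt X p)
    (hY : SmoothAt Y p) :
    ContMDiffAt 𝓘(ℝ, E) 𝓘(ℝ, ℝ) ∞ (fun q => g q (X q) (Y q)) p := by
  obtain ⟨B, hB, h⟩ := hg p
  refine ((hB.clm_apply (contMDiffAt_triv hX)).clm_apply
    (contMDiffAt_triv hY)).congr_of_eventuallyEq ?_
  filter_upwards [h] with q hq using hq _ _

lemma SmoothForm.mdifferentiableAt (hg : SmoothForm g)
    (hX : DiffField X p)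
    (hY : DiffField Y p) :
    MDifferentiableAt 𝓘(ℝ, E) 𝓘(ℝ, ℝ) (fun q => g q (X q) (Y q)) p := by
  obtain ⟨B, hB, h⟩ := hg p
  refine (((hB.mdifferentiableAt (by simp)).clm_apply
    (mdifferentiableAt_triv hX)).clm_apply (mdifferentiableAt_triv hY)).congr_of_eventuallyEq ?_
  filter_upwards [h] with q hq using hq _ _

/-- A symmetric smooth form has a symmetric local representative. -/
lemma SmoothForm.exists_symm (hg : SmoothForm g) (hs : ∀ p X Y, g p X Y = g p Y X) (p : N) :
    ∃ B : N → E →L[ℝ] E →L[ℝ] ℝ, ContMDiffAt 𝓘(ℝ, E) 𝓘(ℝ, E →L[ℝ] E →L[ℝ] ℝ) ∞ B p ∧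
    (∀ q u v, B q u v = B q v u) ∧
    ∀ᶠ q in 𝓝 p, ∀ X Y : TangentSpace 𝓘(ℝ, E) q, g q X Y = B q (triv p q X) (triv p q Y) := by
  obtain ⟨B, hB, h⟩ := hg p
  obtain ⟨L, hL⟩ := exists_symmetrization (E := E)
  have hL' : ContMDiffAt 𝓘(ℝ, E →L[ℝ] E →L[ℝ] ℝ) 𝓘(ℝ, E →L[ℝ] E →L[ℝ] ℝ) ∞ L (B p) :=
    L.contDiff.contMDiff.contMDiffAt
  -- `g` controls `B` only near `p`; symmetrizing yields symmetry at every `q`, so that derivatives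
  -- inherit it directly.
  refine ⟨fun q => L (B q), hL'.comp p hB, fun q u v => ?_, ?_⟩
  · rw [hL, hL, add_comm]
  · filter_upwards [h] with q h X Y
    rw [hL, ← h, ← h, hs q Y X]
    ring

/-- The derivative of `g(Y, Z)` in a local representation of `g`. -/
lemma mvfderiv_form {B : N → E →L[ℝ] E →L[ℝ] ℝ}
    (hB : MDifferentiableAt 𝓘(ℝ, E) 𝓘(ℝ, E →L[ℝ] E →L[ℝ] ℝ) B p)
    (h : ∀ᶠ q in 𝓝 p, ∀ X Y : TangentSpace 𝓘(ℝ, E) q, g q X Y = B q (triv p q X) (triv p q Y))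
    (hX : DiffField X p) (hY : DiffField Y p) (v : TangentSpace 𝓘(ℝ, E) p) :
    mvfderiv 𝓘(ℝ, E) (fun q => g q (X q) (Y q)) p v =
      mvfderiv 𝓘(ℝ, E) B p v (triv p p (X p)) (triv p p (Y p)) +
      B p (mvfderiv 𝓘(ℝ, E) (fun q => triv p q (X q)) p v) (triv p p (Y p)) +
      B p (triv p p (X p)) (mvfderiv 𝓘(ℝ, E) (fun q => triv p q (Y q)) p v) := by
  have hX' := mdifferentiableAt_triv hX
  have hY' := mdifferentiableAt_triv hY
  have he : (fun q => g q (X q) (Y q)) =ᶠ[𝓝 p] fun q => B q (triv p q (X q)) (triv p q (Y q)) := by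
    filter_upwards [h] with q hq using hq _ _
  have he' : mvfderiv 𝓘(ℝ, E) (fun q => g q (X q) (Y q)) p v =
      mvfderiv 𝓘(ℝ, E) (fun q => B q (triv p q (X q)) (triv p q (Y q))) p v :=
    DFunLike.congr_fun he.mfderiv_eq v
  rw [he', mvfderiv_clm_apply (hB.clm_apply hX') hY',
    mvfderiv_clm_apply hB hX', add_apply]

/-- The Koszul formula. -/
lemma IsLeviCivita.koszul
    {cov : (Π p : N, TangentSpace 𝓘(ℝ, E) p) →
      Π p : N, TangentSpace 𝓘(ℝ, E) p →L[ℝ] TangentSpace 𝓘(ℝ, E) p}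
    (hc : IsLeviCivita 𝓘(ℝ, E) g cov) (hg : SmoothForm g) (hs : ∀ p X Y, g p X Y = g p Y X)
    (hX : DiffField X p) (hY : DiffField Y p) (hZ : DiffField Z p) :
    2 * g p (cov Y p (X p)) (Z p) =
      mvfderiv 𝓘(ℝ, E) (fun q => g q (Y q) (Z q)) p (X p) +
      mvfderiv 𝓘(ℝ, E) (fun q => g q (X q) (Z q)) p (Y p) -
      mvfderiv 𝓘(ℝ, E) (fun q => g q (X q) (Y q)) p (Z p) +
      g p (VectorField.mlieBracket 𝓘(ℝ, E) X Y p) (Z p) -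
      g p (VectorField.mlieBracket 𝓘(ℝ, E) X Z p) (Y p) -
      g p (VectorField.mlieBracket 𝓘(ℝ, E) Y Z p) (X p) := by
  obtain ⟨b, hb⟩ := hg.exists_bilin p
  -- Three uses of compatibility and three of torsion-freeness; by symmetry of `g` all other terms
  -- cancel in pairs.
  rw [hc.metric Y Z p _ hY hZ, hc.metric X Z p _ hX hZ, hc.metric X Y p _ hX hY,
    ← hc.torsion_free X Y p hX hY, ← hc.torsion_free X Z p hX hZ, ← hc.torsion_free Y Z p hY hZ]
  rw [hs p (Y p) (cov Z p (X p)), hs p (X p) (cov Z p (Y p)), hs p (X p) (cov Y p (Z p))]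
  simp only [hb, map_sub, LinearMap.sub_apply]
  ring

/-- A symmetric positive definite smooth form has a Levi-Civita connection. -/
lemma isLeviCivita_leviCivita [FiniteDimensional ℝ E] (hg : SmoothForm g)
    (hs : ∀ p X Y, g p X Y = g p Y X) (hp : ∀ p X, X ≠ 0 → 0 < g p X X) :
    IsLeviCivita 𝓘(ℝ, E) g (leviCivita 𝓘(ℝ, E) g) := by
  -- `leviCivita` is a choice, so existence is all that is needed. Uniqueness plays no role: the
  -- Koszul formula fixes every value used later.
  refine Classical.epsilon_spec (p := IsLeviCivita 𝓘(ℝ, E) g) ?_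
  have hΓ (p : N) : ∃ Γ : E →L[ℝ] E →L[ℝ] E, (∀ u v, Γ u v = Γ v u) ∧
      ∃ B : N → E →L[ℝ] E →L[ℝ] ℝ, MDifferentiableAt 𝓘(ℝ, E) 𝓘(ℝ, E →L[ℝ] E →L[ℝ] ℝ) B p ∧
      (∀ᶠ q in 𝓝 p, ∀ X Y : TangentSpace 𝓘(ℝ, E) q, g q X Y = B q (triv p q X) (triv p q Y)) ∧
      ∀ v : TangentSpace 𝓘(ℝ, E) p, ∀ a b, mvfderiv 𝓘(ℝ, E) B p v a b =
        B p (Γ (triv p p v) a) b + B p a (Γ (triv p p v) b) := by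
    obtain ⟨B, hB, hBs, h⟩ := hg.exists_symm hs p
    have hB := hB.mdifferentiableAt (by simp)
    obtain ⟨e, he⟩ := exists_equiv_triv (mem_chart_source E p)
    let D : E →L[ℝ] E →L[ℝ] E →L[ℝ] ℝ := (mvfderiv 𝓘(ℝ, E) B p).comp e.symm.toContinuousLinearMap
    -- The derivative of a family of symmetric forms is symmetric: evaluate the family on constant
    -- vectors before differentiating.
    have hDs (u v w : E) : D u v w = D u w v := by
      have h1 (v w : E) : D u v w = mvfderiv 𝓘(ℝ, E) (fun q => B q v w) p (e.symm u) := by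
        rw [mvfderiv_clm_apply (hB.clm_apply mdifferentiableAt_const) mdifferentiableAt_const,
          mvfderiv_clm_apply hB mdifferentiableAt_const]
        rw [mvfderiv_const, mvfderiv_const]
        simp [D]
      rw [h1, h1]
      simp only [hBs _ v w]
    have hinj (u : E) (hu : B p u = 0) : u = 0 := by
      by_contra hne
      have h1 := hp p (e.symm u) (by simpa using hne)
      rw [h.self_of_nhds, ← he, e.apply_symm_apply] at h1
      have h2 : B p u u = 0 := DFunLike.congr_fun hu u
      exact h1.ne' h2
    obtain ⟨Γ, hΓ1, hΓ2⟩ := exists_christoffel hinj hDs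
    refine ⟨Γ, hΓ1, B, hB, h, fun v a b => ?_⟩
    have hv : mvfderiv 𝓘(ℝ, E) B p v = D (triv p p v) := by
      simp [D, ← he]
    rw [hBs p a, hv, hΓ2]
  choose Γ hΓs B hB h hΓ using hΓ
  choose e he using fun p : N => exists_equiv_triv (mem_chart_source E p)
  -- The usual ∂Y + Γ(·, Y), at each point in the chart centred there. The axioms are conditions at
  -- one point at a time, so nothing has to be glued. Symmetry of `Γ` gives torsion-freeness and
  -- `hΓ` gives compatibility.
  let cov : (Π p : N, TangentSpace 𝓘(ℝ, E) p) →
      Π p : N, TangentSpace 𝓘(ℝ, E) p →L[ℝ] TangentSpace 𝓘(ℝ, E) p := fun Y p =>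
    (e p).symm.toContinuousLinearMap.comp (mvfderiv 𝓘(ℝ, E) (fun q => triv p q (Y q)) p +
      ((Γ p).flip (triv p p (Y p))).comp (e p).toContinuousLinearMap)
  have hcov (Y : Π p : N, TangentSpace 𝓘(ℝ, E) p) (p : N) (v : TangentSpace 𝓘(ℝ, E) p) :
      triv p p (cov Y p v) = mvfderiv 𝓘(ℝ, E) (fun q => triv p q (Y q)) p v +
        Γ p (triv p p v) (triv p p (Y p)) := by
    simp [cov, ← he]
  have hinj (p : N) {u v : TangentSpace 𝓘(ℝ, E) p} (huv : triv p p u = triv p p v) : u = v := by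
    rw [← he, ← he] at huv
    exact (e p).injective huv
  refine ⟨cov, ⟨@fun X Y p hσ hσ' _ => ?_, @fun X f p hσ hf _ => ?_⟩,
    fun X Y p hX hY => ?_, fun Y Z p v hY hZ => ?_⟩
  · ext v
    apply hinj
    have := mvfderiv_add (mdifferentiableAt_triv hσ) (mdifferentiableAt_triv hσ')
    have h2 : (fun q => triv p q ((X + Y) q)) =
        (fun q => triv p q (X q)) + fun q => triv p q (Y q) := by
      ext q; simp
    have h3 : triv p p ((X + Y) p) = triv p p (X p) + triv p p (Y p) := map_add _ _ _
    have h4 : triv p p ((cov X p + cov Y p) v) = triv p p (cov X p v) + triv p p (cov Y p v) :=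
      map_add _ _ _
    rw [hcov, h2, this, h3, h4, hcov, hcov, map_add, add_apply]
    abel
  · ext v
    apply hinj
    have := mvfderiv_smul hf (mdifferentiableAt_triv hσ)
    have h2 : (fun q => triv p q ((f • X) q)) = f • fun q => triv p q (X q) := by
      ext q; simp
    rw [hcov, h2, this]
    simp only [add_apply, map_add, hcov, smul_apply,
      map_smul, ContinuousLinearMap.smulRight_apply, Pi.smul_apply', smul_add]
    abel
  · apply hinj
    rw [map_sub, hcov, hcov, triv_mlieBracket hX hY, hΓs]
    abel
  · rw [mvfderiv_form (hB p) (h p) hY hZ, (h p).self_of_nhds, (h p).self_of_nhds, hcov, hcov, hΓ]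
    simp only [map_add, add_apply]
    ring

end RiemannianForm

/-! ### The limit of the compressed connections for two forms with complementary kernels -/

section SplitForms

variable {E : Type*} [NormedAddCommGroup E] [NormedSpace ℝ E]
  {N : Type*} [TopologicalSpace N] [ChartedSpace E N] [IsManifold 𝓘(ℝ, E) ∞ N]

lemma SmoothAt.diffField {X : Π q : N, TangentSpace 𝓘(ℝ, E) q} {p : N} (hX : SmoothAt X p) :
    DiffField X p := hX.mdifferentiableAt (by simp)

/-- Every tangent vector extends to a vector field which is smooth near its base point. -/
lemma exists_eventually_smoothAt (p : N) :
    ∃ S : E → Π q : N, TangentSpace 𝓘(ℝ, E) q, ∀ᶠ q in 𝓝 p, ∀ e,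
      SmoothAt (S e) q ∧ triv p q (S e q) = e := by
  let T := trivializationAt E (TangentSpace 𝓘(ℝ, E)) p
  refine ⟨fun e q => T.symm q e, ?_⟩
  filter_upwards [T.open_baseSet.mem_nhds (mem_baseSet_trivializationAt E _ p)] with q hq e
  have h1 {x : N} (hx : x ∈ T.baseSet) : (T ⟨x, T.symm x e⟩).2 = e := by
    rw [T.apply_mk_symm hx]
  refine ⟨(T.contMDiffAt_section_iff hq).2 ?_, ?_⟩
  · refine contMDiffAt_const (c := e) |>.congr_of_eventuallyEq ?_
    filter_upwards [T.open_baseSet.mem_nhds hq] with x hx using h1 hx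
  · rw [triv_apply (E := E) (by simpa [T] using hq)]
    exact h1 hq

/-- Every tangent vector extends to a smooth vector field. -/
lemma exists_smoothField [T2Space N] [FiniteDimensional ℝ E] (p : N) (v : TangentSpace 𝓘(ℝ, E) p) :
    ∃ Z : Π q : N, TangentSpace 𝓘(ℝ, E) q, SmoothField 𝓘(ℝ, E) Z ∧ Z p = v := by
  obtain ⟨S, hS⟩ := exists_eventually_smoothAt (E := E) p
  obtain ⟨u, hu, huo, hpu⟩ := eventually_nhds_iff.1 hS
  obtain ⟨f, hf⟩ := (SmoothBumpFunction.nhds_basis_tsupport (I := 𝓘(ℝ, E)) p).mem_iff.1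
    (huo.mem_nhds hpu)
  refine ⟨(f : N → ℝ) • S (triv p p v), ?_, ?_⟩
  · refine ContMDiffOn.smul_section_of_tsupport f.contMDiff.contMDiffOn huo hf.2 ?_
    exact fun q hq => ((hu q hq _).1).contMDiffWithinAt
  · obtain ⟨e, he⟩ := exists_equiv_triv (mem_chart_source E p)
    apply e.injective
    rw [he, he]
    change triv p p (f p • S (triv p p v) p) = _
    rw [f.eq_one, one_smul, (hu p hpu (triv p p v)).2]

/-- Two smooth fields of positive semidefinite forms with complementary kernels. -/
structure IsSplitPair (h w : Π p : N, TangentSpace 𝓘(ℝ, E) p → TangentSpace 𝓘(ℝ, E) p → ℝ) :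
    Prop where
  smooth_left : SmoothForm h
  smooth_right : SmoothForm w
  symm_left : ∀ p X Y, h p X Y = h p Y X
  symm_right : ∀ p X Y, w p X Y = w p Y X
  nonneg_left : ∀ p X, 0 ≤ h p X X
  nonneg_right : ∀ p X, 0 ≤ w p X X
  pos : ∀ p X, X ≠ 0 → 0 < h p X X + w p X X
  exists_split : ∀ p X, ∃ Z, (∀ Y, w p Z Y = 0) ∧ ∀ Y, h p (X - Z) Y = 0

/-- `P` is the projection onto the kernel of `w` along the kernel of `h`. -/
def IsSplitProj (h w : Π p : N, TangentSpace 𝓘(ℝ, E) p → TangentSpace 𝓘(ℝ, E) p → ℝ)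
    (P : Π p : N, TangentSpace 𝓘(ℝ, E) p → TangentSpace 𝓘(ℝ, E) p) : Prop :=
  ∀ p X, (∀ Y, w p (P p X) Y = 0) ∧ ∀ Y, h p (X - P p X) Y = 0

/-- The rescaled metric `ε⁻² h + w`. -/
def rescaled (h w : Π p : N, TangentSpace 𝓘(ℝ, E) p → TangentSpace 𝓘(ℝ, E) p → ℝ) (ε : ℝ)
    (p : N) (X Y : TangentSpace 𝓘(ℝ, E) p) : ℝ := (ε ^ 2)⁻¹ * h p X Y + w p X Y

variable {h w : Π p : N, TangentSpace 𝓘(ℝ, E) p → TangentSpace 𝓘(ℝ, E) p → ℝ}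
  {P : Π p : N, TangentSpace 𝓘(ℝ, E) p → TangentSpace 𝓘(ℝ, E) p}

namespace IsSplitPair

variable (H : IsSplitPair h w)
include H

lemma left_add (p : N) (X Y Z : TangentSpace 𝓘(ℝ, E) p) : h p (X + Y) Z = h p X Z + h p Y Z := by
  obtain ⟨b, hb⟩ := H.smooth_left.exists_bilin p
  simp [hb]

lemma left_sub (p : N) (X Y Z : TangentSpace 𝓘(ℝ, E) p) : h p (X - Y) Z = h p X Z - h p Y Z := by
  obtain ⟨b, hb⟩ := H.smooth_left.exists_bilin p
  simp [hb]

lemma left_smul (p : N) (c : ℝ) (X Z : TangentSpace 𝓘(ℝ, E) p) : h p (c • X) Z = c * h p X Z := by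
  obtain ⟨b, hb⟩ := H.smooth_left.exists_bilin p
  simp [hb]

lemma right_add (p : N) (X Y Z : TangentSpace 𝓘(ℝ, E) p) : w p (X + Y) Z = w p X Z + w p Y Z := by
  obtain ⟨b, hb⟩ := H.smooth_right.exists_bilin p
  simp [hb]

lemma right_sub (p : N) (X Y Z : TangentSpace 𝓘(ℝ, E) p) : w p (X - Y) Z = w p X Z - w p Y Z := by
  obtain ⟨b, hb⟩ := H.smooth_right.exists_bilin p
  simp [hb]

lemma right_smul (p : N) (c : ℝ) (X Z : TangentSpace 𝓘(ℝ, E) p) : w p (c • X) Z = c * w p X Z := by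
  obtain ⟨b, hb⟩ := H.smooth_right.exists_bilin p
  simp [hb]

lemma rescaled_pos {ε : ℝ} (hε : 0 < ε) (p : N) (X : TangentSpace 𝓘(ℝ, E) p) (hX : X ≠ 0) :
    0 < rescaled h w ε p X X := by
  have h1 := H.nonneg_left p X
  have h2 := H.nonneg_right p X
  have h3 := H.pos p X hX
  have h4 : 0 < (ε ^ 2)⁻¹ := by positivity
  unfold rescaled
  rcases h1.eq_or_lt with h5 | h5
  · rw [← h5] at h3 ⊢
    linarith
  · have := mul_pos h4 h5
    linarith

/-- The rescaled metric has a Levi-Civita connection. -/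
lemma isLeviCivita [FiniteDimensional ℝ E] {ε : ℝ} (hε : 0 < ε) :
    IsLeviCivita 𝓘(ℝ, E) (rescaled h w ε) (leviCivita 𝓘(ℝ, E) (rescaled h w ε)) := by
  refine isLeviCivita_leviCivita ((H.smooth_left.const_mul _).add H.smooth_right) (fun p X Y => ?_)
    (fun p X hX => H.rescaled_pos hε p X hX)
  rw [rescaled, rescaled, H.symm_left, H.symm_right]

/-- A vector in the kernel of `w` is determined by its `h`-products with the kernel of `w`. -/
lemma eq_of_forall_left {p : N} {X Y : TangentSpace 𝓘(ℝ, E) p} (hX : ∀ Z, w p X Z = 0)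
    (hY : ∀ Z, w p Y Z = 0) (hXY : ∀ Z, (∀ W, w p Z W = 0) → h p X Z = h p Y Z) : X = Y := by
  by_contra hne
  -- The difference lies in the kernel of `w`, so it can be tested against itself: both forms vanish
  -- on it, contradicting positivity of the sum.
  have hw (Z) : w p (X - Y) Z = 0 := by rw [H.right_sub, hX, hY, sub_zero]
  have h1 := H.pos p (X - Y) (sub_ne_zero.2 hne)
  rw [hw, H.left_sub, hXY _ hw] at h1
  simp at h1

/-- The Gram operator of `h + w` has a smooth inverse. -/
lemma exists_local [FiniteDimensional ℝ E] (p : N) : ∃ B C : N → E →L[ℝ] E →L[ℝ] ℝ,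
    ContMDiffAt 𝓘(ℝ, E) 𝓘(ℝ, E →L[ℝ] E →L[ℝ] ℝ) ∞ B p ∧
    ContMDiffAt 𝓘(ℝ, E) 𝓘(ℝ, E →L[ℝ] E →L[ℝ] ℝ) ∞ C p ∧
    ContMDiffAt 𝓘(ℝ, E) 𝓘(ℝ, (E →L[ℝ] ℝ) →L[ℝ] E) ∞ (fun q => (B q + C q).inverse) p ∧
    ∀ᶠ q in 𝓝 p, (∀ X Y, h q X Y = B q (triv p q X) (triv p q Y)) ∧
      (∀ X Y, w q X Y = C q (triv p q X) (triv p q Y)) ∧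
      ∀ u, (B q + C q).inverse (B q u + C q u) = u := by
  obtain ⟨B, hB, hBh⟩ := H.smooth_left p
  obtain ⟨C, hC, hCw⟩ := H.smooth_right p
  have hker : ∀ᶠ q in 𝓝 p, ∀ u, (B q + C q) u = 0 → u = 0 := by
    filter_upwards [hBh, hCw, (chartAt E p).open_source.mem_nhds (mem_chart_source E p)]
      with q h1 h2 hq u hu
    obtain ⟨e, he⟩ := exists_equiv_triv hq
    by_contra hne
    have h3 := H.pos q (e.symm u) (by simpa using hne)
    rw [h1, h2, ← he, e.apply_symm_apply] at h3
    have h4 : (B q + C q) u u = 0 := by rw [hu]; rfl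
    exact h3.ne' h4
  refine ⟨B, C, hB, hC, ?_, ?_⟩
  · obtain ⟨f, hf⟩ := exists_flat_equiv hker.self_of_nhds
    have h1 : ContDiffAt ℝ ∞ ContinuousLinearMap.inverse (B p + C p) := by
      rw [← hf]
      exact contDiffAt_map_inverse f
    exact h1.contMDiffAt.comp p (hB.add hC)
  · filter_upwards [hBh, hCw, hker] with q h1 h2 h3
    obtain ⟨f, hf⟩ := exists_flat_equiv h3
    refine ⟨h1, h2, fun u => ?_⟩
    rw [← hf, ContinuousLinearMap.inverse_equiv]
    have : B q u + C q u = f u := by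
      rw [← add_apply, ← hf]; rfl
    rw [this]
    exact f.symm_apply_apply u

lemma proj_eq (hP : IsSplitProj h w P) {p : N} {Z : TangentSpace 𝓘(ℝ, E) p}
    (hZ : ∀ Y, w p Z Y = 0) : P p Z = Z := by
  refine H.eq_of_forall_left (hP p Z).1 hZ fun W _ => ?_
  have := (hP p Z).2 W
  rw [H.left_sub] at this
  linarith

lemma proj_add (hP : IsSplitProj h w P) {p : N} (Y Z : TangentSpace 𝓘(ℝ, E) p) :
    P p (Y + Z) = P p Y + P p Z := by
  refine H.eq_of_forall_left (hP p _).1 (fun W => ?_) fun W _ => ?_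
  · rw [H.right_add, (hP p Y).1, (hP p Z).1, add_zero]
  · have h1 := (hP p Y).2 W
    have h2 := (hP p Z).2 W
    have h3 := (hP p (Y + Z)).2 W
    rw [H.left_sub] at h1 h2 h3
    rw [H.left_add] at h3 ⊢
    linarith

/-- The projection onto the kernel of `w` along the kernel of `h` preserves smoothness. -/
lemma smoothAt_proj [FiniteDimensional ℝ E] (hP : IsSplitProj h w P) {p : N}
    {X : Π q : N, TangentSpace 𝓘(ℝ, E) q} (hX : SmoothAt X p) :
    SmoothAt (fun q => P q (X q)) p := by
  obtain ⟨B, C, hB, hC, hI, hev⟩ := H.exists_local p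
  refine contMDiffAt_of_triv ?_
  -- From h(PX, ·) = h(X, ·) and w(PX, ·) = 0 follows (B + C)(PX) = B X, so PX = (B + C)⁻¹ B X in
  -- the trivialization.
  refine (hI.clm_apply (hB.clm_apply (contMDiffAt_triv hX))).congr_of_eventuallyEq ?_
  filter_upwards [hev, (chartAt E p).open_source.mem_nhds (mem_chart_source E p)] with q hq hs
  obtain ⟨h1, h2, h3⟩ := hq
  obtain ⟨e, he⟩ := exists_equiv_triv hs
  rw [← h3 (triv p q (P q (X q)))]
  congr 1
  ext v
  have h4 := (hP q (X q)).1 (e.symm v)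
  have h5 := (hP q (X q)).2 (e.symm v)
  rw [H.left_sub, h1, h1, ← he (e.symm v), e.apply_symm_apply] at h5
  rw [h2, ← he (e.symm v), e.apply_symm_apply] at h4
  rw [add_apply, h4, add_zero]
  linarith

/-- The Koszul expression of `h`. -/
abbrev _root_.Finsler.koszulForm
    (h : Π p : N, TangentSpace 𝓘(ℝ, E) p → TangentSpace 𝓘(ℝ, E) p → ℝ)
    (X Y Z : Π p : N, TangentSpace 𝓘(ℝ, E) p) (p : N) : ℝ :=
  mvfderiv 𝓘(ℝ, E) (fun q => h q (Y q) (Z q)) p (X p) +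
  mvfderiv 𝓘(ℝ, E) (fun q => h q (X q) (Z q)) p (Y p) -
  mvfderiv 𝓘(ℝ, E) (fun q => h q (X q) (Y q)) p (Z p) +
  h p (VectorField.mlieBracket 𝓘(ℝ, E) X Y p) (Z p) -
  h p (VectorField.mlieBracket 𝓘(ℝ, E) X Z p) (Y p) -
  h p (VectorField.mlieBracket 𝓘(ℝ, E) Y Z p) (X p)

/-- The Koszul formula for the rescaled metric on the kernel of `w`. -/
lemma left_proj_leviCivita [FiniteDimensional ℝ E] (hP : IsSplitProj h w P) {p : N}
    {X U Z : Π q : N, TangentSpace 𝓘(ℝ, E) q} (hX : DiffField X p) (hU : DiffField U p)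
    (hZ : DiffField Z p) (hUw : ∀ q Y, w q (U q) Y = 0) (hZw : ∀ q Y, w q (Z q) Y = 0)
    {ε : ℝ} (hε : 0 < ε) :
    2 * h p (P p (leviCivita 𝓘(ℝ, E) (rescaled h w ε) U p (X p))) (Z p) =
      koszulForm h X U Z p - ε ^ 2 * w p (VectorField.mlieBracket 𝓘(ℝ, E) U Z p) (X p) := by
  have hk := (H.isLeviCivita hε).koszul ((H.smooth_left.const_mul _).add H.smooth_right)
    (fun p X Y => by rw [rescaled, rescaled, H.symm_left, H.symm_right]) hX hU hZ
  have hw1 (q) (Y : TangentSpace 𝓘(ℝ, E) q) : w q Y (U q) = 0 := by rw [H.symm_right, hUw]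
  have hw2 (q) (Y : TangentSpace 𝓘(ℝ, E) q) : w q Y (Z q) = 0 := by rw [H.symm_right, hZw]
  have hd (f : N → ℝ) (hf : MDifferentiableAt 𝓘(ℝ, E) 𝓘(ℝ, ℝ) f p)
      (v : TangentSpace 𝓘(ℝ, E) p) :
      mvfderiv 𝓘(ℝ, E) (fun q => (ε ^ 2)⁻¹ * f q) p v = (ε ^ 2)⁻¹ * mvfderiv 𝓘(ℝ, E) f p v := by
    have := mvfderiv_fun_mul (I := 𝓘(ℝ, E)) (f := fun _ : N => (ε ^ 2)⁻¹)
      mdifferentiableAt_const hf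
    rw [this, mvfderiv_const]
    simp
  -- The only `w`-term without `U` or `Z` in a slot is w([U, Z], X). It lacks the factor ε⁻² carried
  -- by the `h`-terms, hence the ε² in the result.
  simp only [rescaled, hw1, hw2, add_zero] at hk
  rw [hd _ (H.smooth_left.mdifferentiableAt hU hZ), hd _ (H.smooth_left.mdifferentiableAt hX hZ),
    hd _ (H.smooth_left.mdifferentiableAt hX hU)] at hk
  have h1 := (hP p (leviCivita 𝓘(ℝ, E) (rescaled h w ε) U p (X p))).2 (Z p)
  rw [H.left_sub, sub_eq_zero] at h1
  rw [← h1]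
  have hε2 : ε ^ 2 ≠ 0 := by positivity
  unfold koszulForm
  field_simp at hk
  linarith

/-- Identities between vectors of ker w are tested on single vectors, while the Koszul formula needs
fields in ker w. Projecting a local extension keeps it smooth and does not change its value at `p`.
-/
lemma exists_diffField (hP : IsSplitProj h w P) [FiniteDimensional ℝ E] (p : N)
    {z : TangentSpace 𝓘(ℝ, E) p} (hz : ∀ Y, w p z Y = 0) :
    ∃ Z : Π q : N, TangentSpace 𝓘(ℝ, E) q, SmoothAt Z p ∧ (∀ q Y, w q (Z q) Y = 0) ∧ Z p = z := by
  obtain ⟨S, hS⟩ := exists_eventually_smoothAt (E := E) p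
  have hS := hS.self_of_nhds (triv p p z)
  refine ⟨fun q => P q (S (triv p p z) q), H.smoothAt_proj hP hS.1, fun q => (hP q _).1, ?_⟩
  obtain ⟨e, he⟩ := exists_equiv_triv (mem_chart_source E p)
  have h1 : S (triv p p z) p = z := by
    apply e.injective
    rw [he, he, hS.2]
  change P p (S (triv p p z) p) = z
  rw [h1]
  exact H.proj_eq hP hz

/-- The limit of the compressed connections, as a combination of two of them. -/
def _root_.Finsler.limitConn
    (h w : Π p : N, TangentSpace 𝓘(ℝ, E) p → TangentSpace 𝓘(ℝ, E) p → ℝ)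
    (P : Π p : N, TangentSpace 𝓘(ℝ, E) p → TangentSpace 𝓘(ℝ, E) p)
    (X U : Π q : N, TangentSpace 𝓘(ℝ, E) q) (p : N) : TangentSpace 𝓘(ℝ, E) p :=
  -- If the value at ε is L + ε² A, then ε = 1 and ε = 2 give L + A and L + 4A, and 4/3 (L + A) -
  -- 1/3 (L + 4A) = L.
  (4 / 3 : ℝ) • P p (leviCivita 𝓘(ℝ, E) (rescaled h w 1) U p (X p)) -
    (1 / 3 : ℝ) • P p (leviCivita 𝓘(ℝ, E) (rescaled h w 2) U p (X p))

lemma right_limitConn (hP : IsSplitProj h w P) (X U : Π q : N, TangentSpace 𝓘(ℝ, E) q) (p : N)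
    (Y : TangentSpace 𝓘(ℝ, E) p) : w p (limitConn h w P X U p) Y = 0 := by
  rw [limitConn, H.right_sub, H.right_smul, H.right_smul, (hP p _).1, (hP p _).1]
  ring

/-- The weights 4/3 and -1/3 cancel the terms ε² w([U, Z], X) at ε = 1 and ε = 2 and add up to one,
which leaves the Koszul expression of `h`. -/
lemma left_limitConn [FiniteDimensional ℝ E] (hP : IsSplitProj h w P) {p : N}
    {X U Z : Π q : N, TangentSpace 𝓘(ℝ, E) q} (hX : DiffField X p) (hU : DiffField U p)
    (hZ : DiffField Z p) (hUw : ∀ q Y, w q (U q) Y = 0) (hZw : ∀ q Y, w q (Z q) Y = 0) :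
    2 * h p (limitConn h w P X U p) (Z p) = koszulForm h X U Z p := by
  have h1 := H.left_proj_leviCivita hP hX hU hZ hUw hZw one_pos
  have h2 := H.left_proj_leviCivita hP hX hU hZ hUw hZw two_pos
  rw [limitConn, H.left_sub, H.left_smul, H.left_smul]
  linarith

/-- The compressed connections are affine in `ε²`. -/
lemma proj_leviCivita_eq [FiniteDimensional ℝ E] (hP : IsSplitProj h w P) {p : N}
    {X U : Π q : N, TangentSpace 𝓘(ℝ, E) q} (hX : DiffField X p) (hU : DiffField U p)
    (hUw : ∀ q Y, w q (U q) Y = 0) {ε : ℝ} (hε : 0 < ε) :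
    P p (leviCivita 𝓘(ℝ, E) (rescaled h w ε) U p (X p)) = limitConn h w P X U p +
      ε ^ 2 • (P p (leviCivita 𝓘(ℝ, E) (rescaled h w 1) U p (X p)) - limitConn h w P X U p) := by
  refine H.eq_of_forall_left (hP p _).1 (fun Y => ?_) fun z hz => ?_
  · rw [H.right_add, H.right_smul, H.right_sub, H.right_limitConn hP, (hP p _).1]
    ring
  · obtain ⟨Z, hZ, hZw, rfl⟩ := H.exists_diffField hP p hz
    have h1 := H.left_proj_leviCivita hP hX hU hZ.diffField hUw hZw one_pos
    have h2 := H.left_proj_leviCivita hP hX hU hZ.diffField hUw hZw hε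
    have h3 := H.left_limitConn hP hX hU hZ.diffField hUw hZw
    rw [H.left_add, H.left_smul, H.left_sub]
    -- The `w`-term occurs with weight ε² in `h2`, 1 in `h1` and 0 in `h3`. The coefficients cancel
    -- it together with the Koszul expression.
    linear_combination (1 / 2) * h2 - (ε ^ 2 / 2) * h1 - ((1 - ε ^ 2) / 2) * h3

/-- The Bott connection of the splitting. -/
def _root_.Finsler.splitBott
    (h w : Π p : N, TangentSpace 𝓘(ℝ, E) p → TangentSpace 𝓘(ℝ, E) p → ℝ)
    (P : Π p : N, TangentSpace 𝓘(ℝ, E) p → TangentSpace 𝓘(ℝ, E) p)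
    (X U : Π q : N, TangentSpace 𝓘(ℝ, E) q) (p : N) : TangentSpace 𝓘(ℝ, E) p :=
  P p (VectorField.mlieBracket 𝓘(ℝ, E) (fun q => X q - P q (X q)) U p) +
    P p (leviCivita 𝓘(ℝ, E) (rescaled h w 1) U p (P p (X p)))

lemma right_splitBott (hP : IsSplitProj h w P) (X U : Π q : N, TangentSpace 𝓘(ℝ, E) q) (p : N)
    (Y : TangentSpace 𝓘(ℝ, E) p) : w p (splitBott h w P X U p) Y = 0 := by
  rw [splitBott, H.right_add, (hP p _).1, (hP p _).1, add_zero]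

/-- Twice the limit connection is the sum of the Bott connection and its dual. -/
lemma mvfderiv_left_eq [FiniteDimensional ℝ E] (hP : IsSplitProj h w P) {p : N}
    {X U V : Π q : N, TangentSpace 𝓘(ℝ, E) q} (hX : SmoothAt X p) (hU : DiffField U p)
    (hV : DiffField V p) (hUw : ∀ q Y, w q (U q) Y = 0) (hVw : ∀ q Y, w q (V q) Y = 0) :
    mvfderiv 𝓘(ℝ, E) (fun q => h q (U q) (V q)) p (X p) =
      h p (splitBott h w P X U p) (V p) +
      h p (U p) ((2 : ℝ) • limitConn h w P X V p - splitBott h w P X V p) := by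
  set XH : Π q : N, TangentSpace 𝓘(ℝ, E) q := fun q => P q (X q) with hXH
  set XV : Π q : N, TangentSpace 𝓘(ℝ, E) q := fun q => X q - P q (X q) with hXV
  have h1 : DiffField XH p := (H.smoothAt_proj hP hX).diffField
  have h2 : DiffField XV p := mdifferentiableAt_sub_section hX.diffField h1
  have hXVh (q) (Y) : h q (XV q) Y = 0 := (hP q (X q)).2 Y
  have hXHw (q) (Y) : w q Y (XH q) = 0 := by rw [H.symm_right]; exact (hP q (X q)).1 Y
  have hP1 (Y Z : TangentSpace 𝓘(ℝ, E) p) : h p (P p Y) Z = h p Y Z := by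
    have := (hP p Y).2 Z
    rw [H.left_sub] at this
    linarith
  have hb {U V : Π q : N, TangentSpace 𝓘(ℝ, E) q} (hU : DiffField U p)
      (hV : DiffField V p) (hUw : ∀ q Y, w q (U q) Y = 0) (hVw : ∀ q Y, w q (V q) Y = 0) :
      2 * h p (splitBott h w P X U p) (V p) =
        2 * h p (VectorField.mlieBracket 𝓘(ℝ, E) XV U p) (V p) + koszulForm h XH U V p := by
    have := H.left_proj_leviCivita hP h1 hU hV hUw hVw one_pos
    -- In a horizontal direction the ε²-term w([U, V], XH) is zero, so the connection at ε = 1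
    -- already has the Koszul expression of the limit.
    rw [hXHw] at this
    rw [splitBott, H.left_add, hP1]
    linarith
  have hl := H.left_limitConn hP h1 hV hU hVw hUw
  -- In the vertical direction h(XV, ·) = 0 leaves XV h(V, U) + h([XV, V], U) - h([XV, U], V). The
  -- two brackets cancel against the Bott terms of `V` and `U`.
  have hl' := H.left_limitConn hP h2 hV hU hVw hUw
  have hadd : limitConn h w P X V p = limitConn h w P XH V p + limitConn h w P XV V p := by
    have hx : X p = XH p + XV p := by simp [XH, XV]
    rw [limitConn, limitConn, limitConn, hx, map_add, map_add, H.proj_add hP, H.proj_add hP]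
    module
  have hx : mvfderiv 𝓘(ℝ, E) (fun q => h q (U q) (V q)) p (X p) =
      mvfderiv 𝓘(ℝ, E) (fun q => h q (U q) (V q)) p (XH p) +
      mvfderiv 𝓘(ℝ, E) (fun q => h q (U q) (V q)) p (XV p) := by
    rw [← map_add]
    simp [XH, XV]
  have hb1 := hb hU hV hUw hVw
  have hb2 := hb hV hU hVw hUw
  have hs : (fun q => h q (V q) (U q)) = fun q => h q (U q) (V q) := by
    ext q; rw [H.symm_left]
  have hc : mvfderiv 𝓘(ℝ, E) (fun _ : N => (0 : ℝ)) p = 0 := mvfderiv_const 0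
  have h0 (q) (Y) : h q Y (XV q) = 0 := by rw [H.symm_left]; exact hXVh q Y
  have hbr : VectorField.mlieBracket 𝓘(ℝ, E) V U p = - VectorField.mlieBracket 𝓘(ℝ, E) U V p :=
    VectorField.mlieBracket_swap_apply
  have hneg (Y Z : TangentSpace 𝓘(ℝ, E) p) : h p (-Y) Z = - h p Y Z := by
    obtain ⟨b, hb⟩ := H.smooth_left.exists_bilin p
    simp [hb]
  rw [H.symm_left p (U p), H.left_sub, H.left_smul, hadd, H.left_add, hx]
  simp only [koszulForm, hXVh, h0, hc, hs, hbr, hneg] at hl hl' hb1 hb2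
  simp only [zero_apply] at hl'
  linarith

/-- The defect of the compressed connection is locally bounded. -/
lemma exists_bound [FiniteDimensional ℝ E] (hP : IsSplitProj h w P)
    {X U : Π q : N, TangentSpace 𝓘(ℝ, E) q} (hX : SmoothField 𝓘(ℝ, E) X)
    (hU : SmoothField 𝓘(ℝ, E) U) (hUw : ∀ q Y, w q (U q) Y = 0) (p : N) :
    ∃ c, ∀ᶠ q in 𝓝 p, rescaled h w 1 q
      (P q (leviCivita 𝓘(ℝ, E) (rescaled h w 1) U q (X q)) - limitConn h w P X U q)
      (P q (leviCivita 𝓘(ℝ, E) (rescaled h w 1) U q (X q)) - limitConn h w P X U q) ≤ c := by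
  set A : Π q : N, TangentSpace 𝓘(ℝ, E) q := fun q =>
    P q (leviCivita 𝓘(ℝ, E) (rescaled h w 1) U q (X q)) - limitConn h w P X U q with hA
  have hAw (q) (Y) : w q (A q) Y = 0 := by
    rw [hA, H.right_sub, (hP q _).1, H.right_limitConn hP, sub_zero]
  -- Subtracting the Koszul formulas at ε = 1 and for the limit leaves only the `w`-term, which is
  -- smooth when `Z` is. No regularity of the chosen connection itself is used.
  have hAh (q) (Z : Π q : N, TangentSpace 𝓘(ℝ, E) q) (hZ : SmoothAt Z q)
      (hZw : ∀ q Y, w q (Z q) Y = 0) :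
      h q (A q) (Z q) = -(1 / 2) * w q (VectorField.mlieBracket 𝓘(ℝ, E) U Z q) (X q) := by
    have h1 := H.left_proj_leviCivita hP (SmoothAt.diffField (hX q))
      (SmoothAt.diffField (hU q)) hZ.diffField hUw hZw one_pos
    have h2 := H.left_limitConn hP (SmoothAt.diffField (hX q))
      (SmoothAt.diffField (hU q)) hZ.diffField hUw hZw
    rw [hA, H.left_sub]
    linarith
  obtain ⟨S, hS⟩ := exists_eventually_smoothAt (E := E) p
  obtain ⟨B, C, hB, hC, hI, hev⟩ := H.exists_local p
  let Z (e : E) : Π q : N, TangentSpace 𝓘(ℝ, E) q := fun q => P q (S e q)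
  -- The covector dual to the defect under h + w. In finite dimension its continuity can be tested
  -- on fixed vectors `e`, where `hAh` applies to the projected frame field `Z e`. The squared norm
  -- of the defect is then β((B + C)⁻¹ β), continuous at `p`.
  let β (q : N) : E →L[ℝ] ℝ := B q (triv p q (A q)) + C q (triv p q (A q))
  have hβe (e : E) : (fun q => β q e) =ᶠ[𝓝 p] fun q =>
      -(1 / 2) * w q (VectorField.mlieBracket 𝓘(ℝ, E) U (Z e) q) (X q) := by
    filter_upwards [hS, hev] with q hSq hq
    rw [← hAh q (Z e) (H.smoothAt_proj hP (hSq e).1) fun q => (hP q _).1]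
    have h1 : β q e = h q (A q) (S e q) + w q (A q) (S e q) := by
      rw [hq.1, hq.2.1, (hSq e).2]; rfl
    have h2 := (hP q (S e q)).2 (A q)
    rw [H.left_sub, H.symm_left, H.symm_left q (P q _)] at h2
    rw [h1, hAw]
    simp only [Z]
    linarith
  have hβ : ContinuousAt β p := by
    refine continuousAt_clm_apply.2 fun e => ContinuousAt.congr ?_ (hβe e).symm
    refine continuousAt_const.mul (ContMDiffAt.continuousAt
      (I := 𝓘(ℝ, E)) (I' := 𝓘(ℝ, ℝ)) (n := ∞) ?_)
    refine H.smooth_right.contMDiffAt ?_ (hX p)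
    have : IsManifold 𝓘(ℝ, E) (minSmoothness ℝ 2) N := by
      rw [minSmoothness_of_isRCLikeNormedField]
      infer_instance
    -- Here ∞ + 1 = ∞: the derivative lost in the bracket costs nothing.
    have : IsManifold 𝓘(ℝ, E) (((⊤ : ℕ∞) : ℕ∞ω) + 1) N := ‹IsManifold 𝓘(ℝ, E) ∞ N›
    exact ContMDiffAt.mlieBracket_vectorField (𝕜 := ℝ) (m := ⊤) (n := ⊤) (hU p)
      (H.smoothAt_proj hP (hS.self_of_nhds e).1) (by simp)
  have hcont : ContinuousAt (fun q => β q ((B q + C q).inverse (β q))) p :=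
    hβ.clm_apply (hI.continuousAt.clm_apply hβ)
  refine ⟨β p ((B p + C p).inverse (β p)) + 1, ?_⟩
  filter_upwards [hcont.eventually (gt_mem_nhds (lt_add_one _)), hev] with q h1 hq
  refine le_trans (le_of_eq ?_) h1.le
  have h2 : (B q + C q).inverse (β q) = triv p q (A q) := hq.2.2 _
  rw [h2]
  change rescaled h w 1 q (A q) (A q) = _
  rw [rescaled, hq.1, hq.2.1, one_pow, inv_one, one_mul]
  rfl

end IsSplitPair

end SplitForms

/-! ### Sprays, the forms δy and the angular form under changes of coordinates -/

section SprayCalculus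

variable {E : Type*} [NormedAddCommGroup E] [NormedSpace ℝ E]

/-- The vertical Hessian `½ L_{yy}` of a function `L` of `(x, y)`. -/
def vHess (L : E × E → ℝ) (q : E × E) : E →L[ℝ] E →L[ℝ] ℝ :=
  (1 / 2 : ℝ) • (fderiv ℝ (fderiv ℝ L) q).bilinearComp (.inr ℝ E E) (.inr ℝ E E)

/-- The covector `L_{yx} y - L_x`. -/
def sprayForm (L : E × E → ℝ) (q : E × E) : E →L[ℝ] ℝ :=
  (fderiv ℝ (fderiv ℝ L) q (q.2, 0)).comp (.inr ℝ E E) - (fderiv ℝ L q).comp (.inl ℝ E E)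

/-- The spray coefficients, as a vector. -/
def sprayVec (L : E × E → ℝ) (q : E × E) : E :=
  (vHess L q).inverse ((1 / 4 : ℝ) • sprayForm L q)

/-- The map `(ẋ, ẏ) ↦ (ẏ + G_y ẋ) / f`. -/
def deltaMap (f L : E × E → ℝ) (q : E × E) : E × E →L[ℝ] E :=
  (f q)⁻¹ • (.snd ℝ E E + ((fderiv ℝ (sprayVec L) q).comp (.inr ℝ E E)).comp (.fst ℝ E E))

/-- The vertical differential. -/
def vDiff (f : E × E → ℝ) (q : E × E) : E →L[ℝ] ℝ := (fderiv ℝ f q).comp (.inr ℝ E E)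

/-- The angular form `½ L_{yy} - f_y ⊗ f_y`. -/
def angForm (f L : E × E → ℝ) (q : E × E) : E →L[ℝ] E →L[ℝ] ℝ :=
  vHess L q - (vDiff f q).smulRight (vDiff f q)

lemma vHess_apply (L : E × E → ℝ) (q : E × E) (u v : E) :
    vHess L q u v = 1 / 2 * fderiv ℝ (fderiv ℝ L) q (0, u) (0, v) := rfl

lemma sprayForm_apply (L : E × E → ℝ) (q : E × E) (u : E) :
    sprayForm L q u = fderiv ℝ (fderiv ℝ L) q (q.2, 0) (0, u) - fderiv ℝ L q (u, 0) := rfl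

lemma deltaMap_apply (f L : E × E → ℝ) (q X : E × E) :
    deltaMap f L q X = (f q)⁻¹ • (X.2 + fderiv ℝ (sprayVec L) q (0, X.1)) := rfl

lemma vDiff_apply (f : E × E → ℝ) (q : E × E) (u : E) : vDiff f q u = fderiv ℝ f q (0, u) := rfl

lemma angForm_apply (f L : E × E → ℝ) (q : E × E) (u v : E) :
    angForm f L q u v = vHess L q u v - vDiff f q u * vDiff f q v := rfl

section Smooth

variable {L f : E × E → ℝ} {q : E × E}

lemma contDiffAt_fderiv_top {G K : Type*} [NormedAddCommGroup G] [NormedSpace ℝ G]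
    [NormedAddCommGroup K] [NormedSpace ℝ K] {f : G → K} {x : G} (h : ContDiffAt ℝ ∞ f x) :
    ContDiffAt ℝ ∞ (fderiv ℝ f) x := h.fderiv_right le_rfl

lemma contDiffAt_vHess (hL : ContDiffAt ℝ ∞ L q) : ContDiffAt ℝ ∞ (vHess L) q := by
  have h := contDiffAt_fderiv_top (contDiffAt_fderiv_top hL)
  let T : (E × E →L[ℝ] E × E →L[ℝ] ℝ) →L[ℝ] (E →L[ℝ] E →L[ℝ] ℝ) :=
    (1 / 2 : ℝ) • (ContinuousLinearMap.compL ℝ E (E × E →L[ℝ] ℝ) (E →L[ℝ] ℝ)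
      ((ContinuousLinearMap.compL ℝ E (E × E) ℝ).flip (.inr ℝ E E))).comp
      ((ContinuousLinearMap.compL ℝ E (E × E) (E × E →L[ℝ] ℝ)).flip (.inr ℝ E E))
  exact T.contDiff.contDiffAt.comp q h

lemma contDiffAt_sprayForm (hL : ContDiffAt ℝ ∞ L q) : ContDiffAt ℝ ∞ (sprayForm L) q := by
  have h1 := contDiffAt_fderiv_top hL
  have h := contDiffAt_fderiv_top h1
  refine ContDiffAt.sub ?_ ?_
  · exact (h.clm_apply (contDiffAt_snd.prodMk contDiffAt_const)).clm_comp contDiffAt_const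
  · exact h1.clm_comp contDiffAt_const

lemma contDiffAt_sprayVec [FiniteDimensional ℝ E] (hL : ContDiffAt ℝ ∞ L q)
    (h : ∀ u, vHess L q u = 0 → u = 0) : ContDiffAt ℝ ∞ (sprayVec L) q := by
  obtain ⟨e, he⟩ := exists_flat_equiv h
  have h1 : ContDiffAt ℝ ∞ ContinuousLinearMap.inverse (vHess L q) := by
    rw [← he]
    exact contDiffAt_map_inverse e
  exact (h1.comp q (contDiffAt_vHess hL)).clm_apply ((contDiffAt_sprayForm hL).const_smul _)

lemma vHess_sprayVec [FiniteDimensional ℝ E] (h : ∀ u, vHess L q u = 0 → u = 0) (u : E) :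
    vHess L q (sprayVec L q) u = 1 / 4 * sprayForm L q u := by
  obtain ⟨e, he⟩ := exists_flat_equiv h
  rw [sprayVec, ← he, ContinuousLinearMap.inverse_equiv]
  show e (e.symm _) u = _
  rw [e.apply_symm_apply]
  rfl

lemma contDiffAt_deltaMap [FiniteDimensional ℝ E] (hL : ContDiffAt ℝ ∞ L q)
    (h : ∀ u, vHess L q u = 0 → u = 0) (hf : ContDiffAt ℝ ∞ f q) (hf0 : f q ≠ 0) :
    ContDiffAt ℝ ∞ (deltaMap f L) q := by
  refine (hf.inv hf0).smul (contDiffAt_const.add ?_)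
  exact ((contDiffAt_fderiv_top (contDiffAt_sprayVec hL h)).clm_comp contDiffAt_const).clm_comp
    contDiffAt_const

lemma contDiffAt_vDiff (hf : ContDiffAt ℝ ∞ f q) : ContDiffAt ℝ ∞ (vDiff f) q :=
  (contDiffAt_fderiv_top hf).clm_comp contDiffAt_const

lemma contDiffAt_angForm (hL : ContDiffAt ℝ ∞ L q) (hf : ContDiffAt ℝ ∞ f q) :
    ContDiffAt ℝ ∞ (angForm f L) q :=
  (contDiffAt_vHess hL).sub ((contDiffAt_vDiff hf).smulRight (contDiffAt_vDiff hf))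

end Smooth

/-- The map induced by `τ` on pairs `(x, y)` of a point and a tangent vector. -/
def tangentMap (τ : E → E) (q : E × E) : E × E := (τ q.1, fderiv ℝ τ q.1 q.2)

variable {τ : E → E} {L L' f f' : E × E → ℝ} {O : Set (E × E)} {q : E × E}

/-- The product rule on Dτ(x) y. The term D²τ(ẋ, y) is what keeps dy from being a tensor, and the
spray must compensate it. -/
lemma hasFDerivAt_tangentMap (hτ : ContDiffAt ℝ ∞ τ q.1) : DifferentiableAt ℝ (tangentMap τ) q ∧
    ∀ X, fderiv ℝ (tangentMap τ) q X =
      (fderiv ℝ τ q.1 X.1, fderiv ℝ (fderiv ℝ τ) q.1 X.1 q.2 + fderiv ℝ τ q.1 X.2) := by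
  have h1 : HasFDerivAt (fun q : E × E => τ q.1) ((fderiv ℝ τ q.1).comp (.fst ℝ E E)) q :=
    (hτ.differentiableAt (by simp)).hasFDerivAt.comp q hasFDerivAt_fst
  have h2 : HasFDerivAt (fun q : E × E => fderiv ℝ τ q.1)
      ((fderiv ℝ (fderiv ℝ τ) q.1).comp (.fst ℝ E E)) q :=
    ((contDiffAt_fderiv_top hτ).differentiableAt (by simp)).hasFDerivAt.comp q hasFDerivAt_fst
  have h3 := h1.prodMk (h2.clm_apply (hasFDerivAt_snd (𝕜 := ℝ) (E := E) (F := E)))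
  refine ⟨h3.differentiableAt, fun X => ?_⟩
  rw [show fderiv ℝ (tangentMap τ) q = _ from h3.fderiv]
  simp [add_comm]

/-- `L` is the expression of `L'` in the coordinates obtained by the change `τ`, on `O`. -/
structure IsCoordChange (τ : E → E) (L L' : E × E → ℝ) (O : Set (E × E)) : Prop where
  isOpen : IsOpen O
  smooth : ∀ q ∈ O, ContDiffAt ℝ ∞ τ q.1
  surj : ∀ q ∈ O, Function.Surjective (fderiv ℝ τ q.1)
  smooth_fun : ∀ q ∈ O, ContDiffAt ℝ ∞ L' (tangentMap τ q)
  eq : ∀ q ∈ O, L q = L' (tangentMap τ q)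

namespace IsCoordChange

lemma fderiv_eq (h : IsCoordChange τ L L' O) (hq : q ∈ O) (X : E × E) :
    fderiv ℝ L q X = fderiv ℝ L' (tangentMap τ q) (fderiv ℝ (tangentMap τ) q X) := by
  have h1 : L =ᶠ[𝓝 q] L' ∘ tangentMap τ := by
    filter_upwards [h.isOpen.mem_nhds hq] with x hx using h.eq x hx
  rw [h1.fderiv_eq, fderiv_comp _ ((h.smooth_fun q hq).differentiableAt (by simp))
    (hasFDerivAt_tangentMap (h.smooth q hq)).1]
  rfl

lemma vDiff_eq (h : IsCoordChange τ L L' O) (hq : q ∈ O) (u : E) :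
    vDiff L q u = vDiff L' (tangentMap τ q) (fderiv ℝ τ q.1 u) := by
  rw [vDiff_apply, vDiff_apply, h.fderiv_eq hq, (hasFDerivAt_tangentMap (h.smooth q hq)).2]
  simp

lemma contDiffAt (h : IsCoordChange τ L L' O) (hq : q ∈ O) : ContDiffAt ℝ ∞ L q := by
  have h1 : L =ᶠ[𝓝 q] L' ∘ tangentMap τ := by
    filter_upwards [h.isOpen.mem_nhds hq] with x hx using h.eq x hx
  refine ContDiffAt.congr_of_eventuallyEq ((h.smooth_fun q hq).comp q ?_) h1
  have h2 : ContDiffAt ℝ ∞ (fun q : E × E => τ q.1) q := (h.smooth q hq).comp q contDiffAt_fst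
  have h3 : ContDiffAt ℝ ∞ (fun q : E × E => fderiv ℝ τ q.1) q :=
    (contDiffAt_fderiv_top (h.smooth q hq)).comp q contDiffAt_fst
  exact h2.prodMk (h3.clm_apply contDiffAt_snd)

/-- One slot is kept vertical, which suffices for both the Hessian and the spray covector. A
vertical vector u goes to (0, Dτ(x) u), and differentiating this along X produces the additional
first-order term. -/
lemma fderiv_fderiv_eq (h : IsCoordChange τ L L' O) (hq : q ∈ O) (X : E × E) (u : E) :
    fderiv ℝ (fderiv ℝ L) q X (0, u) =
      fderiv ℝ (fderiv ℝ L') (tangentMap τ q) (fderiv ℝ (tangentMap τ) q X) (0, fderiv ℝ τ q.1 u) +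
      fderiv ℝ L' (tangentMap τ q) (0, fderiv ℝ (fderiv ℝ τ) q.1 X.1 u) := by
  have hd : DifferentiableAt ℝ (fderiv ℝ L) q :=
    (contDiffAt_fderiv_top (h.contDiffAt hq)).differentiableAt (by simp)
  have h1 : fderiv ℝ (fderiv ℝ L) q X (0, u) = fderiv ℝ (fun q => fderiv ℝ L q (0, u)) q X := by
    rw [fderiv_clm_apply hd (differentiableAt_const _)]
    simp
  have h2 : (fun q => fderiv ℝ L q (0, u)) =ᶠ[𝓝 q] fun q =>
      fderiv ℝ L' (tangentMap τ q) (0, fderiv ℝ τ q.1 u) := by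
    filter_upwards [h.isOpen.mem_nhds hq] with x hx
    exact h.vDiff_eq hx u
  have h3 : HasFDerivAt (fun q : E × E => fderiv ℝ τ q.1)
      ((fderiv ℝ (fderiv ℝ τ) q.1).comp (.fst ℝ E E)) q :=
    ((contDiffAt_fderiv_top (h.smooth q hq)).differentiableAt (by simp)).hasFDerivAt.comp q
      hasFDerivAt_fst
  have h4 : HasFDerivAt (fun q : E × E => ((0 : E), fderiv ℝ τ q.1 u)) _ q :=
    (hasFDerivAt_const (0 : E) q).prodMk (h3.clm_apply (hasFDerivAt_const u q))
  have h5 : HasFDerivAt (fun q => fderiv ℝ L' (tangentMap τ q)) _ q :=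
    ((contDiffAt_fderiv_top (h.smooth_fun q hq)).differentiableAt (by simp)).hasFDerivAt.comp q
      (hasFDerivAt_tangentMap (h.smooth q hq)).1.hasFDerivAt
  rw [h1, h2.fderiv_eq, (h5.clm_apply h4).fderiv]
  simp [add_comm]

/-- With both slots vertical no D²τ term survives, because the induced map is linear in the fibres.
So ½ L_yy is a tensor. -/
lemma vHess_eq (h : IsCoordChange τ L L' O) (hq : q ∈ O) (u v : E) :
    vHess L q u v = vHess L' (tangentMap τ q) (fderiv ℝ τ q.1 u) (fderiv ℝ τ q.1 v) := by
  rw [vHess_apply, vHess_apply, h.fderiv_fderiv_eq hq,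
    (hasFDerivAt_tangentMap (h.smooth q hq)).2]
  simp only [map_zero, zero_apply, zero_add, Prod.mk_zero_zero, add_zero]

lemma nondeg (h : IsCoordChange τ L L' O) (hq : q ∈ O)
    (hn : ∀ u, vHess L q u = 0 → u = 0) (u : E) (hu : vHess L' (tangentMap τ q) u = 0) : u = 0 := by
  obtain ⟨v, rfl⟩ := h.surj q hq u
  rw [hn v, map_zero]
  ext z
  rw [h.vHess_eq hq, hu]
  rfl

variable [FiniteDimensional ℝ E]

/-- The transformation law of the spray coefficients. -/
lemma sprayVec_eq (h : IsCoordChange τ L L' O) (hq : q ∈ O)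
    (hn : ∀ u, vHess L q u = 0 → u = 0) :
    fderiv ℝ τ q.1 (sprayVec L q) = sprayVec L' (tangentMap τ q) +
      (1 / 2 : ℝ) • fderiv ℝ (fderiv ℝ τ) q.1 q.2 q.2 := by
  have hn' := h.nondeg hq hn
  have hT := (hasFDerivAt_tangentMap (h.smooth q hq)).2
  have hs (u v : E) : fderiv ℝ (fderiv ℝ τ) q.1 u v = fderiv ℝ (fderiv ℝ τ) q.1 v u :=
    ((h.smooth q hq).isSymmSndFDerivAt
      (by simp; exact WithTop.coe_le_coe.2 (le_top : (2 : ℕ∞) ≤ ⊤))) u v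
  rw [← sub_eq_zero]
  -- Lower the index with the nondegenerate form ½ L'_yy and test on vectors Dτ v, which exhaust the
  -- space.
  refine hn' _ ?_
  ext z
  obtain ⟨v, rfl⟩ := h.surj q hq z
  have h1 := vHess_sprayVec hn v
  rw [h.vHess_eq hq, sprayForm_apply, h.fderiv_fderiv_eq hq, h.fderiv_eq hq, hT, hT] at h1
  have h2 := vHess_sprayVec hn' (fderiv ℝ τ q.1 v)
  rw [sprayForm_apply] at h2
  have h3 : vHess L' (tangentMap τ q) (fderiv ℝ (fderiv ℝ τ) q.1 q.2 q.2) (fderiv ℝ τ q.1 v) =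
    1 / 2 * fderiv ℝ (fderiv ℝ L') (tangentMap τ q) (0, fderiv ℝ (fderiv ℝ τ) q.1 q.2 q.2)
      (0, fderiv ℝ τ q.1 v) := rfl
  have h4 (a b c : E) : fderiv ℝ (fderiv ℝ L') (tangentMap τ q) (a, b) (0, c) =
      fderiv ℝ (fderiv ℝ L') (tangentMap τ q) (a, 0) (0, c) +
      fderiv ℝ (fderiv ℝ L') (tangentMap τ q) (0, b) (0, c) := by
    rw [← add_apply, ← map_add]; simp
  have h5 (a b : E) : fderiv ℝ L' (tangentMap τ q) (a, b) =
      fderiv ℝ L' (tangentMap τ q) (a, 0) + fderiv ℝ L' (tangentMap τ q) (0, b) := by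
    rw [← map_add]; simp
  have h6 : (tangentMap τ q).2 = fderiv ℝ τ q.1 q.2 := rfl
  rw [h6] at h2
  simp only [map_zero, add_zero] at h1
  -- By symmetry of D²τ the first-order terms L'_y D²τ(y, v) from L_yx y and from L_x cancel. The
  -- vertical part D²τ(y, y) of the transformed vector gives the correction, where ¼ becomes ½
  -- through the factor ½ in the Hessian.
  rw [h4, h5 (fderiv ℝ τ q.1 v), hs v q.2] at h1
  simp only [map_sub, map_add, map_smul, sub_apply, add_apply, smul_apply,
    smul_eq_mul, zero_apply]
  rw [h1, h2, h3]
  ring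

/-- Differentiate the transformation law in y at fixed x; the quadratic correction ½ D²τ(y, y)
becomes D²τ(u, y). The law is needed at neighbouring points too, hence nondegeneracy on all of `O`.
-/
lemma fderiv_sprayVec_eq (h : IsCoordChange τ L L' O) (hq : q ∈ O)
    (hn : ∀ q ∈ O, ∀ u, vHess L q u = 0 → u = 0) (u : E) :
    fderiv ℝ τ q.1 (fderiv ℝ (sprayVec L) q (0, u)) =
      fderiv ℝ (sprayVec L') (tangentMap τ q) (0, fderiv ℝ τ q.1 u) +
      fderiv ℝ (fderiv ℝ τ) q.1 u q.2 := by
  have hs : fderiv ℝ (fderiv ℝ τ) q.1 q.2 u = fderiv ℝ (fderiv ℝ τ) q.1 u q.2 :=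
    ((h.smooth q hq).isSymmSndFDerivAt
      (by simp; exact WithTop.coe_le_coe.2 (le_top : (2 : ℕ∞) ≤ ⊤))) q.2 u
  have hc : HasFDerivAt (fun y : E => (q.1, y)) (ContinuousLinearMap.inr ℝ E E) q.2 :=
    (hasFDerivAt_const q.1 q.2).prodMk (hasFDerivAt_id q.2)
  have hc' : HasFDerivAt (fun y : E => (τ q.1, fderiv ℝ τ q.1 y))
      ((0 : E →L[ℝ] E).prod (fderiv ℝ τ q.1)) q.2 :=
    (hasFDerivAt_const (τ q.1) q.2).prodMk (fderiv ℝ τ q.1).hasFDerivAt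
  have h1 := ((contDiffAt_sprayVec (h.contDiffAt hq) (hn q hq)).differentiableAt
    (by simp)).hasFDerivAt.comp q.2 hc
  have h2 := ((contDiffAt_sprayVec (h.smooth_fun q hq) (h.nondeg hq (hn q hq))).differentiableAt
    (by simp)).hasFDerivAt.comp q.2 hc'
  have h3 := ((fderiv ℝ (fderiv ℝ τ) q.1).hasFDerivAt (x := q.2)).clm_apply (hasFDerivAt_id q.2)
  have h4 := (fderiv ℝ τ q.1).hasFDerivAt.comp q.2 h1
  have h5 := h2.add (h3.const_smul (1 / 2 : ℝ))
  have h6 : (fun y => fderiv ℝ τ q.1 (sprayVec L (q.1, y))) =ᶠ[𝓝 q.2] fun y =>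
      sprayVec L' (τ q.1, fderiv ℝ τ q.1 y) +
        (1 / 2 : ℝ) • fderiv ℝ (fderiv ℝ τ) q.1 y y := by
    filter_upwards [hc.continuousAt.preimage_mem_nhds (h.isOpen.mem_nhds hq)] with y hy
    exact h.sprayVec_eq hy (hn _ hy)
  have h7 := congrArg (fun T => T u) ((h4.congr_of_eventuallyEq h6.symm).unique h5)
  simp only [ContinuousLinearMap.comp_apply, add_apply, smul_apply, ContinuousLinearMap.flip_apply,
    ContinuousLinearMap.prod_apply, zero_apply, ContinuousLinearMap.inr_apply, id,
    ContinuousLinearMap.id_apply, hs] at h7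
  rw [h7, ← two_smul ℝ (fderiv ℝ (fderiv ℝ τ) q.1 u q.2), smul_smul]
  norm_num

/-- The D²τ(ẋ, y) in the transformed ẏ is exactly the one in the law for G_y. Hence ẏ + G_y ẋ
transforms as a tangent vector. -/
lemma deltaMap_eq (h : IsCoordChange τ L L' O) (hf : IsCoordChange τ f f' O) (hq : q ∈ O)
    (hn : ∀ q ∈ O, ∀ u, vHess L q u = 0 → u = 0) (X : E × E) :
    deltaMap f' L' (tangentMap τ q) (fderiv ℝ (tangentMap τ) q X) =
      fderiv ℝ τ q.1 (deltaMap f L q X) := by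
  rw [deltaMap_apply, deltaMap_apply, map_smul, map_add, h.fderiv_sprayVec_eq hq hn,
    (hasFDerivAt_tangentMap (h.smooth q hq)).2, hf.eq q hq]
  congr 1
  dsimp only
  abel

lemma angForm_eq (h : IsCoordChange τ L L' O) (hf : IsCoordChange τ f f' O) (hq : q ∈ O) (u v : E) :
    angForm f' L' (tangentMap τ q) (fderiv ℝ τ q.1 u) (fderiv ℝ τ q.1 v) = angForm f L q u v := by
  rw [angForm_apply, angForm_apply, h.vHess_eq hq, hf.vDiff_eq hq, hf.vDiff_eq hq]

end IsCoordChange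

end SprayCalculus

/-! ### Euler's identities and the kernel of the angular form -/

section Homogeneous

variable {E : Type*} [NormedAddCommGroup E] [NormedSpace ℝ E]

/-- `f` is smooth, positive and homogeneous of degree one in the fibres of `O`, with positive
definite vertical Hessian of `f ^ 2`. -/
structure IsFinslerOn (f : E × E → ℝ) (O : Set (E × E)) : Prop where
  isOpen : IsOpen O
  smooth : ∀ q ∈ O, ContDiffAt ℝ ∞ f q
  pos : ∀ q ∈ O, 0 < f q
  homogeneous : ∀ q ∈ O, ∀ c : ℝ, 0 < c → f (q.1, c • q.2) = c * f q
  posDef : ∀ q ∈ O, ∀ u, u ≠ 0 → 0 < vHess (f ^ 2) q u u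

namespace IsFinslerOn

variable {f : E × E → ℝ} {O : Set (E × E)} {q : E × E}

lemma smooth_sq (h : IsFinslerOn f O) (hq : q ∈ O) : ContDiffAt ℝ ∞ (f ^ 2) q :=
  (h.smooth q hq).pow 2

lemma nondeg (h : IsFinslerOn f O) (hq : q ∈ O) (u : E) (hu : vHess (f ^ 2) q u = 0) : u = 0 := by
  by_contra h0
  have := h.posDef q hq u h0
  rw [hu] at this
  exact lt_irrefl _ this

lemma vHess_symm (h : IsFinslerOn f O) (hq : q ∈ O) (u v : E) :
    vHess (f ^ 2) q u v = vHess (f ^ 2) q v u := by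
  rw [vHess_apply, vHess_apply, ((h.smooth_sq hq).isSymmSndFDerivAt
    (by simp; exact WithTop.coe_le_coe.2 (le_top : (2 : ℕ∞) ≤ ⊤))) (0, u) (0, v)]

lemma angForm_symm (h : IsFinslerOn f O) (hq : q ∈ O) (u v : E) :
    angForm f (f ^ 2) q u v = angForm f (f ^ 2) q v u := by
  rw [angForm_apply, angForm_apply, h.vHess_symm hq, mul_comm]

/-- Euler's identity in degree one: differentiate f(x, c y) = c f(x, y) at c = 1. -/
lemma vDiff_self (h : IsFinslerOn f O) (hq : q ∈ O) : vDiff f q q.2 = f q := by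
  have h1 : HasDerivAt (fun c : ℝ => (q.1, c • q.2)) ((0 : E), (1 : ℝ) • q.2) 1 :=
    (hasDerivAt_const _ _).prodMk ((hasDerivAt_id (1 : ℝ)).smul_const q.2)
  have h2 : HasFDerivAt f (fderiv ℝ f q) (q.1, (1 : ℝ) • q.2) := by
    rw [one_smul]
    exact ((h.smooth q hq).differentiableAt (by simp)).hasFDerivAt
  have h3 := h2.comp_hasDerivAt (1 : ℝ) h1
  have h4 : HasDerivAt (fun c : ℝ => c * f q) (1 * f q) 1 := (hasDerivAt_id (1 : ℝ)).mul_const _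
  have h5 : f ∘ (fun c : ℝ => (q.1, c • q.2)) =ᶠ[𝓝 1] fun c => c * f q := by
    filter_upwards [lt_mem_nhds (zero_lt_one (α := ℝ))] with c hc using h.homogeneous q hq c hc
  have h6 := (h3.congr_of_eventuallyEq h5.symm).unique h4
  rw [one_smul, one_mul] at h6
  exact h6

lemma fderiv_sq (h : IsFinslerOn f O) (hq : q ∈ O) (X : E × E) :
    fderiv ℝ (f ^ 2) q X = 2 * f q * fderiv ℝ f q X := by
  have h1 := (((h.smooth q hq).differentiableAt (by simp)).hasFDerivAt.pow 2).fderiv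
  change fderiv ℝ (f ^ 2) q = _ at h1
  rw [h1]
  simp

/-- Differentiate Euler's identity (f²)_y y = 2 f² in the direction u: the derivative of the factor
y contributes (f²)_y u, which leaves (f²)_yy(u, y) = (f²)_y u = 2 f f_y u. -/
lemma vHess_self (h : IsFinslerOn f O) (hq : q ∈ O) (u : E) :
    vHess (f ^ 2) q u q.2 = f q * vDiff f q u := by
  have hd : DifferentiableAt ℝ (fderiv ℝ (f ^ 2)) q :=
    (contDiffAt_fderiv_top (h.smooth_sq hq)).differentiableAt (by simp)
  have h1 : HasFDerivAt (fun q : E × E => fderiv ℝ (f ^ 2) q (0, q.2)) _ q :=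
    hd.hasFDerivAt.clm_apply ((hasFDerivAt_const (0 : E) q).prodMk hasFDerivAt_snd)
  have h2 : (fun q : E × E => fderiv ℝ (f ^ 2) q (0, q.2)) =ᶠ[𝓝 q] fun q => 2 * (f ^ 2) q := by
    filter_upwards [h.isOpen.mem_nhds hq] with x hx
    rw [h.fderiv_sq hx]
    have := h.vDiff_self hx
    rw [vDiff_apply] at this
    rw [this, Pi.pow_apply]
    ring
  have h3 : HasFDerivAt (fun q => 2 * (f ^ 2) q) _ q :=
    ((h.smooth_sq hq).differentiableAt (by simp)).hasFDerivAt.const_mul 2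
  have h4 := congrArg (fun T => T (0, u)) ((h3.congr_of_eventuallyEq h2).unique h1)
  simp only [add_apply, smul_apply, ContinuousLinearMap.comp_apply, ContinuousLinearMap.flip_apply,
    ContinuousLinearMap.prod_apply, zero_apply, ContinuousLinearMap.coe_snd', smul_eq_mul] at h4
  rw [h.fderiv_sq hq] at h4
  rw [vHess_apply, vDiff_apply]
  linarith

lemma angForm_self (h : IsFinslerOn f O) (hq : q ∈ O) (u : E) : angForm f (f ^ 2) q u q.2 = 0 := by
  rw [angForm_apply, h.vHess_self hq, h.vDiff_self hq]
  ring

lemma angForm_self_left (h : IsFinslerOn f O) (hq : q ∈ O) (u : E) :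
    angForm f (f ^ 2) q q.2 u = 0 := by
  rw [h.angForm_symm hq, h.angForm_self hq]

lemma vDiff_sub (h : IsFinslerOn f O) (hq : q ∈ O) (u : E) :
    vDiff f q (u - ((f q)⁻¹ * vDiff f q u) • q.2) = 0 := by
  rw [map_sub, map_smul, h.vDiff_self hq, smul_eq_mul]
  field_simp [(h.pos q hq).ne']
  ring

/-- The radial vector y is null for the angular form, so the radial part of u may be removed. On the
remainder f_y vanishes and the angular form is the positive definite Hessian. -/
lemma angForm_eq_vHess (h : IsFinslerOn f O) (hq : q ∈ O) (u : E) :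
    angForm f (f ^ 2) q u u = vHess (f ^ 2) q (u - ((f q)⁻¹ * vDiff f q u) • q.2)
      (u - ((f q)⁻¹ * vDiff f q u) • q.2) := by
  have h1 : angForm f (f ^ 2) q u u = angForm f (f ^ 2) q (u - ((f q)⁻¹ * vDiff f q u) • q.2)
      (u - ((f q)⁻¹ * vDiff f q u) • q.2) := by
    simp only [map_sub, map_smul, sub_apply, smul_apply, h.angForm_self hq, h.angForm_self_left hq]
    simp
  rw [h1, angForm_apply, h.vDiff_sub hq]
  simp

lemma angForm_nonneg (h : IsFinslerOn f O) (hq : q ∈ O) (u : E) : 0 ≤ angForm f (f ^ 2) q u u := by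
  rw [h.angForm_eq_vHess hq]
  by_cases h0 : u - ((f q)⁻¹ * vDiff f q u) • q.2 = 0
  · rw [h0]; simp
  · exact (h.posDef q hq _ h0).le

lemma eq_smul_of_angForm (h : IsFinslerOn f O) (hq : q ∈ O) {u : E}
    (hu : angForm f (f ^ 2) q u u = 0) : u = ((f q)⁻¹ * vDiff f q u) • q.2 := by
  rw [h.angForm_eq_vHess hq] at hu
  by_contra h0
  exact (h.posDef q hq _ (sub_ne_zero.2 h0)).ne' hu

end IsFinslerOn

end Homogeneous

/-! ### Induced coordinates on TM and their transition maps -/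

section Coordinates

variable {m : ℕ} {M : Type*} [TopologicalSpace M] [ChartedSpace (Eu (m + 1)) M]
  [IsManifold 𝓘(ℝ, Eu (m + 1)) ∞ M]

/-- The coordinate change from the chart at `x₀` to the chart at `x₁`. -/
def chartChange (x₀ x₁ : M) : Eu (m + 1) → Eu (m + 1) :=
  chartAt (Eu (m + 1)) x₁ ∘ (chartAt (Eu (m + 1)) x₀).symm

lemma tchart_snd_eq_triv (x₀ : M) {v : TM m M} (hv : v.1 ∈ (chartAt (Eu (m + 1)) x₀).source) :
    (tchart x₀ v).2 = triv x₀ v.1 v.2 := (triv_apply hv v.2).symm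

lemma contDiffAt_chartChange {x₀ x₁ x : M} (h₀ : x ∈ (chartAt (Eu (m + 1)) x₀).source)
    (h₁ : x ∈ (chartAt (Eu (m + 1)) x₁).source) :
    ContDiffAt ℝ ∞ (chartChange x₀ x₁) (chartAt (Eu (m + 1)) x₀ x) := by
  have h2 : ContMDiffAt 𝓘(ℝ, Eu (m + 1)) 𝓘(ℝ, Eu (m + 1)) ∞ (extChartAt 𝓘(ℝ, Eu (m + 1)) x₀).symm
      (chartAt (Eu (m + 1)) x₀ x) :=
    (contMDiffOn_extChartAt_symm x₀).contMDiffAt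
      ((isOpen_extChartAt_target x₀).mem_nhds ((extChartAt 𝓘(ℝ, Eu (m + 1)) x₀).map_source
        (by rwa [extChartAt_source])))
  have h3 : ContMDiffAt 𝓘(ℝ, Eu (m + 1)) 𝓘(ℝ, Eu (m + 1)) ∞ (extChartAt 𝓘(ℝ, Eu (m + 1)) x₁)
      ((extChartAt 𝓘(ℝ, Eu (m + 1)) x₀).symm (chartAt (Eu (m + 1)) x₀ x)) := by
    have : (extChartAt 𝓘(ℝ, Eu (m + 1)) x₀).symm (chartAt (Eu (m + 1)) x₀ x) = x :=
      (chartAt (Eu (m + 1)) x₀).left_inv h₀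
    rw [this]
    exact contMDiffAt_extChartAt' h₁
  exact (h3.comp _ h2).contDiffAt

lemma eventually_chartChange {x₀ x₁ x : M} (h₀ : x ∈ (chartAt (Eu (m + 1)) x₀).source) :
    ∀ᶠ z in 𝓝 x, chartAt (Eu (m + 1)) x₁ z =
      chartChange x₀ x₁ (chartAt (Eu (m + 1)) x₀ z) := by
  filter_upwards [(chartAt (Eu (m + 1)) x₀).open_source.mem_nhds h₀] with z hz
  rw [chartChange, Function.comp_apply, (chartAt (Eu (m + 1)) x₀).left_inv hz]

lemma triv_eq_fderiv_chartChange {x₀ x₁ x : M} (h₀ : x ∈ (chartAt (Eu (m + 1)) x₀).source)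
    (h₁ : x ∈ (chartAt (Eu (m + 1)) x₁).source) (v : TangentSpace 𝓘(ℝ, Eu (m + 1)) x) :
    triv x₁ x v = fderiv ℝ (chartChange x₀ x₁) (chartAt (Eu (m + 1)) x₀ x) (triv x₀ x v) := by
  rw [triv_eq_mfderiv h₀, triv_eq_mfderiv h₁]
  have h2 : (extChartAt 𝓘(ℝ, Eu (m + 1)) x₁) =ᶠ[𝓝 x]
    chartChange x₀ x₁ ∘ extChartAt 𝓘(ℝ, Eu (m + 1)) x₀ := eventually_chartChange h₀
  have h3 : MDifferentiableAt 𝓘(ℝ, Eu (m + 1)) 𝓘(ℝ, Eu (m + 1)) (chartChange x₀ x₁)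
      (extChartAt 𝓘(ℝ, Eu (m + 1)) x₀ x) :=
    ((contDiffAt_chartChange h₀ h₁).differentiableAt (by simp)).mdifferentiableAt
  have h4 : MDifferentiableAt 𝓘(ℝ, Eu (m + 1)) 𝓘(ℝ, Eu (m + 1))
      (extChartAt 𝓘(ℝ, Eu (m + 1)) x₀) x := mdifferentiableAt_extChartAt h₀
  rw [h2.mfderiv_eq, mfderiv_comp x h3 h4, mfderiv_eq_fderiv]
  rfl

/-- The fibre part of the transition is the derivative of the base transition, by the chain rule.
This brings the coordinate calculus for `tangentMap` to bear on TM. -/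
lemma tchart_eq_tangentMap {x₀ x₁ : M} {v : TM m M} (h₀ : v.1 ∈ (chartAt (Eu (m + 1)) x₀).source)
    (h₁ : v.1 ∈ (chartAt (Eu (m + 1)) x₁).source) :
    tchart x₁ v = tangentMap (chartChange x₀ x₁) (tchart x₀ v) := by
  refine Prod.ext ?_ ?_
  · exact (eventually_chartChange h₀).self_of_nhds
  · rw [tchart_snd_eq_triv x₁ h₁, triv_eq_fderiv_chartChange h₀ h₁, ← tchart_snd_eq_triv x₀ h₀]
    rfl

lemma fderiv_chartChange_surjective {x₀ x₁ x : M} (h₀ : x ∈ (chartAt (Eu (m + 1)) x₀).source)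
    (h₁ : x ∈ (chartAt (Eu (m + 1)) x₁).source) :
    Function.Surjective (fderiv ℝ (chartChange x₀ x₁) (chartAt (Eu (m + 1)) x₀ x)) := by
  intro u
  obtain ⟨e, he⟩ := exists_equiv_triv h₁
  refine ⟨triv x₀ x (e.symm u), ?_⟩
  rw [← triv_eq_fderiv_chartChange h₀ h₁, ← he, e.apply_symm_apply]

/-- The coordinates of the nonzero vectors over the chart domain at `x₀`. -/
def slitDom (x₀ : M) : Set (Eu (m + 1) × Eu (m + 1)) :=
  {q | q.1 ∈ (chartAt (Eu (m + 1)) x₀).target ∧ q.2 ≠ 0}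

/-- The coordinates in the chart at `x₀` of the nonzero vectors over both chart domains. -/
def overlap (x₀ x₁ : M) : Set (Eu (m + 1) × Eu (m + 1)) :=
  {q | q.1 ∈ ((chartAt (Eu (m + 1)) x₀).symm ≫ₕ chartAt (Eu (m + 1)) x₁).source ∧ q.2 ≠ 0}

lemma isOpen_slitDom (x₀ : M) : IsOpen (slitDom (m := m) x₀) :=
  ((chartAt (Eu (m + 1)) x₀).open_target.preimage continuous_fst).inter
    (isOpen_ne.preimage continuous_snd)

lemma isOpen_overlap (x₀ x₁ : M) : IsOpen (overlap (m := m) x₀ x₁) :=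
  (((chartAt (Eu (m + 1)) x₀).symm ≫ₕ chartAt (Eu (m + 1)) x₁).open_source.preimage
    continuous_fst).inter
    (isOpen_ne.preimage continuous_snd)

lemma tchart_mem_slitDom {x₀ : M} {v : TM m M} (h₀ : v.1 ∈ (chartAt (Eu (m + 1)) x₀).source)
    (hv : v.2 ≠ 0) : tchart x₀ v ∈ slitDom x₀ :=
  ⟨(chartAt (Eu (m + 1)) x₀).map_source h₀,
    fun h => hv ((tchart_snd_eq_zero (mem_tchart_source.2 h₀)).1 h)⟩

lemma exists_of_mem_slitDom {x₀ : M} {q : Eu (m + 1) × Eu (m + 1)} (hq : q ∈ slitDom x₀) :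
    ∃ v : TM m M, v.1 ∈ (chartAt (Eu (m + 1)) x₀).source ∧ v.2 ≠ 0 ∧ tchart x₀ v = q ∧
      (tchart x₀).symm q = v := by
  have h1 : q ∈ (tchart x₀).target := mem_tchart_target.2 hq.1
  have h2 := (tchart x₀).map_target h1
  refine ⟨(tchart x₀).symm q, mem_tchart_source.1 h2, fun h => hq.2 ?_,
    (tchart x₀).right_inv h1, rfl⟩
  rw [← (tchart x₀).right_inv h1]
  exact (tchart_snd_eq_zero h2).2 h

lemma tchart_mem_overlap {x₀ x₁ : M} {v : TM m M} (h₀ : v.1 ∈ (chartAt (Eu (m + 1)) x₀).source)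
    (h₁ : v.1 ∈ (chartAt (Eu (m + 1)) x₁).source) (hv : v.2 ≠ 0) :
    tchart x₀ v ∈ overlap x₀ x₁ := by
  refine ⟨⟨(chartAt (Eu (m + 1)) x₀).map_source h₀, ?_⟩, (tchart_mem_slitDom h₀ hv).2⟩
  show (chartAt (Eu (m + 1)) x₀).symm (chartAt (Eu (m + 1)) x₀ v.1) ∈
    (chartAt (Eu (m + 1)) x₁).source
  rwa [(chartAt (Eu (m + 1)) x₀).left_inv h₀]

lemma exists_of_mem_overlap {x₀ x₁ : M} {q : Eu (m + 1) × Eu (m + 1)} (hq : q ∈ overlap x₀ x₁) :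
    ∃ v : TM m M, v.1 ∈ (chartAt (Eu (m + 1)) x₀).source ∧
      v.1 ∈ (chartAt (Eu (m + 1)) x₁).source ∧ v.2 ≠ 0 ∧ tchart x₀ v = q := by
  obtain ⟨v, h1, h2, rfl, -⟩ := exists_of_mem_slitDom (x₀ := x₀) (M := M) ⟨hq.1.1, hq.2⟩
  refine ⟨v, h1, ?_, h2, rfl⟩
  have h3 : (chartAt (Eu (m + 1)) x₀).symm (chartAt (Eu (m + 1)) x₀ v.1) ∈
    (chartAt (Eu (m + 1)) x₁).source := hq.1.2
  rwa [(chartAt (Eu (m + 1)) x₀).left_inv h1] at h3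

lemma inCoord_tchart (F : TM m M → ℝ) {x₀ : M} {v : TM m M}
    (h₀ : v.1 ∈ (chartAt (Eu (m + 1)) x₀).source) : inCoord F x₀ (tchart x₀ v) = F v := by
  rw [inCoord, (tchart x₀).left_inv (mem_tchart_source.2 h₀)]

namespace FinslerStructure

variable (F : FinslerStructure m M)

lemma contDiffAt_inCoord {x₀ : M} {q : Eu (m + 1) × Eu (m + 1)} (hq : q ∈ slitDom x₀) :
    ContDiffAt ℝ ∞ (inCoord F.toFun x₀) q := by
  have h1 : ContMDiffOn 𝓘(ℝ, Eu (m + 1) × Eu (m + 1)) 𝓘(ℝ, Eu (m + 1)).tangent ∞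
      (extChartAt 𝓘(ℝ, Eu (m + 1)).tangent (⟨x₀, 0⟩ : TangentBundle 𝓘(ℝ, Eu (m + 1)) M)).symm
      (slitDom x₀) := by
    refine (contMDiffOn_extChartAt_symm _).mono fun q hq => ?_
    rw [extChartAt_target]
    simp only [mem_inter_iff]
    refine ⟨mem_tchart_target.2 hq.1, ?_⟩
    rw [ModelWithCorners.Boundaryless.range_eq_univ]
    trivial
  have h2 : ContMDiffOn 𝓘(ℝ, Eu (m + 1) × Eu (m + 1)) 𝓘(ℝ, ℝ) ∞ (inCoord F.toFun x₀)
      (slitDom x₀) := by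
    refine F.smooth.comp h1 fun q hq => ?_
    obtain ⟨v, h1, h2, h3, h4⟩ := exists_of_mem_slitDom hq
    change ((tchart x₀).symm q).2 ≠ 0
    rw [h4]
    exact h2
  exact (contMDiffOn_iff_contDiffOn.1 h2).contDiffAt ((isOpen_slitDom x₀).mem_nhds hq)

lemma isCoordChange (x₀ x₁ : M) : IsCoordChange (chartChange x₀ x₁) (inCoord F.toFun x₀)
    (inCoord F.toFun x₁) (overlap x₀ x₁) where
  isOpen := isOpen_overlap x₀ x₁
  smooth q hq := by
    obtain ⟨v, h0, h1, h2, rfl⟩ := exists_of_mem_overlap hq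
    exact contDiffAt_chartChange h0 h1
  surj q hq := by
    obtain ⟨v, h0, h1, h2, rfl⟩ := exists_of_mem_overlap hq
    exact fderiv_chartChange_surjective h0 h1
  smooth_fun q hq := by
    obtain ⟨v, h0, h1, h2, rfl⟩ := exists_of_mem_overlap hq
    rw [← tchart_eq_tangentMap h0 h1]
    exact F.contDiffAt_inCoord (tchart_mem_slitDom h1 h2)
  eq q hq := by
    obtain ⟨v, h0, h1, h2, rfl⟩ := exists_of_mem_overlap hq
    rw [← tchart_eq_tangentMap h0 h1, inCoord_tchart _ h0, inCoord_tchart _ h1]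

lemma isCoordChange_sq (x₀ x₁ : M) : IsCoordChange (chartChange x₀ x₁) (inCoord F.toFun x₀ ^ 2)
    (inCoord F.toFun x₁ ^ 2) (overlap x₀ x₁) where
  isOpen := isOpen_overlap x₀ x₁
  smooth := (F.isCoordChange x₀ x₁).smooth
  surj := (F.isCoordChange x₀ x₁).surj
  smooth_fun q hq := ((F.isCoordChange x₀ x₁).smooth_fun q hq).pow 2
  eq q hq := by rw [Pi.pow_apply, Pi.pow_apply, (F.isCoordChange x₀ x₁).eq q hq]

lemma fundMatrix_eq_vHess {x₀ : M} {q : Eu (m + 1) × Eu (m + 1)} (hq : q ∈ slitDom x₀)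
    (i j : Fin (m + 1)) : fundMatrix F.toFun x₀ q i j =
      vHess (inCoord F.toFun x₀ ^ 2) q (EuclideanSpace.single i 1) (EuclideanSpace.single j 1) := by
  have hd : DifferentiableAt ℝ (fderiv ℝ (inCoord F.toFun x₀ ^ 2)) q :=
    (contDiffAt_fderiv_top ((F.contDiffAt_inCoord hq).pow 2)).differentiableAt (by simp)
  rw [vHess_apply, fundMatrix, Matrix.of_apply, ddy]
  congr 1
  change fderiv ℝ (fun q => fderiv ℝ (inCoord F.toFun x₀ ^ 2) q
    (0, EuclideanSpace.single j 1)) q (0, EuclideanSpace.single i 1) = _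
  rw [fderiv_clm_apply hd (differentiableAt_const _)]
  simp

lemma euclidean_sum (u : Eu (m + 1)) : u = ∑ i, u i • EuclideanSpace.single i (1 : ℝ) := by
  ext j
  simp [Pi.single_apply]

lemma bilin_eq_sum (b : Eu (m + 1) →L[ℝ] Eu (m + 1) →L[ℝ] ℝ) (u v : Eu (m + 1)) :
    b u v = ∑ i, ∑ j, b (EuclideanSpace.single i 1) (EuclideanSpace.single j 1) * u i * v j := by
  conv_lhs => rw [euclidean_sum u, euclidean_sum v]
  simp only [map_sum, map_smul, sum_apply, smul_apply, smul_eq_mul, Finset.mul_sum]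
  rw [Finset.sum_comm]
  refine Finset.sum_congr rfl fun i _ => Finset.sum_congr rfl fun j _ => by ring

lemma isFinslerOn (x₀ : M) : IsFinslerOn (inCoord F.toFun x₀) (slitDom x₀) where
  isOpen := isOpen_slitDom x₀
  smooth q hq := F.contDiffAt_inCoord hq
  pos q hq := by
    obtain ⟨v, h1, h2, rfl, -⟩ := exists_of_mem_slitDom hq
    rw [inCoord_tchart _ h1]
    exact F.pos v h2
  homogeneous q hq c hc := by
    obtain ⟨v, h1, h2, rfl, -⟩ := exists_of_mem_slitDom hq
    have : ((tchart x₀ v).1, c • (tchart x₀ v).2) = tchart x₀ (dil c v) :=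
      Prod.ext rfl (tchart_dil_snd c (mem_tchart_source.2 h1)).symm
    rw [this, inCoord_tchart _ h1, inCoord_tchart _ (show (dil c v).1 ∈ _ from h1),
      F.homogeneous v h2 c hc]
  posDef q hq u hu := by
    obtain ⟨v, h1, h2, rfl, -⟩ := exists_of_mem_slitDom hq
    have hs : v.1 ∈ (chartAt (Eu (m + 1)) v.1).source := mem_chart_source _ _
    -- Positivity is assumed only in the chart centred at the base point of `v`; the tensor law of
    -- the Hessian carries it to the chart at `x₀`.
    obtain ⟨u', rfl⟩ := fderiv_chartChange_surjective hs h1 u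
    have h3 := (F.isCoordChange_sq v.1 x₀).vHess_eq (tchart_mem_overlap hs h1 h2) u' u'
    rw [← tchart_eq_tangentMap hs h1] at h3
    change 0 < vHess _ _ (fderiv ℝ _ (tchart v.1 v).1 u') (fderiv ℝ _ (tchart v.1 v).1 u')
    rw [← h3, bilin_eq_sum]
    have hu' : u'.ofLp ≠ 0 := by
      intro h
      have : u' = 0 := by ext i; exact congrFun h i
      exact hu (by rw [this, map_zero])
    have h4 := (F.posDef v h2).dotProduct_mulVec_pos hu'
    simp only [dotProduct, Matrix.mulVec, Finset.mul_sum] at h4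
    refine h4.trans_eq (Finset.sum_congr rfl fun i _ => Finset.sum_congr rfl fun j _ => ?_)
    rw [F.fundMatrix_eq_vHess (tchart_mem_slitDom hs h2)]
    simp
    ring

end FinslerStructure

end Coordinates

/-! ### Index formulas in invariant form -/

namespace FinslerStructure

variable {m : ℕ} {M : Type*} [TopologicalSpace M] [ChartedSpace (Eu (m + 1)) M]
  [IsManifold 𝓘(ℝ, Eu (m + 1)) ∞ M] (F : FinslerStructure m M)

section Forms

variable {x₀ : M} {q : Eu (m + 1) × Eu (m + 1)}

lemma ddx_ddy (hq : q ∈ slitDom x₀) (k j : Fin (m + 1)) :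
    ddx k (ddy j (inCoord F.toFun x₀ ^ 2)) q =
      fderiv ℝ (fderiv ℝ (inCoord F.toFun x₀ ^ 2)) q (EuclideanSpace.single k 1, 0)
        (0, EuclideanSpace.single j 1) := by
  have hd : DifferentiableAt ℝ (fderiv ℝ (inCoord F.toFun x₀ ^ 2)) q :=
    (contDiffAt_fderiv_top ((F.contDiffAt_inCoord hq).pow 2)).differentiableAt (by simp)
  rw [ddx]
  change fderiv ℝ (fun q => fderiv ℝ (inCoord F.toFun x₀ ^ 2) q
    (0, EuclideanSpace.single j 1)) q (EuclideanSpace.single k 1, 0) = _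
  rw [fderiv_clm_apply hd (differentiableAt_const _)]
  simp

lemma sprayForm_single (hq : q ∈ slitDom x₀) (j : Fin (m + 1)) :
    sprayForm (inCoord F.toFun x₀ ^ 2) q (EuclideanSpace.single j 1) =
      ∑ k, ddx k (ddy j (inCoord F.toFun x₀ ^ 2)) q * q.2 k - ddx j (inCoord F.toFun x₀ ^ 2) q := by
  rw [sprayForm_apply]
  congr 1
  let T : Eu (m + 1) →L[ℝ] ℝ :=
    ((fderiv ℝ (fderiv ℝ (inCoord F.toFun x₀ ^ 2)) q).comp (.inl ℝ _ _)).flip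
      (0, EuclideanSpace.single j 1)
  change T q.2 = _
  conv_lhs => rw [euclidean_sum q.2]
  rw [map_sum]
  refine Finset.sum_congr rfl fun k _ => ?_
  rw [F.ddx_ddy hq, map_smul, smul_eq_mul, mul_comm]
  rfl

lemma eq_zero_of_single {T : Eu (m + 1) →L[ℝ] ℝ} (h : ∀ j, T (EuclideanSpace.single j 1) = 0) :
    T = 0 := by
  ext u
  rw [euclidean_sum u, map_sum]
  simp [h]

lemma fundMatrix_mulVec (hq : q ∈ slitDom x₀) (u : Eu (m + 1)) (j : Fin (m + 1)) :
    (fundMatrix F.toFun x₀ q).mulVec u.ofLp j =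
      vHess (inCoord F.toFun x₀ ^ 2) q u (EuclideanSpace.single j 1) := by
  rw [(F.isFinslerOn x₀).vHess_symm hq]
  conv_rhs => rw [euclidean_sum u]
  rw [map_sum, Matrix.mulVec, dotProduct]
  refine Finset.sum_congr rfl fun k _ => ?_
  rw [F.fundMatrix_eq_vHess hq, map_smul, smul_eq_mul, mul_comm]

/-- Both sides solve the same linear system with matrix g_ij. Nondegeneracy of the Hessian makes the
matrix inverse a true inverse. -/
lemma sprayCoeff_eq (hq : q ∈ slitDom x₀) (i : Fin (m + 1)) :
    F.sprayCoeff x₀ i q = sprayVec (inCoord F.toFun x₀ ^ 2) q i := by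
  have hn := fun u => (F.isFinslerOn x₀).nondeg hq u
  have hu : IsUnit (fundMatrix F.toFun x₀ q) := by
    rw [← Matrix.mulVec_injective_iff_isUnit]
    intro u v huv
    rw [← sub_eq_zero] at huv ⊢
    change (fundMatrix F.toFun x₀ q).mulVec u - (fundMatrix F.toFun x₀ q).mulVec v = 0 at huv
    rw [← Matrix.mulVec_sub] at huv
    have h1 : vHess (inCoord F.toFun x₀ ^ 2) q (WithLp.toLp 2 (u - v)) = 0 :=
      eq_zero_of_single fun j => by
        rw [← F.fundMatrix_mulVec hq]
        exact congrFun huv j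
    have h2 := hn _ h1
    exact congrArg WithLp.ofLp h2
  have h1 : (fundMatrix F.toFun x₀ q).mulVec (sprayVec (inCoord F.toFun x₀ ^ 2) q).ofLp =
      fun j => 1 / 4 * (∑ k, ddx k (ddy j (inCoord F.toFun x₀ ^ 2)) q * q.2 k -
        ddx j (inCoord F.toFun x₀ ^ 2) q) := by
    ext j
    rw [F.fundMatrix_mulVec hq, vHess_sprayVec hn, F.sprayForm_single hq]
  have h2 := congrArg (fun w => (fundMatrix F.toFun x₀ q)⁻¹.mulVec w) h1
  simp only [Matrix.mulVec_mulVec] at h2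
  rw [Matrix.nonsing_inv_mul _ ((Matrix.isUnit_iff_isUnit_det _).1 hu), Matrix.one_mulVec] at h2
  rw [h2, sprayCoeff, Matrix.mulVec, dotProduct, Finset.mul_sum]
  refine Finset.sum_congr rfl fun j _ => by ring

lemma ddy_sprayCoeff (hq : q ∈ slitDom x₀) (i j : Fin (m + 1)) :
    ddy j (F.sprayCoeff x₀ i) q =
      fderiv ℝ (sprayVec (inCoord F.toFun x₀ ^ 2)) q (0, EuclideanSpace.single j 1) i := by
  have h1 : F.sprayCoeff x₀ i =ᶠ[𝓝 q]
      EuclideanSpace.proj (𝕜 := ℝ) i ∘ sprayVec (inCoord F.toFun x₀ ^ 2) := by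
    filter_upwards [(isOpen_slitDom x₀).mem_nhds hq] with z hz using F.sprayCoeff_eq hz i
  have h2 : DifferentiableAt ℝ (sprayVec (inCoord F.toFun x₀ ^ 2)) q :=
    (contDiffAt_sprayVec ((F.isFinslerOn x₀).smooth_sq hq)
      fun u => (F.isFinslerOn x₀).nondeg hq u).differentiableAt (by simp)
  rw [ddy, h1.fderiv_eq,
    ((EuclideanSpace.proj (𝕜 := ℝ) i).hasFDerivAt.comp q h2.hasFDerivAt).fderiv]
  rfl

/-- The angular form of `F` in the coordinates around `x₀`. -/
abbrev ang (x₀ : M) (q : Eu (m + 1) × Eu (m + 1)) : Eu (m + 1) →L[ℝ] Eu (m + 1) →L[ℝ] ℝ :=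
  angForm (inCoord F.toFun x₀) (inCoord F.toFun x₀ ^ 2) q

/-- The map `δy` in the coordinates around `x₀`. -/
abbrev delta (x₀ : M) (q : Eu (m + 1) × Eu (m + 1)) : Eu (m + 1) × Eu (m + 1) →L[ℝ] Eu (m + 1) :=
  deltaMap (inCoord F.toFun x₀) (inCoord F.toFun x₀ ^ 2) q

/-- The fundamental tensor `g` in the coordinates around `x₀`. -/
abbrev fundForm (x₀ : M) (q : Eu (m + 1) × Eu (m + 1)) : Eu (m + 1) →L[ℝ] Eu (m + 1) →L[ℝ] ℝ :=
  vHess (inCoord F.toFun x₀ ^ 2) q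

lemma deltaY_eq {v : TM m M} (hv : v.2 ≠ 0) (ξ : Eu (m + 1) × Eu (m + 1)) (i : Fin (m + 1)) :
    F.deltaY v ξ i = F.delta v.1 (tchart v.1 v) ξ i := by
  have hs : v.1 ∈ (chartAt (Eu (m + 1)) v.1).source := mem_chart_source _ _
  rw [deltaY, delta, deltaMap_apply, inCoord_tchart _ hs]
  change _ = (F.toFun v)⁻¹ * (ξ.2 i + _)
  congr 2
  let T : Eu (m + 1) →L[ℝ] ℝ := (EuclideanSpace.proj (𝕜 := ℝ) i).comp
    ((fderiv ℝ (sprayVec (inCoord F.toFun v.1 ^ 2)) (tchart v.1 v)).comp (.inr ℝ _ _))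
  change _ = T ξ.1
  conv_rhs => rw [euclidean_sum ξ.1]
  rw [map_sum]
  refine Finset.sum_congr rfl fun k _ => ?_
  rw [F.ddy_sprayCoeff (tchart_mem_slitDom hs hv), map_smul, smul_eq_mul, mul_comm]
  rfl

lemma horForm_eq {v : TM m M} (hv : v.2 ≠ 0) (ξ ζ : Eu (m + 1) × Eu (m + 1)) :
    F.horForm v ξ ζ = F.fundForm v.1 (tchart v.1 v) ξ.1 ζ.1 := by
  have hs : v.1 ∈ (chartAt (Eu (m + 1)) v.1).source := mem_chart_source _ _
  rw [bilin_eq_sum, horForm]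
  simp only [F.fundMatrix_eq_vHess (tchart_mem_slitDom hs hv)]

lemma verForm_eq {v : TM m M} (hv : v.2 ≠ 0) (ξ ζ : Eu (m + 1) × Eu (m + 1)) :
    F.verForm v ξ ζ = F.ang v.1 (tchart v.1 v) (F.delta v.1 (tchart v.1 v) ξ)
      (F.delta v.1 (tchart v.1 v) ζ) := by
  have hs : v.1 ∈ (chartAt (Eu (m + 1)) v.1).source := mem_chart_source _ _
  rw [bilin_eq_sum, verForm]
  simp only [F.fundMatrix_eq_vHess (tchart_mem_slitDom hs hv), F.deltaY_eq hv]
  rfl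

end Forms

/-! ### The unit section [v] ↦ v / F(v) and its differential -/

section UnitSection

lemma unitSection_ray (v : TM₀ m M) : F.unitSection (ray v) = dil (F.toFun v.1)⁻¹ v.1 := rfl

lemma unitSection_proj (p : SphereBundle m M) : (F.unitSection p).1 = baseProj p := by
  obtain ⟨v, rfl⟩ := Quotient.exists_rep p
  rfl

lemma unitSection_ne_zero (p : SphereBundle m M) : (F.unitSection p).2 ≠ 0 := by
  obtain ⟨v, rfl⟩ := Quotient.exists_rep p
  exact smul_ne_zero (inv_ne_zero (F.pos v.1 v.2).ne') v.2

/-- The unit section in the coordinates around `x₀`. -/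
def unitCoord (x₀ : M) (p : SphereBundle m M) : Eu (m + 1) × Eu (m + 1) :=
  tchart x₀ (F.unitSection p)

lemma unitCoord_mem {x₀ : M} {p : SphereBundle m M}
    (hp : baseProj p ∈ (chartAt (Eu (m + 1)) x₀).source) : F.unitCoord x₀ p ∈ slitDom x₀ :=
  tchart_mem_slitDom (by rwa [unitSection_proj]) (F.unitSection_ne_zero p)

/-- The unit section in affine coordinates. -/
def unitAff (x₀ : M) (φ : Eu (m + 1) ≃L[ℝ] ℝ × Eu m) (z : Eu (m + 1) × Eu m) :
    Eu (m + 1) × Eu (m + 1) :=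
  (z.1, (inCoord F.toFun x₀ (z.1, φ.symm (1, z.2)))⁻¹ • φ.symm (1, z.2))

/-- The affine coordinates as a function of the coordinates `(x, y)`. -/
def toAff (φ : Eu (m + 1) ≃L[ℝ] ℝ × Eu m) (q : Eu (m + 1) × Eu (m + 1)) : Eu (m + 1) × Eu m :=
  (q.1, (φ q.2).1⁻¹ • (φ q.2).2)

variable {x₀ : M} {φ : Eu (m + 1) ≃L[ℝ] ℝ × Eu m} {z : Eu (m + 1) × Eu m}

lemma symm_mem_slitDom (hz : z.1 ∈ (chartAt (Eu (m + 1)) x₀).target) :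
    (z.1, φ.symm (1, z.2)) ∈ slitDom x₀ :=
  ⟨hz, fun h => by simpa using congrArg (fun y => (φ y).1) h⟩

lemma unitCoord_eq {p₀ p : SphereBundle m M} (hp : p ∈ (affChart p₀ x₀ φ).source) :
    F.unitCoord x₀ p = F.unitAff x₀ φ (affChart p₀ x₀ φ p) := by
  have hz := ((affChart p₀ x₀ φ).map_source hp).1
  have hm := affInv_mem (φ := φ) hz
  have h1 : ray ⟨affInv x₀ φ (affChart p₀ x₀ φ p), ne_zero_of_mem_affDom hm⟩ = p :=
    (dif_pos (ne_zero_of_mem_affDom hm)).symm.trans ((affChart p₀ x₀ φ).left_inv hp)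
  generalize affChart p₀ x₀ φ p = z at *
  rw [← h1, unitCoord, unitSection_ray, unitAff]
  have h2 := affInv_coord (φ := φ) hz
  have h3 : inCoord F.toFun x₀ (z.1, φ.symm (1, z.2)) = F.toFun (affInv x₀ φ z) := by
    rw [← h2, inCoord_tchart _ (mem_tchart_source.1 hm.1)]
  refine Prod.ext (congrArg (fun q => q.1) h2 :) ?_
  rw [tchart_dil_snd _ hm.1, h2, h3]

lemma contDiffAt_unitAff (hz : z.1 ∈ (chartAt (Eu (m + 1)) x₀).target) :
    ContDiffAt ℝ ∞ (F.unitAff x₀ φ) z := by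
  have h1 : ContDiffAt ℝ ∞ (fun z : Eu (m + 1) × Eu m => (z.1, φ.symm ((1 : ℝ), z.2))) z := by
    fun_prop
  have h2 := (F.isFinslerOn x₀).smooth _ (symm_mem_slitDom (φ := φ) hz)
  have h3 := (F.isFinslerOn x₀).pos _ (symm_mem_slitDom (φ := φ) hz)
  have h4 : ContDiffAt ℝ ∞ (fun z : Eu (m + 1) × Eu m =>
    inCoord F.toFun x₀ (z.1, φ.symm ((1 : ℝ), z.2))) z :=
    ContDiffAt.comp (g := inCoord F.toFun x₀)
      (f := fun z : Eu (m + 1) × Eu m => (z.1, φ.symm ((1 : ℝ), z.2))) z h2 h1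
  exact contDiffAt_fst.prodMk ((h4.inv h3.ne').smul h1.snd)

lemma unitAff_mem (hz : z.1 ∈ (chartAt (Eu (m + 1)) x₀).target) :
    F.unitAff x₀ φ z ∈ slitDom x₀ :=
  ⟨hz, smul_ne_zero (inv_ne_zero ((F.isFinslerOn x₀).pos _ (symm_mem_slitDom hz)).ne')
    (symm_mem_slitDom hz).2⟩

lemma inCoord_unitAff (hz : z.1 ∈ (chartAt (Eu (m + 1)) x₀).target) :
    inCoord F.toFun x₀ (F.unitAff x₀ φ z) = 1 := by
  have h3 := (F.isFinslerOn x₀).pos _ (symm_mem_slitDom (φ := φ) hz)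
  have h4 := (F.isFinslerOn x₀).homogeneous _ (symm_mem_slitDom (φ := φ) hz) _ (inv_pos.2 h3)
  rw [inv_mul_cancel₀ h3.ne'] at h4
  exact h4

lemma unitAff_pos (hz : z.1 ∈ (chartAt (Eu (m + 1)) x₀).target) :
    0 < (φ (F.unitAff x₀ φ z).2).1 := by
  have h3 := (F.isFinslerOn x₀).pos _ (symm_mem_slitDom (φ := φ) hz)
  simp [unitAff, h3]

lemma toAff_unitAff (hz : z.1 ∈ (chartAt (Eu (m + 1)) x₀).target) :
    toAff φ (F.unitAff x₀ φ z) = z := by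
  have h3 := (F.isFinslerOn x₀).pos _ (symm_mem_slitDom (φ := φ) hz)
  refine Prod.ext rfl ?_
  simp [unitAff, toAff, smul_smul, h3.ne']

lemma unitAff_toAff {q : Eu (m + 1) × Eu (m + 1)} (hq : q.1 ∈ (chartAt (Eu (m + 1)) x₀).target)
    (hφ : 0 < (φ q.2).1) :
    F.unitAff x₀ φ (toAff φ q) = (q.1, (inCoord F.toFun x₀ q)⁻¹ • q.2) := by
  have hq' : q ∈ slitDom x₀ := ⟨hq, fun h => by simp [h] at hφ⟩
  have h1 : φ.symm (1, (φ q.2).1⁻¹ • (φ q.2).2) = (φ q.2).1⁻¹ • q.2 := by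
    apply φ.injective
    rw [φ.apply_symm_apply, map_smul]
    refine Prod.ext ?_ rfl
    simp [hφ.ne']
  refine Prod.ext rfl ?_
  simp only [unitAff, toAff, h1]
  rw [(F.isFinslerOn x₀).homogeneous q hq' _ (inv_pos.2 hφ), smul_smul]
  congr 1
  field_simp

lemma fderiv_unitAff_fst (hz : z.1 ∈ (chartAt (Eu (m + 1)) x₀).target) (ζ : Eu (m + 1) × Eu m) :
    (fderiv ℝ (F.unitAff x₀ φ) z ζ).1 = ζ.1 := by
  have h1 := ((F.contDiffAt_unitAff (φ := φ) hz).differentiableAt (by simp)).hasFDerivAt.fst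
  have h2 : HasFDerivAt (fun z => (F.unitAff x₀ φ z).1) (.fst ℝ (Eu (m + 1)) (Eu m)) z :=
    hasFDerivAt_fst
  exact congrArg (fun T => T ζ) (h1.unique h2)

/-- F is constantly 1 along the section, so its differential takes values in the tangent spaces of
the indicatrix bundle F = 1. -/
lemma fderiv_inCoord_unitAff (hz : z.1 ∈ (chartAt (Eu (m + 1)) x₀).target)
    (ζ : Eu (m + 1) × Eu m) :
    fderiv ℝ (inCoord F.toFun x₀) (F.unitAff x₀ φ z) (fderiv ℝ (F.unitAff x₀ φ) z ζ) = 0 := by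
  have h1 := ((F.contDiffAt_unitAff (φ := φ) hz).differentiableAt (by simp)).hasFDerivAt
  have h2 := (((F.isFinslerOn x₀).smooth _ (F.unitAff_mem (φ := φ) hz)).differentiableAt
    (by simp)).hasFDerivAt
  have h3 := h2.comp z h1
  have h4 : inCoord F.toFun x₀ ∘ F.unitAff x₀ φ =ᶠ[𝓝 z] fun _ => (1 : ℝ) := by
    filter_upwards [((chartAt (Eu (m + 1)) x₀).open_target.preimage continuous_fst).mem_nhds hz]
      with w hw using F.inCoord_unitAff hw
  exact congrArg (fun T => T ζ) (h3.unique ((hasFDerivAt_const (1 : ℝ) z).congr_of_eventuallyEq h4))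

lemma differentiableAt_toAff {q : Eu (m + 1) × Eu (m + 1)} (hφ : 0 < (φ q.2).1) :
    DifferentiableAt ℝ (toAff φ) q := by
  have h1 : DifferentiableAt ℝ (fun q : Eu (m + 1) × Eu (m + 1) => φ q.2) q := by fun_prop
  exact differentiableAt_fst.prodMk ((h1.fst.inv hφ.ne').smul h1.snd)

/-- `toAff` is a left inverse of the section, so its derivative inverts that of the section on the
left. -/
lemma fderiv_unitAff_injective (hz : z.1 ∈ (chartAt (Eu (m + 1)) x₀).target)
    {ζ : Eu (m + 1) × Eu m} (h : fderiv ℝ (F.unitAff x₀ φ) z ζ = 0) : ζ = 0 := by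
  have h1 := ((F.contDiffAt_unitAff (φ := φ) hz).differentiableAt (by simp)).hasFDerivAt
  have h3 := (differentiableAt_toAff (F.unitAff_pos (φ := φ) hz)).hasFDerivAt.comp z h1
  have h4 : toAff φ ∘ F.unitAff x₀ φ =ᶠ[𝓝 z] id := by
    filter_upwards [((chartAt (Eu (m + 1)) x₀).open_target.preimage continuous_fst).mem_nhds hz]
      with w hw using F.toAff_unitAff hw
  have h5 := congrArg (fun T => T ζ) (h3.unique ((hasFDerivAt_id z).congr_of_eventuallyEq h4))
  simp only [ContinuousLinearMap.comp_apply, h, map_zero, ContinuousLinearMap.id_apply] at h5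
  exact h5.symm

/-- Section after `toAff` is the radial retraction y ↦ y / F. At a point with F = 1 its derivative
fixes every vertical η with F_y η = 0, so the image of (0, η) under the derivative of `toAff` is a
preimage. -/
lemma exists_fderiv_unitAff (hz : z.1 ∈ (chartAt (Eu (m + 1)) x₀).target) {η : Eu (m + 1)}
    (hη : vDiff (inCoord F.toFun x₀) (F.unitAff x₀ φ z) η = 0) :
    ∃ ζ, fderiv ℝ (F.unitAff x₀ φ) z ζ = (0, η) := by
  have h1 := ((F.contDiffAt_unitAff (φ := φ) hz).differentiableAt (by simp)).hasFDerivAt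
  have hq := F.unitAff_mem (φ := φ) hz
  have hp := F.unitAff_pos (φ := φ) hz
  have hone := F.inCoord_unitAff (φ := φ) hz
  have h2 := (((F.isFinslerOn x₀).smooth _ hq).differentiableAt (by simp)).hasFDerivAt
  rw [← F.toAff_unitAff (φ := φ) hz] at h1
  have h3 := h1.comp _ (differentiableAt_toAff hp).hasFDerivAt
  have h0 : inCoord F.toFun x₀ (F.unitAff x₀ φ z) ≠ 0 := by rw [hone]; exact one_ne_zero
  have h4 : HasFDerivAt (fun q : Eu (m + 1) × Eu (m + 1) =>
      (q.1, (inCoord F.toFun x₀ q)⁻¹ • q.2)) _ (F.unitAff x₀ φ z) :=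
    hasFDerivAt_fst.prodMk (((hasFDerivAt_inv h0).comp _ h2).smul hasFDerivAt_snd)
  have hc : ContinuousAt (fun q : Eu (m + 1) × Eu (m + 1) => (φ q.2).1) (F.unitAff x₀ φ z) := by
    fun_prop
  have h5 : F.unitAff x₀ φ ∘ toAff φ =ᶠ[𝓝 (F.unitAff x₀ φ z)] fun q : Eu (m + 1) × Eu (m + 1) =>
      (q.1, (inCoord F.toFun x₀ q)⁻¹ • q.2) := by
    filter_upwards [((isOpen_slitDom x₀).mem_nhds hq), hc.eventually (lt_mem_nhds hp)] with w h h'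
    exact F.unitAff_toAff h.1 h'
  have h6 := congrArg (fun T => T (0, η)) (h3.unique (h4.congr_of_eventuallyEq h5))
  rw [F.toAff_unitAff hz] at h6
  refine ⟨_, h6.trans ?_⟩
  rw [vDiff_apply] at hη
  refine Prod.ext ?_ ?_ <;> simp [hη, hone]

end UnitSection

end FinslerStructure

lemma triv_self {E : Type*} [NormedAddCommGroup E] [NormedSpace ℝ E] {N : Type*}
    [TopologicalSpace N] [ChartedSpace E N] [IsManifold 𝓘(ℝ, E) ∞ N] {p : N}
    (v : TangentSpace 𝓘(ℝ, E) p) : triv p p v = v := by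
  rw [triv_eq_mfderiv (mem_chart_source E p), mfderiv_extChartAt_self]; rfl

/-! ### The horizontal and vertical forms on SM -/

namespace FinslerStructure

variable {m : ℕ} {M : Type*} [TopologicalSpace M] [ChartedSpace (Eu (m + 1)) M]
  [IsManifold 𝓘(ℝ, Eu (m + 1)) ∞ M] (F : FinslerStructure m M)

local notation "𝓢" => 𝓘(ℝ, Eu (m + 1) × Eu m)

/-- The fibre coordinates of the preferred chart of `SM` at `p`. -/
def fibCoord (p : SphereBundle m M) : Eu (m + 1) ≃L[ℝ] ℝ × Eu m := (exists_coord_at p).choose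

variable {p q : SphereBundle m M}

lemma chartAt_fst_mem (hq : q ∈ (chartAt (Eu (m + 1) × Eu m) p).source) :
    (chartAt (Eu (m + 1) × Eu m) p q).1 ∈ (chartAt (Eu (m + 1)) (baseProj p)).target :=
  ((chartAt (Eu (m + 1) × Eu m) p).map_source hq).1

lemma baseProj_mem (hq : q ∈ (chartAt (Eu (m + 1) × Eu m) p).source) :
    baseProj q ∈ (chartAt (Eu (m + 1)) (baseProj p)).source := by
  have h1 : (Quotient.out q).1 ∈ (tchart (baseProj p)).source := And.left hq
  rw [mem_tchart_source] at h1
  convert h1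
  conv_lhs => rw [← Quotient.out_eq q]
  rfl

lemma chartAt_fst (p q : SphereBundle m M) :
    (chartAt (Eu (m + 1) × Eu m) p q).1 = chartAt (Eu (m + 1)) (baseProj p) (baseProj q) := by
  conv_rhs => rw [← Quotient.out_eq q]
  rfl

lemma unitCoord_eventuallyEq (hq : q ∈ (chartAt (Eu (m + 1) × Eu m) p).source) :
    F.unitCoord (baseProj p) =ᶠ[𝓝 q]
      F.unitAff (baseProj p) (fibCoord p) ∘ extChartAt 𝓢 p := by
  filter_upwards [(chartAt (Eu (m + 1) × Eu m) p).open_source.mem_nhds hq] with z hz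
  exact F.unitCoord_eq hz

lemma contMDiffAt_unitCoord (hq : q ∈ (chartAt (Eu (m + 1) × Eu m) p).source) :
    ContMDiffAt 𝓢 𝓘(ℝ, Eu (m + 1) × Eu (m + 1)) ∞ (F.unitCoord (baseProj p)) q := by
  have h1 : ContMDiffAt 𝓢 𝓢 ∞ (extChartAt 𝓢 p) q := contMDiffAt_extChartAt' hq
  have h2 := F.contDiffAt_unitAff (φ := fibCoord p) (chartAt_fst_mem hq)
  exact (ContMDiffAt.comp q (g := F.unitAff (baseProj p) (fibCoord p)) h2.contMDiffAt
    h1).congr_of_eventuallyEq (F.unitCoord_eventuallyEq hq)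

lemma mvfderiv_unitCoord (hq : q ∈ (chartAt (Eu (m + 1) × Eu m) p).source)
    (X : TangentSpace 𝓢 q) :
    mvfderiv 𝓢 (F.unitCoord (baseProj p)) q X =
      fderiv ℝ (F.unitAff (baseProj p) (fibCoord p)) (chartAt (Eu (m + 1) × Eu m) p q)
        (triv p q X) := by
  have h1 : MDifferentiableAt 𝓢 𝓢 (extChartAt 𝓢 p) q := mdifferentiableAt_extChartAt hq
  have h2 : MDifferentiableAt 𝓢 𝓘(ℝ, Eu (m + 1) × Eu (m + 1))
      (F.unitAff (baseProj p) (fibCoord p)) (extChartAt 𝓢 p q) :=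
    ((F.contDiffAt_unitAff (φ := fibCoord p) (chartAt_fst_mem hq)).differentiableAt
      (by simp)).mdifferentiableAt
  rw [triv_eq_mfderiv hq]
  change mfderiv 𝓢 𝓘(ℝ, Eu (m + 1) × Eu (m + 1)) (F.unitCoord (baseProj p)) q X = _
  rw [(F.unitCoord_eventuallyEq hq).mfderiv_eq, mfderiv_comp q h2 h1, mfderiv_eq_fderiv]
  rfl

lemma mdifferentiableAt_unitSection (p : SphereBundle m M) :
    MDifferentiableAt 𝓢 𝓘(ℝ, Eu (m + 1)).tangent F.unitSection p := by
  have h1 := F.contMDiffAt_unitCoord (mem_chart_source (Eu (m + 1) × Eu m) p)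
  have h2 : ContMDiffAt 𝓘(ℝ, Eu (m + 1) × Eu (m + 1)) 𝓘(ℝ, Eu (m + 1)).tangent ∞
      (extChartAt 𝓘(ℝ, Eu (m + 1)).tangent (⟨baseProj p, 0⟩ :
        TangentBundle 𝓘(ℝ, Eu (m + 1)) M)).symm (F.unitCoord (baseProj p) p) := by
    refine (contMDiffOn_extChartAt_symm _).contMDiffAt ((isOpen_extChartAt_target _).mem_nhds ?_)
    rw [extChartAt_target]
    refine ⟨mem_tchart_target.2 (F.unitCoord_mem (mem_chart_source _ _)).1, ?_⟩
    rw [ModelWithCorners.Boundaryless.range_eq_univ]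
    trivial
  refine ((h2.comp p h1).mdifferentiableAt (by simp)).congr_of_eventuallyEq ?_
  filter_upwards [(chartAt (Eu (m + 1) × Eu m) p).open_source.mem_nhds (mem_chart_source _ p)]
    with z hz
  refine ((tchart (baseProj p)).left_inv (mem_tchart_source.2 ?_)).symm
  rw [unitSection_proj]
  exact baseProj_mem hz

lemma lift_eq (p : SphereBundle m M) (X : TangentSpace 𝓢 p) :
    F.lift p X = mvfderiv 𝓢 (F.unitCoord (baseProj p)) p X := by
  have h1 := F.contMDiffAt_unitCoord (mem_chart_source (Eu (m + 1) × Eu m) p)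
  have h2 := F.mdifferentiableAt_unitSection p
  rw [mvfderiv_eq_fderiv (h1.mdifferentiableAt (by simp)), triv_self]
  have h4 : F.lift p X = fderivWithin ℝ
      (writtenInExtChartAt 𝓢 𝓘(ℝ, Eu (m + 1)).tangent p F.unitSection) (range 𝓢)
      (extChartAt 𝓢 p p) X := by
    unfold lift
    exact DFunLike.congr_fun (if_pos h2 : mfderiv 𝓢 𝓘(ℝ, Eu (m + 1)).tangent F.unitSection p = _) X
  rw [h4]
  have h3 : (writtenInExtChartAt 𝓢 𝓘(ℝ, Eu (m + 1)).tangent p F.unitSection) =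
      F.unitCoord (baseProj p) ∘ (extChartAt 𝓢 p).symm := by
    rw [← F.unitSection_proj p]
    rfl
  rw [h3]
  simp only [modelWithCornersSelf_coe, range_id, fderivWithin_univ]

/-- `lift` in the coordinates of the chart at `p`. -/
def liftAt (p q : SphereBundle m M) :
    Eu (m + 1) × Eu m →L[ℝ] Eu (m + 1) × Eu (m + 1) :=
  fderiv ℝ (F.unitAff (baseProj p) (fibCoord p)) (chartAt (Eu (m + 1) × Eu m) p q)

lemma unitCoord_change {x₀ x₁ : M} (h₀ : baseProj q ∈ (chartAt (Eu (m + 1)) x₀).source)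
    (h₁ : baseProj q ∈ (chartAt (Eu (m + 1)) x₁).source) :
    F.unitCoord x₁ q = tangentMap (chartChange x₀ x₁) (F.unitCoord x₀ q) :=
  tchart_eq_tangentMap (by rwa [unitSection_proj]) (by rwa [unitSection_proj])

lemma unitCoord_mem_overlap {x₀ x₁ : M} (h₀ : baseProj q ∈ (chartAt (Eu (m + 1)) x₀).source)
    (h₁ : baseProj q ∈ (chartAt (Eu (m + 1)) x₁).source) :
    F.unitCoord x₀ q ∈ overlap x₀ x₁ :=
  tchart_mem_overlap (by rwa [unitSection_proj]) (by rwa [unitSection_proj])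
    (F.unitSection_ne_zero q)

/-- `lift` at `q` uses the chart centred over `q`, which moves with `q`. Here it is compared with
the fixed chart over `p`, in which smoothness can be read off. -/
lemma lift_eq_liftAt (hq : q ∈ (chartAt (Eu (m + 1) × Eu m) p).source) (X : TangentSpace 𝓢 q) :
    F.lift q X = fderiv ℝ (tangentMap (chartChange (baseProj p) (baseProj q)))
      (F.unitCoord (baseProj p) q) (F.liftAt p q (triv p q X)) := by
  have hm := F.unitCoord_mem_overlap (baseProj_mem hq) (mem_chart_source _ (baseProj q))
  have h1 := (hasFDerivAt_tangentMap
    ((F.isCoordChange (baseProj p) (baseProj q)).smooth _ hm)).1.mdifferentiableAt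
  have h2 := (F.contMDiffAt_unitCoord hq).mdifferentiableAt (by simp)
  have h3 : F.unitCoord (baseProj q) =ᶠ[𝓝 q]
      tangentMap (chartChange (baseProj p) (baseProj q)) ∘ F.unitCoord (baseProj p) := by
    filter_upwards [continuous_baseProj.continuousAt.preimage_mem_nhds
      ((chartAt (Eu (m + 1)) (baseProj p)).open_source.mem_nhds (baseProj_mem hq)),
      continuous_baseProj.continuousAt.preimage_mem_nhds
      ((chartAt (Eu (m + 1)) (baseProj q)).open_source.mem_nhds (mem_chart_source _ _))]
      with z h h' using F.unitCoord_change h h'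
  rw [lift_eq, liftAt, ← F.mvfderiv_unitCoord hq]
  change mfderiv 𝓢 𝓘(ℝ, Eu (m + 1) × Eu (m + 1)) (F.unitCoord (baseProj q)) q X = _
  rw [h3.mfderiv_eq, mfderiv_comp q h1 h2, mfderiv_eq_fderiv]
  rfl

/-- The horizontal part `g_ij dxⁱ dxʲ` of the Sasaki-type metric. -/
def horMetric (p : SphereBundle m M) (X Y : TangentSpace 𝓢 p) : ℝ :=
  F.horForm (F.unitSection p) (F.lift p X) (F.lift p Y)

/-- The vertical part of the Sasaki-type metric. -/
def verMetric (p : SphereBundle m M) (X Y : TangentSpace 𝓢 p) : ℝ :=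
  F.verForm (F.unitSection p) (F.lift p X) (F.lift p Y)

lemma rescaledMetric_eq (ε : ℝ) : F.rescaledMetric ε = rescaled F.horMetric F.verMetric ε := rfl

lemma horMetric_eq (hq : q ∈ (chartAt (Eu (m + 1) × Eu m) p).source) (X Y : TangentSpace 𝓢 q) :
    F.horMetric q X Y = F.fundForm (baseProj p) (F.unitCoord (baseProj p) q)
      (F.liftAt p q (triv p q X)).1 (F.liftAt p q (triv p q Y)).1 := by
  have hs := mem_chart_source (Eu (m + 1)) (baseProj q)
  have hm := F.unitCoord_mem_overlap (baseProj_mem hq) hs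
  have hT := (hasFDerivAt_tangentMap
    ((F.isCoordChange (baseProj p) (baseProj q)).smooth _ hm)).2
  rw [horMetric, F.horForm_eq (F.unitSection_ne_zero q)]
  change F.fundForm (F.unitSection q).1 (F.unitCoord (F.unitSection q).1 q) _ _ = _
  rw [F.unitSection_proj, F.lift_eq_liftAt hq, F.lift_eq_liftAt hq, hT, hT,
    F.unitCoord_change (baseProj_mem hq) hs,
    fundForm, fundForm, (F.isCoordChange_sq _ _).vHess_eq hm]

/-- The derivative of the transition map in `lift` is absorbed by δy, which transforms as a vector,
and then by the angular form, which is a tensor. -/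
lemma verMetric_eq (hq : q ∈ (chartAt (Eu (m + 1) × Eu m) p).source) (X Y : TangentSpace 𝓢 q) :
    F.verMetric q X Y = F.ang (baseProj p) (F.unitCoord (baseProj p) q)
      (F.delta (baseProj p) (F.unitCoord (baseProj p) q) (F.liftAt p q (triv p q X)))
      (F.delta (baseProj p) (F.unitCoord (baseProj p) q) (F.liftAt p q (triv p q Y))) := by
  have hs := mem_chart_source (Eu (m + 1)) (baseProj q)
  have hm := F.unitCoord_mem_overlap (baseProj_mem hq) hs
  have hn : ∀ q' ∈ overlap (baseProj p) (baseProj q), ∀ u,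
      vHess (inCoord F.toFun (baseProj p) ^ 2) q' u = 0 → u = 0 := fun q' h u =>
    (F.isFinslerOn (baseProj p)).nondeg (show q' ∈ slitDom (baseProj p) from ⟨h.1.1, h.2⟩) u
  rw [verMetric, F.verForm_eq (F.unitSection_ne_zero q)]
  change F.ang (F.unitSection q).1 (F.unitCoord (F.unitSection q).1 q)
    (F.delta (F.unitSection q).1 (F.unitCoord (F.unitSection q).1 q) _)
    (F.delta (F.unitSection q).1 (F.unitCoord (F.unitSection q).1 q) _) = _
  rw [F.unitSection_proj, F.lift_eq_liftAt hq, F.lift_eq_liftAt hq,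
    F.unitCoord_change (baseProj_mem hq) hs, delta,
    (F.isCoordChange_sq _ _).deltaMap_eq (F.isCoordChange _ _) hm hn,
    (F.isCoordChange_sq _ _).deltaMap_eq (F.isCoordChange _ _) hm hn,
    (F.isCoordChange_sq _ _).angForm_eq (F.isCoordChange _ _) hm]

lemma contMDiffAt_liftAt (p : SphereBundle m M) :
    ContMDiffAt 𝓢 𝓘(ℝ, Eu (m + 1) × Eu m →L[ℝ] Eu (m + 1) × Eu (m + 1)) ∞ (F.liftAt p) p := by
  have hq := mem_chart_source (Eu (m + 1) × Eu m) p
  have h1 : ContMDiffAt 𝓢 𝓢 ∞ (extChartAt 𝓢 p) p := contMDiffAt_extChartAt' hq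
  have h2 := contDiffAt_fderiv_top
    (F.contDiffAt_unitAff (φ := fibCoord p) (chartAt_fst_mem hq))
  exact ContMDiffAt.comp p (g := fderiv ℝ (F.unitAff (baseProj p) (fibCoord p))) h2.contMDiffAt h1

/-- Pulling back a form along a family of linear maps, as a bilinear operation. -/
def pullForm {E G : Type*} [NormedAddCommGroup E] [NormedSpace ℝ E] [NormedAddCommGroup G]
    [NormedSpace ℝ G] (B : G →L[ℝ] G →L[ℝ] ℝ) (A : E →L[ℝ] G) : E →L[ℝ] E →L[ℝ] ℝ :=
  (((ContinuousLinearMap.compL ℝ E G ℝ).flip A).comp B).comp A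

lemma contMDiffAt_pullForm {E G N : Type*} [NormedAddCommGroup E] [NormedSpace ℝ E]
    [NormedAddCommGroup G] [NormedSpace ℝ G] [TopologicalSpace N] [ChartedSpace E N]
    {B : N → G →L[ℝ] G →L[ℝ] ℝ} {A : N → E →L[ℝ] G} {p : N}
    (hB : ContMDiffAt 𝓘(ℝ, E) 𝓘(ℝ, G →L[ℝ] G →L[ℝ] ℝ) ∞ B p)
    (hA : ContMDiffAt 𝓘(ℝ, E) 𝓘(ℝ, E →L[ℝ] G) ∞ A p) :
    ContMDiffAt 𝓘(ℝ, E) 𝓘(ℝ, E →L[ℝ] E →L[ℝ] ℝ) ∞ (fun q => pullForm (B q) (A q)) p := by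
  have h1 : ContMDiffAt 𝓘(ℝ, E) 𝓘(ℝ, (G →L[ℝ] ℝ) →L[ℝ] E →L[ℝ] ℝ) ∞
      (fun q => (ContinuousLinearMap.compL ℝ E G ℝ).flip (A q)) p :=
    ContMDiffAt.comp p (g := (ContinuousLinearMap.compL ℝ E G ℝ).flip)
      (ContinuousLinearMap.contMDiff _).contMDiffAt hA
  exact (h1.clm_comp hB).clm_comp hA

lemma smoothForm_horMetric : SmoothForm F.horMetric := by
  intro p
  have hq := mem_chart_source (Eu (m + 1) × Eu m) p
  have hm := F.unitCoord_mem (mem_chart_source (Eu (m + 1)) (baseProj p))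
  refine ⟨fun q => pullForm (F.fundForm (baseProj p) (F.unitCoord (baseProj p) q))
    ((ContinuousLinearMap.fst ℝ _ _).comp (F.liftAt p q)), contMDiffAt_pullForm ?_ ?_, ?_⟩
  · exact ContMDiffAt.comp p (g := vHess (inCoord F.toFun (baseProj p) ^ 2))
      (contDiffAt_vHess ((F.isFinslerOn _).smooth_sq hm)).contMDiffAt (F.contMDiffAt_unitCoord hq)
  · exact contMDiffAt_const.clm_comp (F.contMDiffAt_liftAt p)
  · filter_upwards [(chartAt (Eu (m + 1) × Eu m) p).open_source.mem_nhds hq] with q hq X Y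
      using F.horMetric_eq hq X Y

lemma smoothForm_verMetric : SmoothForm F.verMetric := by
  intro p
  have hq := mem_chart_source (Eu (m + 1) × Eu m) p
  have hm := F.unitCoord_mem (mem_chart_source (Eu (m + 1)) (baseProj p))
  have hf := F.isFinslerOn (baseProj p)
  refine ⟨fun q => pullForm (F.ang (baseProj p) (F.unitCoord (baseProj p) q))
    ((F.delta (baseProj p) (F.unitCoord (baseProj p) q)).comp (F.liftAt p q)),
    contMDiffAt_pullForm ?_ ?_, ?_⟩
  · exact ContMDiffAt.comp p (g := F.ang (baseProj p))
      (contDiffAt_angForm (hf.smooth_sq hm) (hf.smooth _ hm)).contMDiffAt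
      (F.contMDiffAt_unitCoord hq)
  · refine ContMDiffAt.clm_comp ?_ (F.contMDiffAt_liftAt p)
    exact ContMDiffAt.comp p (g := F.delta (baseProj p))
      (contDiffAt_deltaMap (hf.smooth_sq hm) (fun u => hf.nondeg hm u) (hf.smooth _ hm)
        (hf.pos _ hm).ne').contMDiffAt
      (F.contMDiffAt_unitCoord hq)
  · filter_upwards [(chartAt (Eu (m + 1) × Eu m) p).open_source.mem_nhds hq] with q hq X Y
      using F.verMetric_eq hq X Y

/-- The differential of the unit section at `p`. -/
abbrev dUnit (p : SphereBundle m M) : Eu (m + 1) × Eu m →L[ℝ] Eu (m + 1) × Eu (m + 1) :=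
  F.liftAt p p

lemma unitCoord_self (p : SphereBundle m M) : F.unitCoord (baseProj p) p =
    F.unitAff (baseProj p) (fibCoord p) (chartAt (Eu (m + 1) × Eu m) p p) :=
  F.unitCoord_eq (mem_chart_source _ p)

lemma horMetric_self (p : SphereBundle m M) (X Y : TangentSpace 𝓢 p) :
    F.horMetric p X Y = F.fundForm (baseProj p) (F.unitCoord (baseProj p) p)
      (F.dUnit p X).1 (F.dUnit p Y).1 := by
  rw [F.horMetric_eq (mem_chart_source _ p), triv_self, triv_self]

lemma verMetric_self (p : SphereBundle m M) (X Y : TangentSpace 𝓢 p) :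
    F.verMetric p X Y = F.ang (baseProj p) (F.unitCoord (baseProj p) p)
      (F.delta (baseProj p) (F.unitCoord (baseProj p) p) (F.dUnit p X))
      (F.delta (baseProj p) (F.unitCoord (baseProj p) p) (F.dUnit p Y)) := by
  rw [F.verMetric_eq (mem_chart_source _ p), triv_self, triv_self]

lemma inCoord_unitCoord (p : SphereBundle m M) :
    inCoord F.toFun (baseProj p) (F.unitCoord (baseProj p) p) = 1 := by
  rw [unitCoord_self]
  exact F.inCoord_unitAff (chartAt_fst_mem (mem_chart_source _ p))

lemma fderiv_inCoord_dUnit (p : SphereBundle m M) (X : Eu (m + 1) × Eu m) :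
    fderiv ℝ (inCoord F.toFun (baseProj p)) (F.unitCoord (baseProj p) p) (F.dUnit p X) = 0 := by
  rw [unitCoord_self]
  exact F.fderiv_inCoord_unitAff (chartAt_fst_mem (mem_chart_source _ p)) X

lemma dUnit_injective {X : Eu (m + 1) × Eu m} (h : F.dUnit p X = 0) : X = 0 :=
  F.fderiv_unitAff_injective (chartAt_fst_mem (mem_chart_source _ p)) h

lemma dUnit_fst (X : Eu (m + 1) × Eu m) : (F.dUnit p X).1 = X.1 :=
  F.fderiv_unitAff_fst (chartAt_fst_mem (mem_chart_source _ p)) X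

lemma exists_dUnit {η : Eu (m + 1)} (hη : vDiff (inCoord F.toFun (baseProj p))
    (F.unitCoord (baseProj p) p) η = 0) : ∃ X, F.dUnit p X = (0, η) := by
  rw [unitCoord_self] at hη
  exact F.exists_fderiv_unitAff (chartAt_fst_mem (mem_chart_source _ p)) hη

lemma delta_vertical (η : Eu (m + 1)) :
    F.delta (baseProj p) (F.unitCoord (baseProj p) p) (0, η) = η := by
  rw [delta, deltaMap_apply, inCoord_unitCoord]
  simp only [Prod.mk_zero_zero, map_zero, add_zero, inv_one, one_smul]

/-- The horizontal metric vanishes exactly on vertical vectors. -/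
lemma horMetric_eq_zero_iff {X : TangentSpace 𝓢 p} :
    (∀ Y, F.horMetric p X Y = 0) ↔ (F.dUnit p X).1 = 0 := by
  have hm := F.unitCoord_mem (mem_chart_source (Eu (m + 1)) (baseProj p))
  constructor
  · intro h
    by_contra h0
    have h1 := (F.isFinslerOn _).posDef _ hm _ h0
    exact h1.ne' ((F.horMetric_self p X X).symm.trans (h X))
  · intro h Y
    rw [horMetric_self, h]
    simp

lemma isSplitPair : IsSplitPair F.horMetric F.verMetric where
  smooth_left := F.smoothForm_horMetric
  smooth_right := F.smoothForm_verMetric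
  symm_left p X Y := by
    have hm := F.unitCoord_mem (mem_chart_source (Eu (m + 1)) (baseProj p))
    rw [horMetric_self, horMetric_self, fundForm, (F.isFinslerOn _).vHess_symm hm]
  symm_right p X Y := by
    have hm := F.unitCoord_mem (mem_chart_source (Eu (m + 1)) (baseProj p))
    rw [verMetric_self, verMetric_self, ang, (F.isFinslerOn _).angForm_symm hm]
  nonneg_left p X := by
    have hm := F.unitCoord_mem (mem_chart_source (Eu (m + 1)) (baseProj p))
    rw [horMetric_self]
    by_cases h0 : (F.dUnit p X).1 = 0
    · rw [h0]; simp
    · exact ((F.isFinslerOn _).posDef _ hm _ h0).le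
  nonneg_right p X := by
    have hm := F.unitCoord_mem (mem_chart_source (Eu (m + 1)) (baseProj p))
    rw [verMetric_self]
    exact (F.isFinslerOn _).angForm_nonneg hm _
  pos p X hX := by
    have hm := F.unitCoord_mem (mem_chart_source (Eu (m + 1)) (baseProj p))
    have hf := F.isFinslerOn (baseProj p)
    have hv : 0 ≤ F.verMetric p X X := by
      rw [verMetric_self]
      exact hf.angForm_nonneg hm _
    by_cases h0 : (F.dUnit p X).1 = 0
    · have hh : 0 ≤ F.horMetric p X X := by
        rw [horMetric_self, h0]; simp
      refine lt_of_le_of_ne (add_nonneg hh hv) fun h => hX ?_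
      have h1 : F.verMetric p X X = 0 := by linarith
      have h2 : F.dUnit p X = (0, (F.dUnit p X).2) := Prod.ext h0 rfl
      rw [verMetric_self, h2, delta_vertical] at h1
      -- A null vector of the angular form is radial with coefficient F_y(η) / F. The coefficient is
      -- zero since the section stays in F = 1.
      have h3 := hf.eq_smul_of_angForm hm h1
      have h4 := F.fderiv_inCoord_dUnit p X
      rw [h2] at h4
      rw [vDiff_apply, h4, mul_zero, zero_smul] at h3
      exact F.dUnit_injective (p := p) (by rw [h2, h3]; rfl)
    · have h1 := hf.posDef _ hm _ h0
      have h2 : 0 < F.horMetric p X X := by rw [horMetric_self]; exact h1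
      linarith
  exists_split p X := by
    have hm := F.unitCoord_mem (mem_chart_source (Eu (m + 1)) (baseProj p))
    have hf := F.isFinslerOn (baseProj p)
    set u := F.unitCoord (baseProj p) p with hu
    set η := F.delta (baseProj p) u (F.dUnit p X) with hη
    -- `V` is the vertical vector carrying the non-radial part of δy(X). Then δy(X - V) is radial,
    -- hence null for the angular form; whether the radial part is zero does not matter.
    obtain ⟨V, hV⟩ : ∃ V : TangentSpace 𝓢 p, F.dUnit p V = _ :=
      F.exists_dUnit (hf.vDiff_sub hm η)
    refine ⟨X - V, fun Y => ?_, F.horMetric_eq_zero_iff.2 ?_⟩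
    · have h1 : F.dUnit p (X - V) = F.dUnit p X - F.dUnit p V := map_sub _ _ _
      rw [verMetric_self, h1, hV, map_sub, delta_vertical, ← hu, ← hη, sub_sub_cancel, map_smul,
        smul_apply, hf.angForm_self_left hm, smul_zero]
    · have h1 : X - (X - V) = V := sub_sub_cancel X V
      rw [h1]
      exact congrArg Prod.fst hV

/-- Both conditions say ẋ = 0: in the charts π is the projection (x, z) ↦ x, and h is definite in ẋ.
-/
lemma mem_vertical_iff {X : TangentSpace 𝓢 p} :
    X ∈ vertical p ↔ ∀ Y, F.horMetric p X Y = 0 := by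
  refine Iff.trans ?_ F.horMetric_eq_zero_iff.symm
  have h3 : (F.dUnit p X).1 = X.1 := dUnit_fst F X
  rw [h3]
  have hs := mem_chart_source (Eu (m + 1) × Eu m) p
  have hw : writtenInExtChartAt 𝓢 𝓘(ℝ, Eu (m + 1)) p (baseProj : SphereBundle m M → M) =ᶠ[𝓝
      (extChartAt 𝓢 p p)] Prod.fst := by
    filter_upwards [(chartAt (Eu (m + 1) × Eu m) p).open_target.mem_nhds
      ((chartAt (Eu (m + 1) × Eu m) p).map_source hs)] with z hz
    have h1 := chartAt_fst p ((chartAt (Eu (m + 1) × Eu m) p).symm z)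
    rw [(chartAt (Eu (m + 1) × Eu m) p).right_inv hz] at h1
    exact h1.symm
  have hd : MDifferentiableAt 𝓢 𝓘(ℝ, Eu (m + 1)) (baseProj : SphereBundle m M → M) p := by
    refine ⟨continuous_baseProj.continuousAt.continuousWithinAt, ?_⟩
    exact (hw.differentiableAt_iff.2 differentiableAt_fst).differentiableWithinAt
  have h2 : mfderiv 𝓢 𝓘(ℝ, Eu (m + 1)) (baseProj : SphereBundle m M → M) p X = X.1 := by
    have h4 := DFunLike.congr_fun (if_pos hd :
      mfderiv 𝓢 𝓘(ℝ, Eu (m + 1)) (baseProj : SphereBundle m M → M) p = _) X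
    refine h4.trans ?_
    simp only [modelWithCornersSelf_coe, range_id, fderivWithin_univ]
    rw [hw.fderiv_eq, fderiv_fst]
    rfl
  show mfderiv 𝓢 𝓘(ℝ, Eu (m + 1)) (baseProj : SphereBundle m M → M) p X = 0 ↔ _
  rw [h2]
  rfl

end FinslerStructure

lemma IsSplitPair.proj_eq_zero {E : Type*} [NormedAddCommGroup E] [NormedSpace ℝ E] {N : Type*}
    [TopologicalSpace N] [ChartedSpace E N] [IsManifold 𝓘(ℝ, E) ∞ N]
    {h w : Π p : N, TangentSpace 𝓘(ℝ, E) p → TangentSpace 𝓘(ℝ, E) p → ℝ} (H : IsSplitPair h w)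
    {P : Π p : N, TangentSpace 𝓘(ℝ, E) p → TangentSpace 𝓘(ℝ, E) p} (hP : IsSplitProj h w P)
    {p : N} {V : TangentSpace 𝓘(ℝ, E) p} (hV : ∀ Y, h p V Y = 0) : P p V = 0 := by
  by_contra h0
  have h1 := H.pos p _ h0
  have h2 := (hP p V).2 (P p V)
  rw [H.left_sub, hV] at h2
  rw [(hP p V).1] at h1
  linarith

/-! ### Identification of the limit with the Cartan connection; convergence -/

namespace FinslerStructure

variable {m : ℕ} {M : Type*} [TopologicalSpace M] [ChartedSpace (Eu (m + 1)) M]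
  [IsManifold 𝓘(ℝ, Eu (m + 1)) ∞ M] (F : FinslerStructure m M)

local notation "𝓢" => 𝓘(ℝ, Eu (m + 1) × Eu m)

variable {p : SphereBundle m M}

lemma sasakiMetric_eq (X Y : TangentSpace 𝓢 p) :
    F.sasakiMetric p X Y = F.horMetric p X Y + F.verMetric p X Y := by
  rw [sasakiMetric, rescaledMetric_eq, rescaled]
  simp

/-- If X is orthogonal to V(SM), then so is the vertical summand of its splitting, since the other
summand lies in ker w. That summand is therefore null, hence zero. -/
lemma mem_horizontal_iff {X : TangentSpace 𝓢 p} :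
    X ∈ F.horizontal p ↔ ∀ Y, F.verMetric p X Y = 0 := by
  have H := F.isSplitPair
  constructor
  · intro h
    obtain ⟨Z, hZ, hXZ⟩ := H.exists_split p X
    have h1 : F.sasakiMetric p X (X - Z) = 0 := h _ (F.mem_vertical_iff.2 hXZ)
    rw [sasakiMetric_eq, H.symm_left, hXZ, zero_add] at h1
    have h2 : X - Z = 0 := by
      by_contra h0
      have h3 := H.pos p _ h0
      rw [hXZ, H.right_sub, h1, hZ] at h3
      simp at h3
    rwa [sub_eq_zero.1 h2]
  · intro h V hV
    rw [sasakiMetric_eq, h, H.symm_left, F.mem_vertical_iff.1 hV, zero_add]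

/-- The orthogonal projection onto the horizontal space. -/
def horProj (p : SphereBundle m M) (X : TangentSpace 𝓢 p) : TangentSpace 𝓢 p :=
  orthProj (F.sasakiMetric p) (F.horizontal p) X

/-- The splitting supplies an orthogonal projection, so the choice in `orthProj` meets its
specification. Orthogonality of X - PX to ker w says that h(X - PX, ·) vanishes there, and it
vanishes on the complement ker h anyway. -/
lemma isSplitProj_horProj : IsSplitProj F.horMetric F.verMetric F.horProj := by
  intro p X
  have H := F.isSplitPair
  have hspec : F.horProj p X ∈ F.horizontal p ∧
      X - F.horProj p X ∈ orthCompl (F.sasakiMetric p) (F.horizontal p) := by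
    obtain ⟨Z, hZ, hXZ⟩ := H.exists_split p X
    refine Classical.epsilon_spec (p := fun z => z ∈ F.horizontal p ∧
      X - z ∈ orthCompl (F.sasakiMetric p) (F.horizontal p))
      ⟨Z, F.mem_horizontal_iff.2 hZ, fun W hW => ?_⟩
    rw [sasakiMetric_eq, hXZ, H.symm_right, F.mem_horizontal_iff.1 hW, zero_add]
  refine ⟨F.mem_horizontal_iff.1 hspec.1, fun Y => ?_⟩
  obtain ⟨Z, hZ, hYZ⟩ := H.exists_split p Y
  have h1 := hspec.2 Z (F.mem_horizontal_iff.2 hZ)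
  rw [sasakiMetric_eq, H.symm_right, hZ, add_zero] at h1
  have h2 := hYZ (X - F.horProj p X)
  rw [H.left_sub, H.symm_left, sub_eq_zero, H.symm_left p Z, h1] at h2
  exact h2

lemma orthProj_vertical (X : TangentSpace 𝓢 p) :
    orthProj (F.sasakiMetric p) (vertical p) X = X - F.horProj p X := by
  have H := F.isSplitPair
  have hP := F.isSplitProj_horProj
  have hspec : orthProj (F.sasakiMetric p) (vertical p) X ∈ vertical p ∧
      X - orthProj (F.sasakiMetric p) (vertical p) X ∈ F.horizontal p := by
    refine Classical.epsilon_spec (p := fun z => z ∈ vertical p ∧ X - z ∈ F.horizontal p)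
      ⟨X - F.horProj p X, F.mem_vertical_iff.2 (hP p X).2, ?_⟩
    rw [sub_sub_cancel]
    exact F.mem_horizontal_iff.2 (hP p X).1
  set V := orthProj (F.sasakiMetric p) (vertical p) X
  have h1 := H.proj_eq hP (F.mem_horizontal_iff.1 hspec.2)
  have h2 := H.proj_eq_zero hP (F.mem_vertical_iff.1 hspec.1)
  have h3 := H.proj_add hP (X - V) V
  rw [sub_add_cancel, h1, h2, add_zero] at h3
  rw [h3, sub_sub_cancel]

variable {X U : Π q : SphereBundle m M, TangentSpace 𝓘(ℝ, Eu (m + 1) × Eu m) q}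

lemma projH_eq (hU : ∀ p, U p ∈ F.horizontal p) : F.projH U = U :=
  funext fun p => F.isSplitPair.proj_eq F.isSplitProj_horProj (F.mem_horizontal_iff.1 (hU p))

lemma compressed_eq (ε : ℝ) (hU : ∀ p, U p ∈ F.horizontal p) (p : SphereBundle m M) :
    F.compressed ε X U p =
      F.horProj p (leviCivita 𝓢 (rescaled F.horMetric F.verMetric ε) U p (X p)) := by
  rw [compressed, F.projH_eq hU]
  rfl

lemma bott_eq (hU : ∀ p, U p ∈ F.horizontal p) (p : SphereBundle m M) :
    F.bott X U p = splitBott F.horMetric F.verMetric F.horProj X U p := by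
  have h1 : F.projV X = fun q => X q - F.horProj q (X q) :=
    funext fun q => F.orthProj_vertical (X q)
  rw [bott, F.compressed_eq 1 hU, h1]
  rfl

lemma isDualConnection_bott : F.IsDualConnection F.bott fun X U p =>
    (2 : ℝ) • limitConn F.horMetric F.verMetric F.horProj X U p -
      splitBott F.horMetric F.verMetric F.horProj X U p := by
  intro X U V hX hU hV p
  have H := F.isSplitPair
  have hP := F.isSplitProj_horProj
  have hUw (q) (Y : TangentSpace 𝓢 q) := F.mem_horizontal_iff.1 (hU.2 q) Y
  have hVw (q) (Y : TangentSpace 𝓢 q) := F.mem_horizontal_iff.1 (hV.2 q) Y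
  refine ⟨F.mem_horizontal_iff.2 fun Y => ?_, ?_⟩
  · rw [H.right_sub, H.right_smul, H.right_limitConn hP, H.right_splitBott hP]
    ring
  · have h1 : (fun q => F.sasakiMetric q (U q) (V q)) = fun q => F.horMetric q (U q) (V q) := by
      funext q
      rw [sasakiMetric_eq, hUw, add_zero]
    rw [h1, F.bott_eq hU.2, sasakiMetric_eq, sasakiMetric_eq, hUw, H.right_splitBott hP, add_zero,
      add_zero]
    exact H.mvfderiv_left_eq hP (hX p) (SmoothAt.diffField (hU.1 p)) (SmoothAt.diffField (hV.1 p))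
      hUw hVw

/-- Some dual exists by `isDualConnection_bott`, so the chosen one is dual. Duals agree on smooth
arguments because every horizontal vector extends to a global smooth horizontal section; the
extension uses bump functions, hence the Hausdorff property. -/
lemma bottDual_eq [T2Space M] (hX : SmoothField 𝓢 X) (hU : F.IsHorizontalSection U)
    (p : SphereBundle m M) : F.bottDual X U p =
      (2 : ℝ) • limitConn F.horMetric F.verMetric F.horProj X U p -
        splitBott F.horMetric F.verMetric F.horProj X U p := by
  have H := F.isSplitPair
  have hP := F.isSplitProj_horProj
  have h1 : F.IsDualConnection F.bott F.bottDual :=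
    Classical.epsilon_spec (p := F.IsDualConnection F.bott) ⟨_, F.isDualConnection_bott⟩
  have h2 := (F.isDualConnection_bott X U U hX hU hU p).1
  refine H.eq_of_forall_left (F.mem_horizontal_iff.1 (h1 X U U hX hU hU p).1)
    (F.mem_horizontal_iff.1 h2) fun z hz => ?_
  obtain ⟨Z, hZ, rfl⟩ := exists_smoothField p z
  have hW : F.IsHorizontalSection fun q => F.horProj q (Z q) :=
    ⟨fun q => H.smoothAt_proj hP (hZ q), fun q => F.mem_horizontal_iff.2 (hP q _).1⟩
  have h3 := (h1 X _ U hX hW hU p).2.symm.trans (F.isDualConnection_bott X _ U hX hW hU p).2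
  simp only [H.proj_eq hP hz, sasakiMetric_eq, hz, add_zero] at h3
  rw [H.symm_left, H.symm_left p _ (Z p)]
  exact add_left_cancel h3

lemma symmBott_eq [T2Space M] (hX : SmoothField 𝓢 X) (hU : F.IsHorizontalSection U)
    (p : SphereBundle m M) :
    F.symmBott X U p = limitConn F.horMetric F.verMetric F.horProj X U p := by
  rw [symmBott, cartanEndo, F.bottDual_eq hX hU, F.bott_eq hU.2]
  module

/-- The difference between the compressed connection at `ε = 1` and the limit connection. -/
def connDefect (X U : Π q : SphereBundle m M, TangentSpace 𝓘(ℝ, Eu (m + 1) × Eu m) q)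
    (p : SphereBundle m M) : TangentSpace 𝓘(ℝ, Eu (m + 1) × Eu m) p :=
  F.horProj p (leviCivita 𝓘(ℝ, Eu (m + 1) × Eu m)
    (rescaled F.horMetric F.verMetric 1) U p (X p)) -
    limitConn F.horMetric F.verMetric F.horProj X U p

lemma compressed_eq_add [T2Space M] (hX : SmoothField 𝓢 X) (hU : F.IsHorizontalSection U) {ε : ℝ}
    (hε : 0 < ε) (p : SphereBundle m M) :
    F.compressed ε X U p = F.symmBott X U p + ε ^ 2 • F.connDefect X U p := by
  have hUw (q) (Y : TangentSpace 𝓢 q) := F.mem_horizontal_iff.1 (hU.2 q) Y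
  rw [F.compressed_eq ε hU.2, F.symmBott_eq hX hU,
    F.isSplitPair.proj_leviCivita_eq F.isSplitProj_horProj (SmoothAt.diffField (hX p))
      (SmoothAt.diffField (hU.1 p)) hUw hε, connDefect]

lemma tendsto_compressed [T2Space M] (hX : SmoothField 𝓢 X) (hU : F.IsHorizontalSection U)
    (p : SphereBundle m M) :
    Tendsto (fun ε : ℝ => F.compressed ε X U p) (𝓝[>] 0) (𝓝 (F.symmBott X U p)) := by
  have h1 : Tendsto (fun ε : ℝ => F.symmBott X U p + ε ^ 2 • F.connDefect X U p) (𝓝[>] 0)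
      (𝓝 (F.symmBott X U p)) := by
    have h2 : Continuous fun ε : ℝ => F.symmBott X U p + ε ^ 2 • F.connDefect X U p := by fun_prop
    have h3 := (h2.tendsto 0).mono_left (nhdsWithin_le_nhds (s := Ioi 0))
    simpa using h3
  refine h1.congr' ?_
  filter_upwards [self_mem_nhdsWithin] with ε hε using (F.compressed_eq_add hX hU hε p).symm

lemma tendstoUniformlyOn_compressed [T2Space M] (hX : SmoothField 𝓢 X)
    (hU : F.IsHorizontalSection U) {K : Set (SphereBundle m M)} (hK : IsCompact K) :
    TendstoUniformlyOn
      (fun (ε : ℝ) p => F.sasakiMetric p (F.compressed ε X U p - F.symmBott X U p)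
        (F.compressed ε X U p - F.symmBott X U p))
      (fun _ => 0) (𝓝[>] 0) K := by
  have H := F.isSplitPair
  have hP := F.isSplitProj_horProj
  have hUw (q) (Y : TangentSpace 𝓢 q) := F.mem_horizontal_iff.1 (hU.2 q) Y
  obtain ⟨c, hc⟩ : ∃ c, ∀ p ∈ K,
      F.sasakiMetric p (F.connDefect X U p) (F.connDefect X U p) ≤ c := by
    refine hK.induction_on (p := fun s => ∃ c, ∀ p ∈ s,
        F.sasakiMetric p (F.connDefect X U p) (F.connDefect X U p) ≤ c)
      -- Boundedness passes to subsets and finite unions, so by compactness the local bounds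
      -- suffice.
      ⟨0, by simp⟩ (fun s t hst ⟨c, hc⟩ => ⟨c, fun p hp => hc p (hst hp)⟩) ?_ ?_
    · rintro s t ⟨c, hc⟩ ⟨d, hd⟩
      refine ⟨max c d, fun p hp => hp.elim (fun h => (hc p h).trans (le_max_left _ _))
        fun h => (hd p h).trans (le_max_right _ _)⟩
    · intro p _
      obtain ⟨c, hc⟩ := H.exists_bound hP hX hU.1 hUw p
      exact ⟨_, mem_nhdsWithin_of_mem_nhds hc, c, fun q hq => hq⟩
  -- The squared norm is measured, so the factor ε² of the defect enters as ε⁴.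
  have hs (ε : ℝ) (p) : F.sasakiMetric p (ε ^ 2 • F.connDefect X U p) (ε ^ 2 • F.connDefect X U p) =
      ε ^ 4 * F.sasakiMetric p (F.connDefect X U p) (F.connDefect X U p) := by
    rw [F.sasakiMetric_eq, F.sasakiMetric_eq, H.left_smul, H.right_smul, H.symm_left,
      H.symm_right, H.left_smul, H.right_smul]
    ring
  have h0 (p) : 0 ≤ F.sasakiMetric p (F.connDefect X U p) (F.connDefect X U p) := by
    rw [F.sasakiMetric_eq]
    exact add_nonneg (H.nonneg_left p _) (H.nonneg_right p _)
  have hlim : Tendsto (fun ε : ℝ => ε ^ 4 * c) (𝓝[>] 0) (𝓝 0) := by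
    have h2 : Continuous fun ε : ℝ => ε ^ 4 * c := by fun_prop
    have h3 := (h2.tendsto 0).mono_left (nhdsWithin_le_nhds (s := Ioi 0))
    simpa using h3
  rw [Metric.tendstoUniformlyOn_iff]
  intro δ hδ
  filter_upwards [self_mem_nhdsWithin, hlim.eventually (gt_mem_nhds hδ)] with ε hε hlt p hp
  have hε4 : 0 ≤ ε ^ 4 := by positivity
  rw [F.compressed_eq_add hX hU hε, add_sub_cancel_left, hs, dist_zero_left, Real.norm_of_nonneg
    (mul_nonneg hε4 (h0 p))]
  exact (mul_le_mul_of_nonneg_left (hc p hp) hε4).trans_lt hlt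

end FinslerStructure

end Finsler

end

theorem proposition1 {m : ℕ} {M : Type*} [TopologicalSpace M]
    [ChartedSpace (Finsler.Eu (m + 1)) M] [IsManifold 𝓘(ℝ, Finsler.Eu (m + 1)) ∞ M] [T2Space M]
    (F : Finsler.FinslerStructure m M)
    (X U : Π p : Finsler.SphereBundle m M,
      TangentSpace 𝓘(ℝ, Finsler.Eu (m + 1) × Finsler.Eu m) p)
    (hX : Finsler.SmoothField 𝓘(ℝ, Finsler.Eu (m + 1) × Finsler.Eu m) X)
    (hU : F.IsHorizontalSection U) :
    (∀ p, Tendsto (fun ε : ℝ => F.compressed ε X U p) (𝓝[>] 0) (𝓝 (F.symmBott X U p))) ∧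
    ∀ K : Set (Finsler.SphereBundle m M), IsCompact K →
      TendstoUniformlyOn
        (fun (ε : ℝ) p => F.sasakiMetric p (F.compressed ε X U p - F.symmBott X U p)
          (F.compressed ε X U p - F.symmBott X U p))
        (fun _ => 0) (𝓝[>] 0) K := by
  exact ⟨F.tendsto_compressed hX hU, fun _ hK => F.tendstoUniformlyOn_compressed hX hU hK⟩
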